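/- **Setting.** Let $T>0$, $\rho>0$, let $\Omega\subset\mathbb R^3$ be a bounded domain with Lipschitz boundary, $\Gamma_D\subset\partial\Omega$ measurable, $\Gamma_N=\partial\Omega\setminus\Gamma_D$, and let $n$ be the outer unit normal. Let $\mathbb R^{3\times3}_{\rm sym}$ and $\mathbb R^{3\times3}_{\rm sym,0}$ denote the symmetric and the symmetric trace-free matrices, $\mathbb A:\mathbb B=\sum_{j,k}\mathbb A_{jk}\mathbb B_{jk}$, $\operatorname{dev}\mathbb A=\mathbb A-\frac13(\operatorname{tr}\mathbb A)\mathbb I$, $\mathbb D(v)=\frac12(\nabla v+\nabla v^\top)$, $\mathbb W(v)=\frac12(\nabla v-\nabla v^\top)$. Conditions on parts of $\partial\Omega$ are understood almost everywhere with respect to surface measure, unless stated otherwise. Assume: - $f\in L^1(0,T;L^2(\Omega;\mathbb R^3))$, and $\mathbb S(v)=\mathbb L[\mathbb D(v)]$ with $\mathbb L:\mathbb R^{3\times3}_{\rm sym}\to\mathbb R^{3\times3}_{\rm sym}$ linear and $\mathbb L[\mathbb A]:\mathbb A\ge\mu_*|\mathbb A|^2$ for some $\mu_*>0$; - $\mathcal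 P:L^1(\Omega;\mathbb R^{3\times3}_{\rm sym,0})\to[0,\infty]$ is convex and lower semicontinuous with $\mathcal P(0)=0$; - $\varphi\in C^3(\mathbb R^{3\times3}_{\rm sym};[0,\infty))$, $\varphi-\frac\kappa2|\cdot|^2$ is convex for some $\kappa>0$, $1+\varphi(\mathbb A)\ge\beta|\mathbb A|^2$ for some $\beta>0$, $|D^3\varphi|\le M$ for some $M>0$, and $D\varphi(\mathbb A)\mathbb A=\mathbb A\,D\varphi(\mathbb A)$ for all $\mathbb A$; - (approximation property) for every $\mathbb A\in L^1(\Omega;\mathbb R^{3\times3}_{\rm sym,0})$ there are $\Phi_j\in C^1(\overline\Omega;\mathbb R^{3\times3}_{\rm sym,0})$ with $\Phi_j\rightharpoonup\mathbb A$ weakly in $L^1$ and $\mathcal P(\Phi_j)\to\mathcal P(\mathbb A)$. Put $\mathcal E(v,\mathbb E)=\int_\Omega\frac\rho2|v|^2+\varphi(\mathbb E)\,dx$ and $\mathbb T=D\varphi(\mathbb E)+\varphi(\mathbb E)\mathbb I$. Let $v_0\in L^1(\Omega;\mathbb R^3)$, $\mathbb E_0\in L^1(\Omega;\mathbb R^{3\times3}_{\rm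 sym})$ with $\mathcal E(v_0,\mathbb E_0)<\infty$. **Energy-variational solutions.** A pair of test functions consists of $\psi\in C^1_c([0,T)\times\overline\Omega;\mathbb R^3)$ with $\psi=0$ on $(0,T)\times\Gamma_D$ and $\psi\cdot n=0$ on $(0,T)\times\Gamma_N$, and $\Psi\in C^1_c([0,T)\times\overline\Omega;\mathbb R^{3\times3}_{\rm sym})$. A triple $(v,\mathbb E,E)$ is an energy-variational solution if $v\in L^\infty(0,T;L^2)\cap L^2(0,T;H^1)$, $\mathbb E\in L^\infty(0,T;L^2(\Omega;\mathbb R^{3\times3}_{\rm sym}))$, $E\in BV([0,T])$, $v=0$ on $(0,T)\times\Gamma_D$ and $v\cdot n=0$ on $(0,T)\times\Gamma_N$ in the sense of traces, $\mathcal E(v,\mathbb E)\le E$ a.e. in $(0,T)$, and the following hold. 1. There is $\mathcal K:C^1(\overline\Omega;\mathbb R^3\times\mathbb R^{3\times3}_{\rm sym})\to[0,\infty)$ such that $t\mapsto\mathcal K(\psi(t),\Psi(t))$ is integrable on $(0,T)$ for every pair of test functions, and for a.a. $s<t$ in $[0,T]$ and all pairs of test functions $$\begin{aligned}&\Big[E-\int_\Omega\rho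 v\cdot\psi+\mathbb E:\Psi\,dx\Big]\Big|_s^t+\int_s^t\!\int_\Omega\mathbb S(v):\mathbb D(v)-f\cdot v\,dx\,dt'\\&+\int_s^t\!\int_\Omega\rho v\cdot\partial_t\psi+\tfrac\rho2(\operatorname{div}v)(v\cdot\psi)+\rho(v\otimes v):\nabla\psi\,dx\,dt'\\&+\int_s^t\!\int_\Omega-(\mathbb S(v)+D\varphi(\mathbb E)):\mathbb D(\psi)-\varphi(\mathbb E)\operatorname{div}\psi+f\cdot\psi\,dx\,dt'\\&+\int_s^t\!\int_\Omega\mathbb E:\partial_t\Psi+(\operatorname{div}v)\mathbb E:\Psi+v\cdot\nabla\Psi:\mathbb E-(\mathbb E\mathbb W(v)-\mathbb W(v)\mathbb E):\Psi+\mathbb D(v):\Psi\,dx\,dt'\\&+\int_s^t\mathcal P(\operatorname{dev}D\varphi(\mathbb E))-\mathcal P(\operatorname{dev}\Psi)\,dt'\le\int_s^t\mathcal K(\psi,\Psi)\,(E-\mathcal E(v,\mathbb E))\,dt'\end{aligned}$$ (a trivial condition if $\int_s^t\mathcal P(\operatorname{dev}\Psi)\,dt'=\infty$). 2. The initial values are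 attained weakly*: $\int_\Omega\rho v(s)\cdot\psi+\mathbb E(s):\Psi\,dx\to\int_\Omega\rho v_0\cdot\psi+\mathbb E_0:\Psi\,dx$ as $s\searrow0$ outside a null set, for all $\psi\in C^1(\overline\Omega;\mathbb R^3)$ with $\psi=0$ on $\Gamma_D$, $\psi\cdot n=0$ on $\Gamma_N$ and all $\Psi\in C^1(\overline\Omega;\mathbb R^{3\times3}_{\rm sym})$. **Proposition.** Let $(v,\mathbb E,E)$ be an energy-variational solution with $\lim_{t\searrow0}E(t)=\mathcal E(v_0,\mathbb E_0)$ and $$v\in C^1([0,T];C^2(\overline\Omega;\mathbb R^3)),\qquad\mathbb E\in C^1([0,T];C^1(\overline\Omega;\mathbb R^{3\times3}_{\rm sym})).$$ Then $E=\mathcal E(v,\mathbb E)$ a.e. in $(0,T)$, and $(v,\mathbb E)$ satisfies the system pointwise: - $\rho(\partial_tv+v\cdot\nabla v)=\operatorname{div}(\mathbb S(v)+\mathbb T)-\frac\rho2(\operatorname{div}v)v+f$ almost everywhere in $(0,T)\times\Omega$; - for every $t\in(0,T)$ there is $\Xi\in\partial\mathcal P(\operatorname{dev}\mathbb T(t))\subset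 L^\infty(\Omega;\mathbb R^{3\times3}_{\rm sym,0})$ with $\partial_t\mathbb E+v\cdot\nabla\mathbb E+\mathbb E\mathbb W(v)-\mathbb W(v)\mathbb E+\Xi=\mathbb D(v)$ at every point of $\Omega$; - for every $t\in(0,T)$: $v=0$ on $\Gamma_D$ and $v\cdot n=0$ on $\Gamma_N$, and the tangential part of $(\mathbb T+\mathbb S(v))n$ vanishes at every point of $\Gamma_N$ that has a neighbourhood in which $\partial\Omega$ is a $C^2$ surface and which meets $\Gamma_D$ at most in a set of surface measure zero; - $v(0)=v_0$ and $\mathbb E(0)=\mathbb E_0$ almost everywhere in $\Omega$. -/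

import Mathlib

open Set Filter Topology MeasureTheory
open scoped ENNReal NNReal RealInnerProductSpace Matrix.Norms.Frobenius

noncomputable section

namespace ViscoElastoPlastic

/-! ### Vectors and matrices -/

/-- `ℝ³` with the Euclidean norm. -/
abbrev V : Type := EuclideanSpace ℝ (Fin 3)

/-- Real `3 × 3` matrices, normed by the Frobenius norm. -/
abbrev Mat : Type := Matrix (Fin 3) (Fin 3) ℝ

/-- The subspace of symmetric matrices. -/
def symSubmodule : Submodule ℝ Mat where
  carrier := {A | A.transpose = A}
  add_mem' := by
    intro A B hA hB
    simp only [mem_ofPred_eq] at hA hB ⊢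
    rw [Matrix.transpose_add, hA, hB]
  zero_mem' := Matrix.transpose_zero
  smul_mem' := by
    intro c A hA
    simp only [mem_ofPred_eq] at hA ⊢
    rw [Matrix.transpose_smul, hA]

/-- The subspace of symmetric deviatoric (trace-free) matrices. -/
def symDevSubmodule : Submodule ℝ Mat where
  carrier := {A | A.transpose = A ∧ A.trace = 0}
  add_mem' := by
    rintro A B ⟨hA, hA0⟩ ⟨hB, hB0⟩
    exact ⟨by rw [Matrix.transpose_add, hA, hB], by rw [Matrix.trace_add, hA0, hB0, add_zero]⟩
  zero_mem' := ⟨Matrix.transpose_zero, Matrix.trace_zero _ _⟩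
  smul_mem' := by
    rintro c A ⟨hA, hA0⟩
    exact ⟨by rw [Matrix.transpose_smul, hA], by rw [Matrix.trace_smul, hA0, smul_zero]⟩

/-- Symmetric matrices, with the Frobenius norm. -/
def SymMat : Type := symSubmodule

/-- Symmetric deviatoric matrices, with the Frobenius norm. -/
def DevMat : Type := symDevSubmodule

instance : NormedAddCommGroup SymMat := inferInstanceAs (NormedAddCommGroup symSubmodule)
instance : NormedSpace ℝ SymMat := inferInstanceAs (NormedSpace ℝ symSubmodule)
instance : FiniteDimensional ℝ SymMat := inferInstanceAs (FiniteDimensional ℝ symSubmodule)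
instance : NormedAddCommGroup DevMat := inferInstanceAs (NormedAddCommGroup symDevSubmodule)
instance : NormedSpace ℝ DevMat := inferInstanceAs (NormedSpace ℝ symDevSubmodule)
instance : FiniteDimensional ℝ DevMat := inferInstanceAs (FiniteDimensional ℝ symDevSubmodule)

/-- The inclusion of the symmetric matrices. -/
def SymMat.incl : SymMat →ₗ[ℝ] Mat := symSubmodule.subtype

/-- The inclusion of the symmetric deviatoric matrices. -/
def DevMat.incl : DevMat →ₗ[ℝ] Mat := symDevSubmodule.subtype

instance : Coe SymMat Mat := ⟨fun A => SymMat.incl A⟩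
instance : Coe DevMat Mat := ⟨fun A => DevMat.incl A⟩

/-- A symmetric matrix as an element of `SymMat`. -/
def SymMat.mk (A : Mat) (hA : A.transpose = A) : SymMat := (⟨A, hA⟩ : symSubmodule)

/-- A symmetric deviatoric matrix as an element of `DevMat`. -/
def DevMat.mk (A : Mat) (hA : A.transpose = A ∧ A.trace = 0) : DevMat :=
  (⟨A, hA⟩ : symDevSubmodule)

@[simp] theorem SymMat.incl_mk (A : Mat) (hA : A.transpose = A) : SymMat.incl (SymMat.mk A hA) = A := rfl

@[simp] theorem DevMat.incl_mk (A : Mat) (hA : A.transpose = A ∧ A.trace = 0) :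
    DevMat.incl (DevMat.mk A hA) = A := rfl

theorem SymMat.incl_injective : Function.Injective SymMat.incl := symSubmodule.injective_subtype

theorem DevMat.incl_injective : Function.Injective DevMat.incl :=
  symDevSubmodule.injective_subtype

theorem SymMat.transpose_eq (A : SymMat) : (A : Mat).transpose = (A : Mat) := Subtype.property A

/-- The Euclidean inner product `A : B` of matrices. -/
def frob (A B : Mat) : ℝ := ∑ i, ∑ j, A i j * B i j

/-- The symmetric part of a matrix. -/
def symPart (A : Mat) : SymMat :=
  SymMat.mk ((1 / 2 : ℝ) • (A + A.transpose)) (by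
    rw [Matrix.transpose_smul, Matrix.transpose_add, Matrix.transpose_transpose, add_comm])

/-- The skew-symmetric part of a matrix. -/
def skewPart (A : Mat) : Mat := (1 / 2 : ℝ) • (A - A.transpose)

/-- The deviatoric part of a symmetric matrix. -/
def dev (A : SymMat) : DevMat :=
  DevMat.mk ((A : Mat) - ((1 / 3 : ℝ) * (A : Mat).trace) • (1 : Mat)) (by
    refine ⟨by rw [Matrix.transpose_sub, Matrix.transpose_smul, A.transpose_eq,
      Matrix.transpose_one], ?_⟩
    rw [Matrix.trace_sub, Matrix.trace_smul, Matrix.trace_one]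
    simp only [Fintype.card_fin, smul_eq_mul]
    push_cast
    ring)

/-- The matrix of a linear map of `ℝ³`; for the derivative of a vector field this is the
Jacobian matrix with entries `∂ⱼ uᵢ`. -/
def toMat (G : V →L[ℝ] V) : Mat := Matrix.of fun i j => G (EuclideanSpace.single j 1) i

/-- `𝔻(v)`, as a function of the gradient of `v`. -/
def strainRate (G : V →L[ℝ] V) : SymMat := symPart (toMat G)

/-- `𝕎(v)`, as a function of the gradient of `v`. -/
def spin (G : V →L[ℝ] V) : Mat := skewPart (toMat G)

/-- `div v`, as a function of the gradient of `v`. -/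
def divg (G : V →L[ℝ] V) : ℝ := (toMat G).trace

/-- The derivative `Dφ(A)` of a function on symmetric matrices, as a symmetric matrix: its
`(i, j)` entry is the derivative in the direction of the symmetric part of the matrix unit. -/
def gradSym (φ : SymMat → ℝ) (A : SymMat) : SymMat :=
  SymMat.mk (Matrix.of fun i j => fderiv ℝ φ A (symPart (Matrix.single i j 1))) (by
    ext i j
    have h : symPart (Matrix.single j i 1) = symPart (Matrix.single i j 1) := by
      apply SymMat.incl_injective
      simp [symPart, Matrix.transpose_single, add_comm]
    simp [h])

/-- `gradSym` represents the Fréchet derivative with respect to the product `A : B`. -/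
theorem frob_gradSym (φ : SymMat → ℝ) (A H : SymMat) :
    frob (gradSym φ A : Mat) (H : Mat) = fderiv ℝ φ A H := by
  have hH : (H : Mat).transpose = (H : Mat) := H.transpose_eq
  have key : H = ∑ i, ∑ j, (H : Mat) i j • symPart (Matrix.single i j 1) := by
    apply SymMat.incl_injective
    have h2 : ∑ i, ∑ j, (H : Mat) i j • (Matrix.single i j 1 : Mat) = (H : Mat) := by
      conv_rhs => rw [Matrix.matrix_eq_sum_single (H : Mat)]
      simp [Matrix.smul_single]
    have h3 : ∑ i, ∑ j, (H : Mat) i j • (Matrix.single i j 1 : Mat).transpose = (H : Mat) := by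
      conv_rhs => rw [← hH, ← h2]
      simp [Matrix.transpose_sum]
    simp only [map_sum, map_smul, symPart, SymMat.incl_mk]
    calc (H : Mat) = (1 / 2 : ℝ) • ((H : Mat) + (H : Mat)) := by module
      _ = (1 / 2 : ℝ) • (∑ i, ∑ j, (H : Mat) i j • (Matrix.single i j 1 : Mat)
            + ∑ i, ∑ j, (H : Mat) i j • (Matrix.single i j 1 : Mat).transpose) := by rw [h2, h3]
      _ = _ := by
        simp only [← Finset.sum_add_distrib, Finset.smul_sum]
        refine Finset.sum_congr rfl fun i _ => Finset.sum_congr rfl fun j _ => ?_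
        module
  conv_rhs => rw [key]
  simp only [map_sum, map_smul, smul_eq_mul, frob, gradSym, SymMat.incl_mk, Matrix.of_apply]
  refine Finset.sum_congr rfl fun i _ => Finset.sum_congr rfl fun j _ => mul_comm _ _

/-! ### Function spaces -/

/-- `u ∈ Cⁿ(Ū)` for an open set `U`: `u` is `Cⁿ` in `U`, continuous on the closure, and all
derivatives up to order `n` extend continuously from `U` to the closure. -/
def ContDiffUpTo {X F : Type*} [NormedAddCommGroup X] [NormedSpace ℝ X] [NormedAddCommGroup F]
    [NormedSpace ℝ F] (n : ℕ) (U : Set X) (u : X → F) : Prop :=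
  ContDiffOn ℝ n u U ∧ ContinuousOn u (closure U) ∧
    ∀ j ≤ n, ∃ g : X → ContinuousMultilinearMap ℝ (fun _ : Fin j => X) F,
      ContinuousOn g (closure U) ∧ EqOn g (iteratedFDeriv ℝ j u) U

/-- Convergence in the norm of `Cⁿ(Ū)`: uniform convergence on `U` of all derivatives up to
order `n`. -/
def TendstoCn {ι X F : Type*} [NormedAddCommGroup X] [NormedSpace ℝ X] [NormedAddCommGroup F]
    [NormedSpace ℝ F] (n : ℕ) (U : Set X) (l : Filter ι) (u : ι → X → F) (u₀ : X → F) : Prop :=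
  ∀ j ≤ n, TendstoUniformlyOn (fun i x => iteratedFDeriv ℝ j (u i) x) (iteratedFDeriv ℝ j u₀) l U

/-- `u ∈ C¹([0,T]; Cⁿ(Ū))`: there is a map `w : [0,T] → Cⁿ(Ū)` which is continuous and is the
limit of the difference quotients of `u`, both with respect to the norm of `Cⁿ(Ū)`. -/
def C1InTime {X F : Type*} [NormedAddCommGroup X] [NormedSpace ℝ X] [NormedAddCommGroup F]
    [NormedSpace ℝ F] (T : ℝ) (n : ℕ) (U : Set X) (u : ℝ → X → F) : Prop :=
  (∀ t ∈ Icc 0 T, ContDiffUpTo n U (u t)) ∧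
    ∃ w : ℝ → X → F, (∀ t ∈ Icc 0 T, ContDiffUpTo n U (w t)) ∧
      (∀ t ∈ Icc 0 T, TendstoCn n U (𝓝[Icc 0 T] t) w (w t)) ∧
      ∀ t ∈ Icc 0 T,
        TendstoCn n U (𝓝[Icc 0 T \ {t}] t) (fun s => (s - t)⁻¹ • (u s - u t)) (w t)

/-- `u ∈ L^p(0,T; L^q(Ω))`. -/
def MemLpLq {F : Type*} [NormedAddCommGroup F] (p q : ℝ≥0∞) (T : ℝ) (Ω : Set V)
    (u : ℝ → V → F) : Prop :=
  AEStronglyMeasurable (Function.uncurry u)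
      ((volume.restrict (Ioo 0 T)).prod (volume.restrict Ω)) ∧
    eLpNorm (fun t => eLpNorm (u t) q (volume.restrict Ω)) p (volume.restrict (Ioo 0 T)) < ∞

/-- `G` is the weak gradient of the vector field `u` on the open set `Ω`. -/
def IsWeakGradient (Ω : Set V) (u : V → V) (G : V → V →L[ℝ] V) : Prop :=
  ∀ η : V → ℝ, ContDiff ℝ (⊤ : ℕ∞) η → HasCompactSupport η → tsupport η ⊆ Ω → ∀ e : V,
    ∫ x in Ω, (fderiv ℝ η x e) • u x = -∫ x in Ω, η x • G x e

/-! ### Domains, normals, traces -/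

/-- Near `p`, after a rigid motion, the set `Ω` is the region below the graph of a function with
the property `Reg`. The graph direction is the unit vector `w`, and the function is evaluated
on the plane orthogonal to `w`. -/
def IsSubgraphNear (Reg : (V → ℝ) → Prop) (Ω : Set V) (p : V) : Prop :=
  ∃ w : V, ‖w‖ = 1 ∧ ∃ h : V → ℝ, Reg h ∧ ∃ r > 0, ∀ y ∈ Metric.ball p r,
    (y ∈ Ω ↔ ⟪y, w⟫ < h (y - ⟪y, w⟫ • w))

/-- Bounded domains with Lipschitz boundary. -/
def IsLipschitzDomain (Ω : Set V) : Prop :=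
  IsOpen Ω ∧ IsConnected Ω ∧ Bornology.IsBounded Ω ∧
    ∀ p ∈ frontier Ω, IsSubgraphNear (fun h => ∃ K, LipschitzWith K h) Ω p

/-- Surface measure up to a constant factor; only its null sets are used. -/
def surf : Measure V := Measure.hausdorffMeasure 2

/-- `n` is the outer unit normal of `Ω` at the boundary point `x`: the set `Ω` is tangent at `x`
to the half space `{y | ⟪y - x, n⟫ < 0}`. At a boundary point of a Lipschitz domain such an `n`
exists precisely if the graph function is differentiable there, hence at almost every point. -/
def IsOuterNormal (Ω : Set V) (x n : V) : Prop :=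
  x ∈ frontier Ω ∧ ‖n‖ = 1 ∧ ∀ ε > 0, ∃ r > 0, ∀ y ∈ Metric.ball x r,
    (⟪y - x, n⟫ < -ε * ‖y - x‖ → y ∈ Ω) ∧ (ε * ‖y - x‖ < ⟪y - x, n⟫ → y ∉ Ω)

/-- The trace of `u` at the boundary point `x` is `g`: the averages of `|u - g|` over
`Ω ∩ B_r(x)` tend to zero. For Sobolev functions on Lipschitz domains this determines the usual
trace almost everywhere on the boundary, and for functions that are continuous up to the
boundary it is the boundary value. -/
def HasTrace (Ω : Set V) (u : V → V) (x g : V) : Prop :=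
  Tendsto (fun r : ℝ => ⨍ y in Metric.ball x r ∩ Ω, ‖u y - g‖) (𝓝[>] 0) (𝓝 0)

/-! ### The model -/

/-- The data of the model. -/
structure Model where
  /-- final time -/
  T : ℝ
  /-- density -/
  ρ : ℝ
  /-- spatial domain -/
  Ω : Set V
  /-- Dirichlet part of the boundary -/
  ΓD : Set V
  /-- external force -/
  f : ℝ → V → V
  /-- the linear map that gives the viscous stress -/
  L : SymMat →ₗ[ℝ] SymMat
  /-- stored elastic energy density -/
  φ : SymMat → ℝ
  /-- (dual) dissipation potential on `L¹(Ω; DevMat)` -/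
  P : Lp DevMat 1 ((volume : Measure V).restrict Ω) → ℝ≥0∞

namespace Model

variable (m : Model)

/-- The Neumann (perfect slip) part of the boundary. -/
def ΓN : Set V := frontier m.Ω \ m.ΓD

/-- Lebesgue measure on `(0,T)`. -/
def μT : Measure ℝ := volume.restrict (Ioo 0 m.T)

/-- Lebesgue measure on `Ω`. -/
def μΩ : Measure V := volume.restrict m.Ω

/-- The assumptions on the data. -/
structure Standing : Prop where
  T_pos : 0 < m.T
  ρ_pos : 0 < m.ρ
  domain : IsLipschitzDomain m.Ω
  ΓD_subset : m.ΓD ⊆ frontier m.Ω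
  ΓD_meas : MeasurableSet m.ΓD
  force : MemLpLq 1 2 m.T m.Ω m.f
  viscous : ∃ μ > 0, ∀ A : SymMat, μ * ‖A‖ ^ 2 ≤ frob (m.L A) A
  P_convex : ∀ (A B : Lp DevMat 1 ((volume : Measure V).restrict m.Ω)) (a b : ℝ≥0), a + b = 1 →
    m.P ((a : ℝ) • A + (b : ℝ) • B) ≤ a * m.P A + b * m.P B
  P_lsc : LowerSemicontinuous m.P
  P_zero : m.P 0 = 0
  φ_smooth : ContDiff ℝ 3 m.φ
  φ_nonneg : ∀ A, 0 ≤ m.φ A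
  φ_strongConvex : ∃ κ > 0, ConvexOn ℝ univ fun A : SymMat => m.φ A - κ / 2 * ‖A‖ ^ 2
  φ_growth : ∃ β > 0, ∀ A : SymMat, β * ‖A‖ ^ 2 ≤ 1 + m.φ A
  φ_third : ∃ M > 0, ∀ A : SymMat, ‖iteratedFDeriv ℝ 3 m.φ A‖ ≤ M
  φ_commute : ∀ A : SymMat, (gradSym m.φ A : Mat) * (A : Mat) = (A : Mat) * (gradSym m.φ A : Mat)

/-- The approximation property of `P`: every `A ∈ L¹` is the weak limit in `L¹` of functions in
`C¹(Ω̄)` along which `P` converges to `P A`. -/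
def ApproximationProperty : Prop :=
  ∀ A : Lp DevMat 1 ((volume : Measure V).restrict m.Ω),
    ∃ B : ℕ → Lp DevMat 1 ((volume : Measure V).restrict m.Ω),
      (∀ j, ∃ Φ : V → DevMat, ContDiffUpTo 1 m.Ω Φ ∧ B j =ᵐ[m.μΩ] Φ) ∧
      (∀ ℓ : StrongDual ℝ (Lp DevMat 1 ((volume : Measure V).restrict m.Ω)),
        Tendsto (fun j => ℓ (B j)) atTop (𝓝 (ℓ A))) ∧
      Tendsto (fun j => m.P (B j)) atTop (𝓝 (m.P A))

open Classical in
/-- The potential `P` evaluated at (the class of) a function; the value is `∞` if the function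
is not in `L¹`. -/
def potential (u : V → DevMat) : ℝ≥0∞ :=
  if h : MemLp u 1 ((volume : Measure V).restrict m.Ω) then m.P (h.toLp u) else ∞

/-- The density of the total energy. -/
def energyDensity (v : V → V) (E : V → SymMat) (x : V) : ℝ := m.ρ / 2 * ‖v x‖ ^ 2 + m.φ (E x)

/-- The total energy `ℰ(v, E)`; meaningful if the density is integrable. -/
def energy (v : V → V) (E : V → SymMat) : ℝ := ∫ x in m.Ω, m.energyDensity v E x

/-- The viscous stress, as a function of the velocity gradient. -/
def viscousStress (G : V →L[ℝ] V) : SymMat := m.L (strainRate G)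

/-- The stress `Dφ(E) + φ(E) 𝕀`. -/
def elasticStress (A : SymMat) : Mat := (gradSym m.φ A : Mat) + m.φ A • (1 : Mat)

/-! ### Test functions -/

/-- The boundary conditions of the test functions: `ψ = 0` on the Dirichlet part and `ψ · n = 0`
on the Neumann part, almost everywhere with respect to surface measure. -/
def TestBoundary (ψ : V → V) : Prop :=
  (∀ᵐ x ∂surf.restrict m.ΓD, ψ x = 0) ∧
    ∀ᵐ x ∂surf.restrict m.ΓN, ∀ n, IsOuterNormal m.Ω x n → ⟪ψ x, n⟫ = 0

/-- `u ∈ C¹_c([0,T) × Ω̄; F)`. -/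
def IsTest {F : Type*} [NormedAddCommGroup F] [NormedSpace ℝ F] (u : ℝ → V → F) : Prop :=
  ContDiffUpTo 1 (Ioo 0 m.T ×ˢ m.Ω) (Function.uncurry u) ∧
    ∃ T' < m.T, ∀ t, T' ≤ t → ∀ x ∈ closure m.Ω, u t x = 0

/-- Admissible pairs of test functions. -/
def IsTestPair (ψ : ℝ → V → V) (Ψ : ℝ → V → SymMat) : Prop :=
  m.IsTest ψ ∧ m.IsTest Ψ ∧ ∀ t ∈ Ioo 0 m.T, m.TestBoundary (ψ t)

/-! ### Energy-variational solutions -/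

/-- The integrand `𝕊(v) : 𝔻(v) - f · v`, for velocity `v`, velocity gradient `G` and force
`f`. -/
def dissipationDensity (v : V) (G : V →L[ℝ] V) (f : V) : ℝ :=
  frob (m.viscousStress G) (strainRate G) - ⟪f, v⟫

/-- The part of the integrand of the weak formulation that contains the test function of the
momentum equation, for velocity `v`, velocity gradient `G`, elastic strain `A`, force `f`, and
`p = ψ`, `p_t = ∂ₜψ`, `Dp = ∇ψ`. Note that `(v ⊗ v) : ∇ψ = ⟪v, (∇ψ) v⟫`. -/
def momentumDensity (v : V) (G : V →L[ℝ] V) (A : SymMat) (f : V) (p p_t : V) (Dp : V →L[ℝ] V) :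
    ℝ :=
  m.ρ * ⟪v, p_t⟫ + m.ρ / 2 * divg G * ⟪v, p⟫ + m.ρ * ⟪v, Dp v⟫
    - frob (m.viscousStress G + gradSym m.φ A : SymMat) (strainRate Dp) - m.φ A * divg Dp + ⟪f, p⟫

/-- The part of the integrand of the weak formulation that contains the test function of the
strain equation, for velocity `v`, velocity gradient `G`, elastic strain `A`, and
`Q = Ψ`, `Q_t = ∂ₜΨ`, `DQ = ∇Ψ`. -/
def strainDensity (v : V) (G : V →L[ℝ] V) (A : SymMat) (Q Q_t : SymMat) (DQ : V →L[ℝ] SymMat) : ℝ :=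
  frob A Q_t + divg G * frob A Q + frob (DQ v) A
    - frob ((A : Mat) * spin G - spin G * (A : Mat)) Q + frob (strainRate G) Q

/-- The pairing `∫ ρ v · ψ + E : Ψ dx`. -/
def pairing (v : V → V) (E : V → SymMat) (ψ : V → V) (Ψ : V → SymMat) : ℝ :=
  ∫ x in m.Ω, (m.ρ * ⟪v x, ψ x⟫ + frob (E x) (Ψ x))

/-- The space-time integral over `(s,t) × Ω` in the energy-variational inequality, without the
dissipation potential. Here `G` is the spatial gradient of `v`. -/
def bulkTerm (v : ℝ → V → V) (G : ℝ → V → V →L[ℝ] V) (E : ℝ → V → SymMat)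
    (ψ : ℝ → V → V) (Ψ : ℝ → V → SymMat) (s t : ℝ) : ℝ :=
  ∫ τ in s..t, ∫ x in m.Ω,
    (m.dissipationDensity (v τ x) (G τ x) (m.f τ x)
      + m.momentumDensity (v τ x) (G τ x) (E τ x) (m.f τ x)
          (ψ τ x) (deriv (fun σ => ψ σ x) τ) (fderiv ℝ (ψ τ) x)
      + strainDensity (v τ x) (G τ x) (E τ x)
          (Ψ τ x) (deriv (fun σ => Ψ σ x) τ) (fderiv ℝ (Ψ τ) x))

/-- The energy-variational inequality on `(s,t)`, with regularity weight `K`. The integrals of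
the dissipation potential may be infinite and are therefore written on the two sides of an
inequality between extended real numbers. -/
def EnVarInequality (K : (closure m.Ω → V) → (closure m.Ω → SymMat) → ℝ≥0)
    (v : ℝ → V → V) (G : ℝ → V → V →L[ℝ] V) (E : ℝ → V → SymMat) (En : ℝ → ℝ)
    (ψ : ℝ → V → V) (Ψ : ℝ → V → SymMat) (s t : ℝ) : Prop :=
  (((En t - m.pairing (v t) (E t) (ψ t) (Ψ t)) - (En s - m.pairing (v s) (E s) (ψ s) (Ψ s))
        + m.bulkTerm v G E ψ Ψ s t : ℝ) : EReal)
      + ((∫⁻ τ in Ioc s t, m.potential (fun x => dev (gradSym m.φ (E τ x))) : ℝ≥0∞) : EReal)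
    ≤ ((∫⁻ τ in Ioc s t, m.potential (fun x => dev (Ψ τ x)) : ℝ≥0∞) : EReal)
      + ((∫ τ in s..t, (K ((closure m.Ω).domRestrict (ψ τ)) ((closure m.Ω).domRestrict (Ψ τ)) : ℝ)
            * (En τ - m.energy (v τ) (E τ)) : ℝ) : EReal)

/-- Admissible initial data. -/
structure IsInitial (v₀ : V → V) (E₀ : V → SymMat) : Prop where
  v_int : MemLp v₀ 1 m.μΩ
  E_int : MemLp E₀ 1 m.μΩ
  energy_finite : Integrable (m.energyDensity v₀ E₀) m.μΩ

/-- `(v, E, En)` is an energy-variational solution with initial values `(v₀, E₀)`. -/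
structure IsEnVarSolution (v₀ : V → V) (E₀ : V → SymMat)
    (v : ℝ → V → V) (E : ℝ → V → SymMat) (En : ℝ → ℝ) : Prop where
  v_bounded : MemLpLq ∞ 2 m.T m.Ω v
  E_bounded : MemLpLq ∞ 2 m.T m.Ω E
  En_bv : BoundedVariationOn En (Icc 0 m.T)
  dirichlet : ∀ᵐ t ∂m.μT, ∀ᵐ x ∂surf.restrict m.ΓD, HasTrace m.Ω (v t) x 0
  slip : ∀ᵐ t ∂m.μT, ∀ᵐ x ∂surf.restrict m.ΓN,
    ∃ g, HasTrace m.Ω (v t) x g ∧ ∀ n, IsOuterNormal m.Ω x n → ⟪g, n⟫ = 0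
  energy_le : ∀ᵐ t ∂m.μT,
    Integrable (m.energyDensity (v t) (E t)) m.μΩ ∧ m.energy (v t) (E t) ≤ En t
  /-- `v ∈ L²(0,T; H¹)` with weak gradient `G`, and there is a regularity weight `K`, integrable
  in time along all test functions, such that the energy-variational inequality holds. -/
  inequality : ∃ G : ℝ → V → V →L[ℝ] V,
    MemLpLq 2 2 m.T m.Ω G ∧ (∀ᵐ t ∂m.μT, IsWeakGradient m.Ω (v t) (G t)) ∧
    ∃ K : (closure m.Ω → V) → (closure m.Ω → SymMat) → ℝ≥0,
      (∀ ψ Ψ, m.IsTestPair ψ Ψ →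
        Integrable (fun τ =>
          (K ((closure m.Ω).domRestrict (ψ τ)) ((closure m.Ω).domRestrict (Ψ τ)) : ℝ)) m.μT) ∧
      ∀ᵐ s ∂m.μT, ∀ᵐ t ∂m.μT, s < t → ∀ ψ Ψ, m.IsTestPair ψ Ψ →
        m.EnVarInequality K v G E En ψ Ψ s t
  /-- The initial values are attained weakly* in the dual of the space of (time-independent) test
  functions; the limit is taken outside of a null set of times. -/
  initial : ∀ (ψ : V → V) (Ψ : V → SymMat),
    ContDiffUpTo 1 m.Ω ψ → ContDiffUpTo 1 m.Ω Ψ → m.TestBoundary ψ →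
      Tendsto (fun s => m.pairing (v s) (E s) ψ Ψ) (𝓝[>] 0 ⊓ ae volume)
        (𝓝 (m.pairing v₀ E₀ ψ Ψ))

/-! ### Strong solutions -/

/-- `Ξ ∈ ∂P(A)`, where `Ξ ∈ L^∞` is regarded as an element of the dual of `L¹`. -/
def IsSubgradient (A Ξ : V → DevMat) : Prop :=
  MemLp Ξ ∞ m.μΩ ∧ MemLp A 1 m.μΩ ∧ m.potential A ≠ ∞ ∧
    ∀ B : V → DevMat, MemLp B 1 m.μΩ →
      (m.potential A : EReal) + ((∫ x in m.Ω, frob (Ξ x) (B x - A x : DevMat) : ℝ) : EReal)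
        ≤ m.potential B

/-- The divergence of a matrix field, `(div Σ)ᵢ = ∑ⱼ ∂ⱼ Σᵢⱼ`. -/
def matDiv (S : V → Mat) (x : V) : V :=
  WithLp.toLp 2 fun i => ∑ j, fderiv ℝ (fun y => S y i j) x (EuclideanSpace.single j 1)

/-- The momentum equation at `(t,x)`. -/
def MomentumEq (v : ℝ → V → V) (E : ℝ → V → SymMat) (t : ℝ) (x : V) : Prop :=
  m.ρ • (deriv (fun τ => v τ x) t + fderiv ℝ (v t) x (v t x))
    = matDiv (fun y => (m.viscousStress (fderiv ℝ (v t) y) : Mat) + m.elasticStress (E t y)) x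
      - (m.ρ / 2 * divg (fderiv ℝ (v t) x)) • v t x + m.f t x

/-- The Zaremba-Jaumann rate of `E` at `(t,x)`. -/
def jaumannRate (v : ℝ → V → V) (E : ℝ → V → SymMat) (t : ℝ) (x : V) : Mat :=
  (deriv (fun τ => E τ x) t : Mat) + (fderiv ℝ (E t) x (v t x) : Mat)
    + ((E t x : Mat) * spin (fderiv ℝ (v t) x) - spin (fderiv ℝ (v t) x) * (E t x : Mat))

/-- The strain inclusion at time `t`: `𝔻(v)` is at every point of `Ω` the sum of the
Zaremba-Jaumann rate and an element of the subdifferential of `P` at `dev 𝕋`. -/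
def StrainInclusion (v : ℝ → V → V) (E : ℝ → V → SymMat) (t : ℝ) : Prop :=
  ∃ Ξ : V → DevMat,
    m.IsSubgradient (fun x => dev (symPart (m.elasticStress (E t x)))) Ξ ∧
      ∀ x ∈ m.Ω, jaumannRate v E t x + (Ξ x : Mat) = (strainRate (fderiv ℝ (v t) x) : Mat)

/-- A point of the Neumann part near which the boundary is a surface of class `C²` that meets the
Dirichlet part only in a set of surface measure zero. -/
def IsRegularNeumannPoint (x : V) : Prop :=
  x ∈ m.ΓN ∧ IsSubgraphNear (fun h => ContDiff ℝ 2 h) m.Ω x ∧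
    ∃ r > 0, surf (m.ΓD ∩ Metric.ball x r) = 0

/-- The total stress `𝕋 + 𝕊(v)` at a boundary point, where the velocity gradient is extended
continuously from `Ω`. -/
def boundaryStress (v : V → V) (E : V → SymMat) (x : V) : Mat :=
  m.elasticStress (E x) + (m.viscousStress (extendFrom m.Ω (fderiv ℝ v) x) : Mat)

/-- The tangential part of `(𝕋 + 𝕊(v)) n` vanishes at the boundary point `x`. -/
def TractionFree (v : V → V) (E : V → SymMat) (x n : V) : Prop :=
  let a : V := WithLp.toLp 2 ((m.boundaryStress v E x).mulVec n.ofLp)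
  a - ⟪a, n⟫ • n = 0

/-- The system is satisfied pointwise. -/
structure IsStrongSolution (v₀ : V → V) (E₀ : V → SymMat)
    (v : ℝ → V → V) (E : ℝ → V → SymMat) : Prop where
  momentum : ∀ᵐ t ∂m.μT, ∀ᵐ x ∂m.μΩ, m.MomentumEq v E t x
  strain : ∀ t ∈ Ioo 0 m.T, m.StrainInclusion v E t
  dirichlet : ∀ t ∈ Ioo 0 m.T, ∀ᵐ x ∂surf.restrict m.ΓD, v t x = 0
  slip : ∀ t ∈ Ioo 0 m.T, ∀ᵐ x ∂surf.restrict m.ΓN,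
    ∀ n, IsOuterNormal m.Ω x n → ⟪v t x, n⟫ = 0
  traction : ∀ t ∈ Ioo 0 m.T, ∀ x, m.IsRegularNeumannPoint x →
    ∀ n, IsOuterNormal m.Ω x n → m.TractionFree (v t) (E t) x n
  initial : ∀ᵐ x ∂m.μΩ, v 0 x = v₀ x ∧ E 0 x = E₀ x

end Model

end ViscoElastoPlastic

end

noncomputable section

namespace ViscoElastoPlastic

/-! ### Functions with first derivatives that extend continuously to the closure -/

section Extension

variable {X F : Type*} [NormedAddCommGroup X] [NormedSpace ℝ X] [NormedAddCommGroup F]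
  [NormedSpace ℝ F]

/-! The inequality is tested with the velocity itself, cut off near the final time, plus a free
increment `p`, and with a strain test function `Q`. Integrating by parts in space and time, every
term that is not a residual of the system is either a time derivative or the divergence of a
multiple of `v`, whose flux vanishes because `v` is tangential to the boundary. `density_identity`
is this computation at a point. It rests on the fact that Dφ(𝔼) commutes with 𝔼, so that the spin
terms of the Zaremba-Jaumann rate are orthogonal to Dφ(𝔼). `bulk_identity` is the integrated form.
What remains is an inequality for the defect e = E - ℰ(v,𝔼), in which the strain residual is paired
with Q - Dφ(𝔼) and the momentum residual with p.

For p = 0 and Q = Dφ(𝔼) the residuals drop out and the two dissipation terms cancel; they are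
finite, as testing with zero shows. Hence e(t) - e(s) is at most the integral of k e over (s,t),
with an integrable weight k. Since e is nonnegative and tends to zero at time zero, Grönwall's
inequality gives e = 0 (`defect_le_integral`, `energy_eq`). The weight term then disappears for
every test pair, and p and Q become free (`variational_inequality`).

The choice Q = Dφ(𝔼) with p and -p gives the weak momentum equation. Increments supported inside the
domain give the equation almost everywhere. Once it holds, tangential increments show that the flux
of the total stress against them is zero, and concentrating the tangential part of the traction near
a regular Neumann point makes this flux positive unless the traction is normal (`tractionFree`).

The choice p = 0 with Q independent of time, localized in time by continuity and the lower
semicontinuity of P, gives an inequality at each time (`strain_inequality`). Multiples of the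
identity do not change dev Q, which forces the strain residual to be trace-free. The inequality then
says that this residual is a subgradient on C¹ fields, and the approximation property extends it to
all of L¹ (`strainInclusion`).

The analytic tool is the divergence theorem for tangential fields on Lipschitz domains
(`integral_divg_eq_zero`). Only null sets of surface measure enter: the field is cut off in a layer
of width ε below the graph, and the layer integral converges to a flux over the parameter plane,
whose integrand vanishes almost everywhere. -/

/-- `ū` and `D` are globally continuous extensions of `u` (from `closure U`) and of the derivative
of `u` (from `U`). -/
structure HasC1Ext (U : Set X) (u ū : X → F) (D : X → X →L[ℝ] F) : Prop where
  cont : Continuous ū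
  cont_deriv : Continuous D
  eqOn : EqOn u ū (closure U)
  hasFDerivAt : ∀ x ∈ U, HasFDerivAt u (D x) x

/-- Fields are built by algebra on their extensions; this converts the result back into the
regularity class required of test functions. -/
theorem HasC1Ext.contDiffUpTo {U : Set X} (hU : IsOpen U) {u ū : X → F} {D : X → X →L[ℝ] F}
    (h : HasC1Ext U u ū D) : ContDiffUpTo 1 U u := by
  have hfd : EqOn (fderiv ℝ u) D U := fun x hx => (h.hasFDerivAt x hx).fderiv
  refine ⟨?_, h.cont.continuousOn.congr h.eqOn, ?_⟩
  · have := (contDiffOn_succ_iff_fderiv_of_isOpen (𝕜 := ℝ) (n := 0) (f := u) hU).2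
      ⟨fun x hx => (h.hasFDerivAt x hx).differentiableAt.differentiableWithinAt, by simp, by
        rw [contDiffOn_zero]; exact h.cont_deriv.continuousOn.congr hfd⟩
    simpa using this
  · intro j hj
    interval_cases j
    · refine ⟨fun x => (continuousMultilinearCurryFin0 ℝ X F).symm (ū x),
        ((LinearIsometryEquiv.continuous _).comp h.cont).continuousOn, fun x hx => ?_⟩
      rw [iteratedFDeriv_zero_eq_comp, Function.comp_apply, h.eqOn (subset_closure hx)]
    · refine ⟨fun x => (continuousMultilinearCurryFin1 ℝ X F).symm (D x),
        ((LinearIsometryEquiv.continuous _).comp h.cont_deriv).continuousOn, fun x hx => ?_⟩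
      ext m
      rw [iteratedFDeriv_one_apply, hfd hx]
      simp

/-- Tietze's theorem in finitely many coordinates. With globally continuous representatives,
integrability over bounded sets and continuity of parameter integrals need no discussion of the
boundary. -/
theorem exists_continuous_extension {Z Y : Type*} [TopologicalSpace Z] [NormalSpace Z]
    [NormedAddCommGroup Y] [NormedSpace ℝ Y] [FiniteDimensional ℝ Y] {K : Set Z} (hK : IsClosed K)
    {g : Z → Y} (hg : ContinuousOn g K) : ∃ G : Z → Y, Continuous G ∧ EqOn g G K := by
  have : TietzeExtension Y := TietzeExtension.of_tvs ℝ
  obtain ⟨G, hG⟩ := ContinuousMap.exists_restrict_eq (Y := Y) hK ⟨K.domRestrict g, hg.domRestrict⟩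
  refine ⟨G, G.continuous, fun x hx => ?_⟩
  have := congrArg (fun f => f ⟨x, hx⟩) hG
  exact this.symm

theorem ContDiffUpTo.exists_hasC1Ext [FiniteDimensional ℝ X] [FiniteDimensional ℝ F] {U : Set X}
    (hU : IsOpen U) {u : X → F} (h : ContDiffUpTo 1 U u) : ∃ ū D, HasC1Ext U u ū D := by
  obtain ⟨h1, h2, h3⟩ := h
  obtain ⟨ū, hū, hu⟩ := exists_continuous_extension isClosed_closure h2
  obtain ⟨g, hg, hgu⟩ := h3 1 le_rfl
  obtain ⟨D, hD, hDu⟩ := exists_continuous_extension isClosed_closure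
    ((continuousMultilinearCurryFin1 ℝ X F).continuous.comp_continuousOn hg)
  refine ⟨ū, D, hū, hD, hu, fun x hx => ?_⟩
  have hd : DifferentiableAt ℝ u x :=
    (h1.differentiableOn (by simp) x hx).differentiableAt (hU.mem_nhds hx)
  convert hd.hasFDerivAt using 1
  rw [← hDu (subset_closure hx), Function.comp_apply, hgu hx]
  ext y
  simp [iteratedFDeriv_one_apply]

omit [NormedSpace ℝ X] in
/-- A continuous curve in `C(Ū)`, as a jointly continuous function. -/
theorem exists_joint_extension {Y : Type*} [NormedAddCommGroup Y] [NormedSpace ℝ Y]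
    [FiniteDimensional ℝ Y] {T : ℝ} {U : Set X} {A : ℝ → X → Y}
    (h1 : ∀ t ∈ Icc 0 T, ∃ g : X → Y, ContinuousOn g (closure U) ∧ EqOn g (A t) U)
    (h2 : ∀ t ∈ Icc 0 T, TendstoUniformlyOn A (A t) (𝓝[Icc 0 T] t) U) :
    ∃ B : ℝ × X → Y, Continuous B ∧ ∀ t ∈ Icc 0 T, ∀ x ∈ U, A t x = B (t, x) := by
  choose! g hg hgA using h1
  have hc : ContinuousOn (fun z : ℝ × X => g z.1 z.2) (Icc 0 T ×ˢ closure U) := by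
    rintro ⟨t, x⟩ ⟨ht, hx⟩
    rw [ContinuousWithinAt, Metric.tendsto_nhds]
    intro ε hε
    -- The uniform estimate is known on `U` only and passes to the closure by continuity, which
    -- costs the strict inequality; `e2` keeps its own strict.
    have e1 : ∀ᶠ s in 𝓝[Icc 0 T] t, ∀ y ∈ closure U, dist (g s y) (g t y) ≤ ε / 2 := by
      filter_upwards [Metric.tendstoUniformlyOn_iff.1 (h2 t ht) (ε / 2) (by positivity),
        self_mem_nhdsWithin] with s hs hsT y hy
      have hcl : ContinuousOn (fun y => dist (g s y) (g t y)) (closure U) :=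
        continuous_dist.comp_continuousOn ((hg s hsT).prodMk (hg t ht))
      have : ∀ y ∈ U, dist (g s y) (g t y) ≤ ε / 2 := fun y hy => by
        rw [hgA s hsT hy, hgA t ht hy, dist_comm]; exact (hs y hy).le
      exact le_on_closure this hcl continuousOn_const hy
    have e2 : ∀ᶠ y in 𝓝[closure U] x, dist (g t y) (g t x) < ε / 2 :=
      Metric.tendsto_nhds.1 (hg t ht x hx) (ε / 2) (by positivity)
    rw [nhdsWithin_prod_eq]
    filter_upwards [e1.prod_mk (e2.and self_mem_nhdsWithin)] with z hz
    calc dist (g z.1 z.2) (g t x) ≤ dist (g z.1 z.2) (g t z.2) + dist (g t z.2) (g t x) :=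
          dist_triangle _ _ _
      _ < ε := by linarith [hz.1 z.2 hz.2.2, hz.2.1]
  obtain ⟨B, hB, hB'⟩ := exists_continuous_extension (isClosed_Icc.prod isClosed_closure) hc
  exact ⟨B, hB, fun t ht x hx => by
    rw [← hB' (Set.mk_mem_prod ht (subset_closure hx))]; exact (hgA t ht hx).symm⟩

/-- The increment u(s) - u(t) is |s - t| times a difference quotient, and the quotients are
uniformly bounded near t because they converge uniformly to a bounded limit. -/
theorem C1InTime.tendstoUniformlyOn [FiniteDimensional ℝ X] {T : ℝ} {n : ℕ} {U : Set X}
    (hU : IsOpen U) (hb : Bornology.IsBounded U) {u w : ℝ → X → F}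
    (hu : ∀ t ∈ Icc 0 T, ContDiffUpTo n U (u t)) {t : ℝ} (ht : t ∈ Icc 0 T)
    (hw : ContDiffUpTo n U (w t))
    (hq : TendstoCn n U (𝓝[Icc 0 T \ {t}] t) (fun s => (s - t)⁻¹ • (u s - u t)) (w t))
    {j : ℕ} (hj : j ≤ n) :
    TendstoUniformlyOn (fun s => iteratedFDeriv ℝ j (u s)) (iteratedFDeriv ℝ j (u t))
      (𝓝[Icc 0 T] t) U := by
  obtain ⟨g, hg, hgw⟩ := hw.2.2 j hj
  obtain ⟨M, hM⟩ := hb.isCompact_closure.exists_bound_of_continuousOn hg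
  rw [Metric.tendstoUniformlyOn_iff]
  intro ε hε
  have hq' := Metric.tendstoUniformlyOn_iff.1 (hq j hj) 1 one_pos
  have hpos : 0 < |M| + 2 := by positivity
  have hq'' : ∀ᶠ s in 𝓝[Icc 0 T \ {t}] t, ∀ x ∈ U,
      dist (iteratedFDeriv ℝ j (u t) x) (iteratedFDeriv ℝ j (u s) x) < ε := by
    have hs1 : ∀ᶠ s in 𝓝[Icc 0 T \ {t}] t, dist s t < ε / (|M| + 2) :=
      nhdsWithin_le_nhds (Metric.ball_mem_nhds t (by positivity))
    filter_upwards [hq', hs1, self_mem_nhdsWithin] with s hs hst hsT x hx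
    have hne : s - t ≠ 0 := sub_ne_zero.2 hsT.2
    have hcd : ∀ r ∈ Icc 0 T, ContDiffAt ℝ j (u r) x := fun r hr =>
      ((hu r hr).1.of_le (by exact_mod_cast hj)).contDiffAt (hU.mem_nhds hx)
    have h1 : dist (iteratedFDeriv ℝ j (w t) x)
      (iteratedFDeriv ℝ j ((s - t)⁻¹ • (u s - u t)) x) < 1 := hs x hx
    rw [iteratedFDeriv_const_smul_apply (f := u s - u t) ((hcd s hsT.1).sub (hcd t ht)),
      iteratedFDeriv_sub_apply (hcd s hsT.1) (hcd t ht), ← hgw hx, dist_eq_norm] at h1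
    set d := iteratedFDeriv ℝ j (u s) x - iteratedFDeriv ℝ j (u t) x
    -- `M` bounds the limit on the compact closure and the tolerance of the quotients is 1; `|M| +
    -- 2` is a convenient strictly positive bound.
    have h2 : ‖(s - t)⁻¹ • d‖ < |M| + 2 := by
      calc ‖(s - t)⁻¹ • d‖ = ‖g x - (g x - (s - t)⁻¹ • d)‖ := by congr 1; abel
        _ ≤ ‖g x‖ + ‖g x - (s - t)⁻¹ • d‖ := norm_sub_le _ _
        _ < |M| + 2 := by linarith [hM x (subset_closure hx), le_abs_self M]
    rw [dist_comm, dist_eq_norm]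
    calc ‖d‖ = |s - t| * ‖(s - t)⁻¹ • d‖ := by
          rw [norm_smul, norm_inv, Real.norm_eq_abs, mul_inv_cancel_left₀ (abs_ne_zero.2 hne)]
      _ < ε / (|M| + 2) * (|M| + 2) := by
          rw [Real.dist_eq] at hst
          exact mul_lt_mul'' hst h2 (abs_nonneg _) (norm_nonneg _)
      _ = ε := div_mul_cancel₀ _ hpos.ne'
  rw [eventually_nhdsWithin_iff] at hq'' ⊢
  filter_upwards [hq''] with s hs hsT x hx
  by_cases hst : s = t
  · rw [hst, dist_self]; exact hε
  · exact hs ⟨hsT, hst⟩ x hx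

omit [NormedSpace ℝ X] in
theorem closure_cylinder {T : ℝ} (hT : 0 < T) (U : Set X) :
    closure (Ioo 0 T ×ˢ U) = Icc 0 T ×ˢ closure U := by
  rw [closure_prod_eq, closure_Ioo hT.ne]

/-- Globally continuous extensions of a function on a space-time cylinder and of its time and
space derivatives. -/
structure CylExt (T : ℝ) (U : Set X) (u : ℝ → X → F) (ū ut : ℝ × X → F)
    (ux : ℝ × X → X →L[ℝ] F) : Prop where
  cont : Continuous ū
  cont_t : Continuous ut
  cont_x : Continuous ux
  eqOn : ∀ t ∈ Icc 0 T, ∀ x ∈ closure U, u t x = ū (t, x)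
  hasDerivAt : ∀ t ∈ Ioo 0 T, ∀ x ∈ U, HasDerivAt (fun τ => u τ x) (ut (t, x)) t
  hasFDerivAt : ∀ t ∈ Ioo 0 T, ∀ x ∈ U, HasFDerivAt (u t) (ux (t, x)) x

theorem HasC1Ext.cylExt {T : ℝ} (hT : 0 < T) {U : Set X} {u : ℝ → X → F} {ū : ℝ × X → F}
    {D : ℝ × X → ℝ × X →L[ℝ] F} (h : HasC1Ext (Ioo 0 T ×ˢ U) (Function.uncurry u) ū D) :
    CylExt T U u ū (fun z => D z (1, 0)) (fun z => (D z).comp (ContinuousLinearMap.inr ℝ ℝ X)) := by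
  have hD := h.cont_deriv
  refine ⟨h.cont, by fun_prop, by fun_prop, fun t ht x hx => ?_, fun t ht x hx => ?_,
    fun t ht x hx => ?_⟩
  · exact h.eqOn (x := (t, x)) (by rw [closure_cylinder hT]; exact ⟨ht, hx⟩)
  · have h1 : HasDerivAt (fun τ : ℝ => (τ, x)) ((1 : ℝ), (0 : X)) t :=
      (hasDerivAt_id t).prodMk (hasDerivAt_const t x)
    exact (h.hasFDerivAt (t, x) ⟨ht, hx⟩).comp_hasDerivAt t h1
  · exact (h.hasFDerivAt (t, x) ⟨ht, hx⟩).comp x (hasFDerivAt_prodMk_right t x)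

/-- Continuous partial derivatives in time and space give total differentiability on the open
cylinder. -/
theorem CylExt.hasC1Ext {T : ℝ} (hT : 0 < T) {U : Set X} (hU : IsOpen U) {u : ℝ → X → F}
    {ū ut : ℝ × X → F} {ux : ℝ × X → X →L[ℝ] F} (h : CylExt T U u ū ut ux) :
    HasC1Ext (Ioo 0 T ×ˢ U) (Function.uncurry u) ū
      fun z => (ContinuousLinearMap.toSpanSingleton ℝ (ut z)).coprod (ux z) := by
  have hut := h.cont_t
  have hux := h.cont_x
  have h1 : Continuous fun z => ContinuousLinearMap.toSpanSingleton ℝ (ut z) :=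
    continuous_clm_apply.2 fun y => by
      simp only [ContinuousLinearMap.toSpanSingleton_apply]; fun_prop
  refine ⟨h.cont, ?_, ?_, ?_⟩
  · have : (fun z => (ContinuousLinearMap.toSpanSingleton ℝ (ut z)).coprod (ux z)) = fun z =>
        (ContinuousLinearMap.toSpanSingleton ℝ (ut z)).comp (ContinuousLinearMap.fst ℝ ℝ X)
          + (ux z).comp (ContinuousLinearMap.snd ℝ ℝ X) := by
      ext z <;> simp
    rw [this]
    fun_prop
  · rw [closure_cylinder hT]
    rintro ⟨t, x⟩ ⟨ht, hx⟩
    exact h.eqOn t ht x hx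
  · rintro ⟨t, x⟩ ⟨ht, hx⟩
    have hev : ∀ᶠ z : ℝ × X in 𝓝 (t, x), z ∈ Ioo 0 T ×ˢ U :=
      (isOpen_Ioo.prod hU).mem_nhds ⟨ht, hx⟩
    refine HasStrictFDerivAt.hasFDerivAt (hasStrictFDerivAt_uncurry_coprod (f := u) (u := (t, x))
      (f₁ := fun t x => ContinuousLinearMap.toSpanSingleton ℝ (ut (t, x)))
      (f₂ := fun t x => ux (t, x)) ?_ ?_ h1.continuousAt hux.continuousAt)
    · filter_upwards [hev] with z hz
      exact (h.hasDerivAt z.1 hz.1 z.2 hz.2).hasFDerivAt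
    · filter_upwards [hev] with z hz
      exact h.hasFDerivAt z.1 hz.1 z.2 hz.2

/-- The curve, its time derivative and its space gradient are each continuous in time with values in
C(Ū), so each has a jointly continuous extension. -/
theorem C1InTime.exists_cylExt [FiniteDimensional ℝ X] [FiniteDimensional ℝ F] {T : ℝ}
    {n : ℕ} (hn : 1 ≤ n) {U : Set X} (hU : IsOpen U) (hb : Bornology.IsBounded U)
    {u : ℝ → X → F} (h : C1InTime T n U u) :
    ∃ ū ut ux, CylExt T U u ū ut ux := by
  obtain ⟨hu, w, hw, hwc, hq⟩ := h
  have ext0 : ∀ y : ℝ → X → F, (∀ t ∈ Icc 0 T, ContDiffUpTo n U (y t)) →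
      (∀ t ∈ Icc 0 T, TendstoUniformlyOn (fun s => iteratedFDeriv ℝ 0 (y s))
        (iteratedFDeriv ℝ 0 (y t)) (𝓝[Icc 0 T] t) U) →
      ∃ B : ℝ × X → F, Continuous B ∧ ∀ t ∈ Icc 0 T, ∀ x ∈ U, y t x = B (t, x) := by
    intro y hy hyt
    refine exists_joint_extension (fun t ht => ⟨y t, (hy t ht).2.1, fun x _ => rfl⟩) fun t ht => ?_
    have := (LinearIsometryEquiv.isometry
      (continuousMultilinearCurryFin0 ℝ X F)).uniformContinuous.comp_tendstoUniformlyOn (hyt t ht)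
    simpa [Function.comp_def, iteratedFDeriv_zero_eq_comp] using! this
  have hunif := fun t (ht : t ∈ Icc 0 T) (j : ℕ) (hj : j ≤ n) =>
    C1InTime.tendstoUniformlyOn hU hb hu ht (hw t ht) (hq t ht) hj
  obtain ⟨ū, hūc, hū⟩ := ext0 u hu fun t ht => hunif t ht 0 (Nat.zero_le _)
  obtain ⟨wb, hwbc, hwb⟩ := ext0 w hw fun t ht => hwc t ht 0 (Nat.zero_le _)
  obtain ⟨G, hGc, hG⟩ : ∃ B : ℝ × X → X →L[ℝ] F, Continuous B ∧
      ∀ t ∈ Icc 0 T, ∀ x ∈ U, fderiv ℝ (u t) x = B (t, x) := by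
    have e : ∀ s x, continuousMultilinearCurryFin1 ℝ X F (iteratedFDeriv ℝ 1 (u s) x)
        = fderiv ℝ (u s) x := fun s x => by ext y; simp [iteratedFDeriv_one_apply]
    refine exists_joint_extension (A := fun t => fderiv ℝ (u t)) (fun t ht => ?_) fun t ht => ?_
    · obtain ⟨g, hg, hgu⟩ := (hu t ht).2.2 1 hn
      refine ⟨fun x => continuousMultilinearCurryFin1 ℝ X F (g x),
        (continuousMultilinearCurryFin1 ℝ X F).continuous.comp_continuousOn hg, fun x hx => ?_⟩
      simp only [hgu hx, e]
    · have := (LinearIsometryEquiv.isometry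
        (continuousMultilinearCurryFin1 ℝ X F)).uniformContinuous.comp_tendstoUniformlyOn
          (hunif t ht 1 hn)
      simp only [Function.comp_def, e] at this
      exact this
  refine ⟨ū, wb, G, hūc, hwbc, hGc, ?_, fun t ht x hx => ?_, fun t ht x hx => ?_⟩
  · intro t ht x hx
    have : EqOn (u t) (fun x => ū (t, x)) (closure U) :=
      EqOn.of_subset_closure (fun y hy => hū t ht y hy) (hu t ht).2.1
        (by fun_prop) subset_closure le_rfl
    exact this hx
  · have hzI := Ioo_subset_Icc_self ht
    have hz0 := (hq t hzI 0 (Nat.zero_le _)).tendsto_at hx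
    have hz3 := (continuousMultilinearCurryFin0 ℝ X F).continuous.continuousAt.tendsto.comp hz0
    have hz4 : Tendsto (fun s => (s - t)⁻¹ • (u s x - u t x)) (𝓝[≠] t)
        (𝓝 (w t x)) := by
      -- At an interior time the one-sided restrictions of the difference quotient are void.
      have : 𝓝[≠] t ≤ 𝓝[Icc 0 T \ {t}] t := by
        rw [nhdsWithin, nhdsWithin, sdiff_eq, ← inf_principal, ← inf_assoc]
        refine le_inf (le_inf inf_le_left ?_) inf_le_right
        exact inf_le_left.trans (le_principal_iff.2 (Icc_mem_nhds ht.1 ht.2))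
      exact Tendsto.mono_left hz3 this
    have := hasDerivAt_iff_tendsto_slope.2 hz4
    rw [hwb _ hzI _ hx] at this
    exact this
  · have hzI := Ioo_subset_Icc_self ht
    have := ((((hu t hzI).1.differentiableOn (by norm_cast; omega)) x hx).differentiableAt
      (hU.mem_nhds hx)).hasFDerivAt
    rwa [hG _ hzI _ hx] at this

/-- The second space derivative of a curve in `C¹([0,T]; C²(Ū))`. -/
theorem C1InTime.exists_second_deriv [FiniteDimensional ℝ X] [FiniteDimensional ℝ F] {T : ℝ}
    {U : Set X} (hU : IsOpen U) (hb : Bornology.IsBounded U)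
    {u : ℝ → X → F} (h : C1InTime T 2 U u) :
    ∃ H : ℝ × X → X →L[ℝ] X →L[ℝ] F, Continuous H ∧
      ∀ t ∈ Icc 0 T, ∀ x ∈ U, HasFDerivAt (fderiv ℝ (u t)) (H (t, x)) x := by
  obtain ⟨hu, w, hw, hwc, hq⟩ := h
  have hunif := fun t (ht : t ∈ Icc 0 T) (j : ℕ) (hj : j ≤ 2) =>
    C1InTime.tendstoUniformlyOn hU hb hu ht (hw t ht) (hq t ht) hj
  have hcl : ∀ t x, continuousMultilinearCurryLeftEquiv ℝ (fun _ : Fin 2 => X) F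
      (iteratedFDeriv ℝ 2 (u t) x) = fderiv ℝ (iteratedFDeriv ℝ 1 (u t)) x := by
    intro t x
    rw [iteratedFDeriv_succ_eq_comp_left]
    simp
  let Λ : ContinuousMultilinearMap ℝ (fun _ : Fin 1 => X) F →L[ℝ] X →L[ℝ] F :=
    ((continuousMultilinearCurryFin1 ℝ X F).toContinuousLinearEquiv :
      ContinuousMultilinearMap ℝ (fun _ : Fin 1 => X) F →L[ℝ] X →L[ℝ] F)
  have hΛ : ∀ t ∈ Icc 0 T, ∀ x ∈ U,
      HasFDerivAt (fderiv ℝ (u t)) (Λ.comp (fderiv ℝ (iteratedFDeriv ℝ 1 (u t)) x)) x := by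
    intro t ht x hx
    have hcd : ContDiffAt ℝ 2 (u t) x := (hu t ht).1.contDiffAt (hU.mem_nhds hx)
    have hd : DifferentiableAt ℝ (iteratedFDeriv ℝ 1 (u t)) x :=
      hcd.differentiableAt_iteratedFDeriv (by norm_num)
    have h1 := Λ.hasFDerivAt.comp x hd.hasFDerivAt
    have e : (fun y => Λ (iteratedFDeriv ℝ 1 (u t) y)) = fderiv ℝ (u t) := by
      ext s x; simp [Λ, iteratedFDeriv_one_apply]
    exact e ▸ h1
  have : FiniteDimensional ℝ (ContinuousMultilinearMap ℝ (fun _ : Fin 1 => X) F) :=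
    (continuousMultilinearCurryFin1 ℝ X F).symm.toLinearEquiv.finiteDimensional
  obtain ⟨H, hHc, hH⟩ := exists_joint_extension (T := T) (U := U)
    (A := fun t x => fderiv ℝ (iteratedFDeriv ℝ 1 (u t)) x) (fun t ht => by
      obtain ⟨g, hg, hgu⟩ := (hu t ht).2.2 2 le_rfl
      exact ⟨fun x => continuousMultilinearCurryLeftEquiv ℝ (fun _ : Fin 2 => X) F (g x),
        (LinearIsometryEquiv.continuous _).comp_continuousOn hg, fun x hx => by
        simp only [hgu hx, hcl]⟩) fun t ht => by
      have := (LinearIsometryEquiv.isometry (continuousMultilinearCurryLeftEquiv ℝ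
        (fun _ : Fin 2 => X) F)).uniformContinuous.comp_tendstoUniformlyOn (hunif t ht 2 le_rfl)
      simp only [Function.comp_def, hcl] at this
      exact this
  exact ⟨fun z => Λ.comp (H z), by fun_prop, fun t ht x hx => by
    simpa only [hH t ht x hx] using hΛ t ht x hx⟩

end Extension

/-! ### Cut-off functions -/

open scoped Manifold ContDiff in
-- The value one is taken near each point of `K`, not only on `K`, so that multiplication by the
-- cut-off leaves derivatives on `K` unchanged.
theorem exists_smooth_cutoff {X : Type*} [NormedAddCommGroup X] [NormedSpace ℝ X]
    [FiniteDimensional ℝ X] {K U : Set X} (hK : IsCompact K) (hU : IsOpen U) (hKU : K ⊆ U) :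
    ∃ θ : X → ℝ, ContDiff ℝ (⊤ : ℕ∞) θ ∧ HasCompactSupport θ ∧ tsupport θ ⊆ U ∧
      (∀ x ∈ K, ∀ᶠ y in 𝓝 x, θ y = 1) ∧ ∀ x, θ x ∈ Icc (0 : ℝ) 1 := by
  obtain ⟨L, hL, hKL, hLU⟩ := exists_compact_between hK hU hKU
  obtain ⟨f, h0, h1, hf⟩ := exists_contMDiffMap_zero_one_nhds_of_isClosed 𝓘(ℝ, X) (n := (⊤ : ℕ∞))
    (isOpen_interior (s := L)).isClosed_compl hK.isClosed
    (disjoint_left.2 fun x hx hxK => hx (hKL hxK))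
  have hts : tsupport f ⊆ interior L := by
    intro x hx
    by_contra hxL
    have h2 := (mem_nhdsSet_iff_forall.1 h0) x hxL
    exact (notMem_tsupport_iff_eventuallyEq.2 h2) hx
  refine ⟨f, f.contMDiff.contDiff, ?_, hts.trans (interior_subset.trans hLU), fun x hx =>
    (mem_nhdsSet_iff_forall.1 h1) x hx, hf⟩
  exact hL.of_isClosed_subset (isClosed_tsupport _) (hts.trans interior_subset)

/-! ### Graph coordinates -/

/-- The coordinates of a point in directions orthogonal to `b 0`. -/
def proj (b : OrthonormalBasis (Fin 3) ℝ V) : V →L[ℝ] (Fin 2 → ℝ) :=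
  ContinuousLinearMap.pi fun i => innerSL ℝ (b i.succ)

/-- The point with coordinates `z.1` orthogonal to `b 0` and `z.2` along `b 0`. -/
def param (b : OrthonormalBasis (Fin 3) ℝ V) (z : (Fin 2 → ℝ) × ℝ) : V :=
  z.2 • b 0 + ∑ i, z.1 i • b i.succ

variable (b : OrthonormalBasis (Fin 3) ℝ V)

theorem proj_apply (y : V) (i : Fin 2) : proj b y i = ⟪b i.succ, y⟫ := rfl

theorem continuous_param : Continuous (param b) := by unfold param; fun_prop

theorem inner_param (z : (Fin 2 → ℝ) × ℝ) : ⟪param b z, b 0⟫ = z.2 := by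
  have h : ∀ i : Fin 2, ⟪b i.succ, b 0⟫ = 0 := fun i =>
    b.orthonormal.inner_eq_zero (Fin.succ_ne_zero i)
  have h0 : ⟪b 0, b 0⟫ = (1 : ℝ) := by
    rw [real_inner_self_eq_norm_sq, b.norm_eq_one, one_pow]
  simp only [param, inner_add_left, real_inner_smul_left, sum_inner, h, h0]
  simp

theorem proj_param (z : (Fin 2 → ℝ) × ℝ) : proj b (param b z) = z.1 := by
  ext i
  have h0 : ⟪b i.succ, b 0⟫ = 0 := b.orthonormal.inner_eq_zero (Fin.succ_ne_zero i)
  have h : ∀ j : Fin 2, ⟪b i.succ, b j.succ⟫ = if i = j then (1 : ℝ) else 0 := fun j => by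
    rw [orthonormal_iff_ite.1 b.orthonormal]; simp
  simp only [proj_apply, param, inner_add_right, real_inner_smul_right, inner_sum, h, h0]
  simp

theorem param_proj (y : V) : param b (proj b y, ⟪y, b 0⟫) = y := by
  conv_rhs => rw [← b.sum_repr' y, Fin.sum_univ_succ]
  simp [param, proj_apply, real_inner_comm]

/-- A swap, the splitting of one coordinate and an isometry are composed. This makes Fubini's
theorem available along the graph direction. -/
theorem measurePreserving_param : MeasurePreserving (param b) := by
  have h1 := (b.measurePreserving_repr_symm).comp ((PiLp.volume_preserving_toLp (Fin 3)).comp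
    ((volume_preserving_piFinSuccAbove (fun _ : Fin 3 => ℝ) 0).symm.comp
      (Measure.measurePreserving_swap (μ := (volume : Measure (Fin 2 → ℝ)))
        (ν := (volume : Measure ℝ)))))
  have h2 : param b = b.repr.symm ∘ WithLp.toLp 2 ∘
      (MeasurableEquiv.piFinSuccAbove (fun _ : Fin 3 => ℝ) 0).symm ∘ Prod.swap := by
    funext z
    simp only [Function.comp_apply, param]
    rw [← OrthonormalBasis.sum_repr_symm, Fin.sum_univ_succ (n := 2)]
    rfl
  rw [h2]
  exact h1

/-- Null sets of the surface measure project to Lebesgue null sets. -/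
theorem ae_graph_notMem {Z : Set V} (hZ : surf Z = 0) (h : (Fin 2 → ℝ) → ℝ) :
    ∀ᵐ a : Fin 2 → ℝ, param b (a, h a) ∉ Z := by
  have hl : LipschitzWith 1 (proj b) := by
    refine LipschitzWith.of_dist_le_mul fun x y => ?_
    rw [dist_eq_norm, dist_eq_norm, ← map_sub, NNReal.coe_one, one_mul,
      pi_norm_le_iff_of_nonneg (norm_nonneg _)]
    intro i
    rw [proj_apply]
    calc ‖⟪b i.succ, x - y⟫‖ ≤ ‖b i.succ‖ * ‖x - y‖ := norm_inner_le_norm _ _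
      _ = ‖x - y‖ := by rw [b.norm_eq_one, one_mul]
  -- The projection is a contraction into the plane with the maximum norm, where two-dimensional
  -- Hausdorff measure is Lebesgue measure.
  have h1 := hl.hausdorffMeasure_image_le (d := 2) (by norm_num) Z
  have h2 : (μH[2] : Measure V) Z = 0 := hZ
  rw [h2, mul_zero, nonpos_iff_eq_zero] at h1
  have h3 : (volume : Measure (Fin 2 → ℝ)) (proj b '' Z) = 0 := by
    rw [← hausdorffMeasure_pi_real]; simpa using h1
  have h4 : ∀ᵐ a : Fin 2 → ℝ, a ∉ proj b '' Z := measure_eq_zero_iff_ae_notMem.1 h3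
  filter_upwards [h4] with a ha hZ'
  exact ha ⟨_, hZ', proj_param b _⟩

theorem exists_orthonormalBasis {w : V} (hw : ‖w‖ = 1) :
    ∃ b : OrthonormalBasis (Fin 3) ℝ V, b 0 = w := by
  obtain ⟨b, hb⟩ := Orthonormal.exists_orthonormalBasis_extension_of_card_eq (𝕜 := ℝ) (E := V)
    (ι := Fin 3) (by simp) (v := fun _ => w) (s := {0}) (by
      refine ⟨fun i => hw, fun i j hij => absurd (Subsingleton.elim i j) hij⟩)
  exact ⟨b, hb 0 rfl⟩

/-! ### Normals of subgraphs -/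

/-- For d = n' - n one has ⟪d, n⟫ = -‖d‖²/2 and ⟪d, n'⟫ = ‖d‖²/2. A short step from x along d
therefore lies inside `Ω` according to n and outside according to n'. The aperture ‖d‖/4 leaves room
in both estimates. -/
theorem IsOuterNormal.unique {Ω : Set V} {x n n' : V} (h : IsOuterNormal Ω x n)
    (h' : IsOuterNormal Ω x n') : n = n' := by
  by_contra hne
  obtain ⟨-, hn, h⟩ := h
  obtain ⟨-, hn', h'⟩ := h'
  set d := n' - n
  have hd : 0 < ‖d‖ := norm_pos_iff.2 (sub_ne_zero.2 (Ne.symm hne))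
  have e1 : ⟪d, n⟫ = -(‖d‖ ^ 2) / 2 := by
    have := @norm_sub_sq_real V _ _ n' n
    rw [hn, hn'] at this
    rw [this, inner_sub_left, real_inner_self_eq_norm_sq, hn]; ring
  have e2 : ⟪d, n'⟫ = ‖d‖ ^ 2 / 2 := by
    have := @norm_sub_sq_real V _ _ n' n
    rw [hn, hn'] at this
    rw [this, inner_sub_left, real_inner_self_eq_norm_sq, hn', real_inner_comm]; ring
  obtain ⟨r, hr, H⟩ := h (‖d‖ / 4) (by positivity)
  obtain ⟨r', hr', H'⟩ := h' (‖d‖ / 4) (by positivity)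
  set t := min r r' / (2 * ‖d‖)
  have ht : 0 < t := by positivity
  have hnorm : ‖t • d‖ = min r r' / 2 := by
    rw [norm_smul, Real.norm_of_nonneg ht.le]; simp only [t]; field_simp
  have hm : 0 < min r r' := lt_min hr hr'
  have hb : ∀ ρ, min r r' ≤ ρ → x + t • d ∈ Metric.ball x ρ := fun ρ hρ => by
    rw [Metric.mem_ball, dist_eq_norm, add_sub_cancel_left, hnorm]; linarith
  have i1 := (H _ (hb r (min_le_left _ _))).1
  have i2 := (H' _ (hb r' (min_le_right _ _))).2
  rw [add_sub_cancel_left, real_inner_smul_left, norm_smul, Real.norm_of_nonneg ht.le] at i1 i2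
  refine i2 ?_ (i1 ?_)
  · rw [e2]; nlinarith [mul_pos ht (pow_pos hd 2)]
  · rw [e1]; nlinarith [mul_pos ht (pow_pos hd 2)]

/-- The (not normalized) outer normal of the subgraph of `h`, extended constantly along `b 0`. -/
def graphNormal (h : (Fin 2 → ℝ) → ℝ) (y : V) : V :=
  b 0 - ∑ i, fderiv ℝ h (proj b y) (Pi.single i 1) • b i.succ

theorem inner_graphNormal (h : (Fin 2 → ℝ) → ℝ) (y X : V) :
    ⟪X, graphNormal b h y⟫ = ⟪X, b 0⟫ - fderiv ℝ h (proj b y) (proj b X) := by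
  have : proj b X = ∑ i, proj b X i • Pi.single (M := fun _ => ℝ) i (1 : ℝ) := by
    ext j; simp [Finset.sum_apply, Pi.single_apply]
  rw [graphNormal, inner_sub_right, inner_sum, this, map_sum]
  congr 1
  refine Finset.sum_congr rfl fun i _ => ?_
  rw [map_smul, smul_eq_mul, real_inner_smul_right, proj_apply, real_inner_comm, mul_comm]

theorem graphNormal_ne_zero (h : (Fin 2 → ℝ) → ℝ) (y : V) : graphNormal b h y ≠ 0 := by
  intro h0
  have h1 := inner_graphNormal b h y (b 0)
  have h2 : proj b (b 0) = 0 := by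
    ext i; rw [proj_apply]; exact b.orthonormal.inner_eq_zero (Fin.succ_ne_zero i)
  rw [h0, h2, ContinuousLinearMap.map_zero, inner_zero_right, real_inner_self_eq_norm_sq, b.norm_eq_one] at h1
  norm_num at h1

section Subgraph

variable {b} {h : (Fin 2 → ℝ) → ℝ} {Ω : Set V} {p : V} {r : ℝ}

/-- Strictly below or above the graph a whole neighbourhood lies in `Ω` or in its complement. From a
point of the graph, `Ω` is reached by moving down along `b 0`. -/
theorem mem_frontier_iff_of_subgraph (hc : Continuous h)
    (hΩ : ∀ y ∈ Metric.ball p r, y ∈ Ω ↔ ⟪y, b 0⟫ < h (proj b y)) {y : V}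
    (hy : y ∈ Metric.ball p r) : y ∈ frontier Ω ↔ ⟪y, b 0⟫ = h (proj b y) := by
  have hnb := Metric.isOpen_ball.mem_nhds hy
  have hgc : Continuous fun z : V => h (proj b z) - ⟪z, b 0⟫ := by fun_prop
  constructor
  · intro hf
    rcases lt_trichotomy ⟪y, b 0⟫ (h (proj b y)) with hlt | heq | hgt
    · exfalso
      have : ∀ᶠ z in 𝓝 y, 0 < h (proj b z) - ⟪z, b 0⟫ :=
        hgc.continuousAt.eventually (lt_mem_nhds (sub_pos.2 hlt))
      refine hf.2 (mem_interior_iff_mem_nhds.2 ?_)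
      filter_upwards [this, hnb] with z hz hzb
      exact (hΩ z hzb).2 (sub_pos.1 hz)
    · exact heq
    · exfalso
      have : ∀ᶠ z in 𝓝 y, h (proj b z) - ⟪z, b 0⟫ < 0 :=
        hgc.continuousAt.eventually (gt_mem_nhds (sub_neg.2 hgt))
      have h2 : ∀ᶠ z in 𝓝 y, z ∉ Ω := by
        filter_upwards [this, hnb] with z hz hzb hzΩ
        exact absurd ((hΩ z hzb).1 hzΩ) (not_lt.2 (sub_neg.1 hz).le)
      exact (mem_closure_iff_frequently.1 hf.1) h2
  · intro heq
    have hpb0 : proj b (b 0) = 0 := by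
      ext i; rw [proj_apply]; exact b.orthonormal.inner_eq_zero (Fin.succ_ne_zero i)
    have hb0 : ⟪b 0, b 0⟫ = (1 : ℝ) := by
      rw [real_inner_self_eq_norm_sq, b.norm_eq_one, one_pow]
    refine ⟨?_, fun hi => ?_⟩
    · have ht : Tendsto (fun s : ℝ => y + s • b 0) (𝓝[<] 0) (𝓝 y) := by
        have : ContinuousAt (fun s : ℝ => y + s • b 0) 0 := by fun_prop
        simpa using this.tendsto.mono_left nhdsWithin_le_nhds
      refine mem_closure_of_tendsto ht ?_
      filter_upwards [ht hnb, self_mem_nhdsWithin] with s hs hs0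
      rw [hΩ _ hs, map_add, map_smul, hpb0, smul_zero, add_zero, inner_add_left, heq,
        real_inner_smul_left, hb0]
      have : s < 0 := hs0
      linarith
    · exact lt_irrefl _ (heq ▸ (hΩ y hy).1 (interior_subset hi))

/-- The function ⟪z, b 0⟫ - h(proj b z) decides membership in `Ω`, vanishes at y and has derivative
⟪·, N⟫ there. Outside a cone of aperture ε its linear part dominates the error, and so fixes the
sign. -/
theorem isOuterNormal_of_subgraph (hc : Continuous h)
    (hΩ : ∀ y ∈ Metric.ball p r, y ∈ Ω ↔ ⟪y, b 0⟫ < h (proj b y)) {y : V}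
    (hy : y ∈ Metric.ball p r) (hyf : y ∈ frontier Ω) (hd : DifferentiableAt ℝ h (proj b y)) :
    IsOuterNormal Ω y (‖graphNormal b h y‖⁻¹ • graphNormal b h y) := by
  set N := graphNormal b h y
  have hN : 0 < ‖N‖ := norm_pos_iff.2 (graphNormal_ne_zero b h y)
  refine ⟨hyf, by rw [norm_smul, norm_inv, norm_norm, inv_mul_cancel₀ hN.ne'], fun ε hε => ?_⟩
  have heq := (mem_frontier_iff_of_subgraph hc hΩ hy).1 hyf
  have hg : HasFDerivAt (fun z : V => ⟪z, b 0⟫ - h (proj b z))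
      (((innerSL ℝ (b 0)) : V →L[ℝ] ℝ) - (fderiv ℝ h (proj b y)).comp (proj b)) y := by
    have h1 : HasFDerivAt (fun z : V => ⟪z, b 0⟫) (innerSL ℝ (b 0)) y := by
      have := (innerSL ℝ (b 0)).hasFDerivAt (x := y)
      refine this.congr_of_eventuallyEq (Eventually.of_forall fun z => ?_)
      simp [real_inner_comm]
    exact h1.sub (hd.hasFDerivAt.comp y (proj b).hasFDerivAt)
  have hlo := hg.isLittleO.def (c := ε * ‖N‖) (by positivity)
  obtain ⟨ρ, hρ, H⟩ := Metric.eventually_nhds_iff_ball.1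
    (hlo.and (Metric.isOpen_ball.mem_nhds hy))
  refine ⟨ρ, hρ, fun z hz => ?_⟩
  obtain ⟨h1, h2⟩ := H z hz
  have h3 : (((innerSL ℝ (b 0)) : V →L[ℝ] ℝ) - (fderiv ℝ h (proj b y)).comp (proj b)) (z - y)
      = ⟪z - y, N⟫ := by
    rw [inner_graphNormal]; simp [real_inner_comm]
  rw [h3, heq, sub_self, sub_zero, Real.norm_eq_abs] at h1
  have h4 := abs_le.1 h1
  have e : ⟪z - y, ‖N‖⁻¹ • N⟫ = ‖N‖⁻¹ * ⟪z - y, N⟫ := real_inner_smul_right _ _ _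
  have hNN : ‖N‖ * ‖N‖⁻¹ = 1 := mul_inv_cancel₀ hN.ne'
  rw [e, hΩ z h2]
  constructor
  · intro hlt
    have : ⟪z - y, N⟫ < -(ε * ‖N‖) * ‖z - y‖ := by
      calc ⟪z - y, N⟫ = ‖N‖ * (‖N‖⁻¹ * ⟪z - y, N⟫) := by rw [← mul_assoc, hNN, one_mul]
        _ < ‖N‖ * (-ε * ‖z - y‖) := by gcongr
        _ = _ := by ring
    linarith [h4.2]
  · intro hlt
    have : ε * ‖N‖ * ‖z - y‖ < ⟪z - y, N⟫ := by
      calc ε * ‖N‖ * ‖z - y‖ = ‖N‖ * (ε * ‖z - y‖) := by ring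
        _ < ‖N‖ * (‖N‖⁻¹ * ⟪z - y, N⟫) := by gcongr
        _ = _ := by rw [← mul_assoc, hNN, one_mul]
    linarith [h4.1]

end Subgraph

/-! ### The flux through a Lipschitz graph -/

/-- Outside the open unit interval the function attains its minimum 0 or its maximum 1, so Fermat's
criterion applies. -/
theorem deriv_smoothTransition_of_notMem {x : ℝ} (hx : x ∉ Ioo (0 : ℝ) 1) :
    deriv Real.smoothTransition x = 0 := by
  rcases le_or_gt x 0 with h0 | h0
  · refine IsLocalMin.deriv_eq_zero (Eventually.of_forall fun y => ?_)
    rw [Real.smoothTransition.zero_of_nonpos h0]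
    exact Real.smoothTransition.nonneg y
  · have h1 : 1 ≤ x := by by_contra h; exact hx ⟨h0, not_le.1 h⟩
    refine IsLocalMax.deriv_eq_zero (Eventually.of_forall fun y => ?_)
    rw [Real.smoothTransition.one_of_one_le h1]
    exact Real.smoothTransition.le_one y

theorem contDiff_smoothTransition : ContDiff ℝ 1 Real.smoothTransition :=
  Real.smoothTransition.contDiff (n := 1)

theorem continuous_deriv_smoothTransition : Continuous (deriv Real.smoothTransition) :=
  contDiff_smoothTransition.continuous_deriv le_rfl

theorem hasCompactSupport_deriv_smoothTransition :
    HasCompactSupport (deriv Real.smoothTransition) :=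
  HasCompactSupport.intro (isCompact_Icc (a := (0 : ℝ)) (b := 1)) fun _ hx =>
    deriv_smoothTransition_of_notMem fun h => hx (Ioo_subset_Icc_self h)

theorem hasDerivAt_smoothTransition (x : ℝ) :
    HasDerivAt Real.smoothTransition (deriv Real.smoothTransition x) x :=
  (contDiff_smoothTransition.differentiable (by simp) x).hasDerivAt

/-- The unit mass makes the average over the boundary layer converge to the flux itself. -/
theorem integral_deriv_smoothTransition : ∫ x, deriv Real.smoothTransition x = 1 := by
  have h1 : ∫ x in (0 : ℝ)..1, deriv Real.smoothTransition x = 1 := by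
    rw [intervalIntegral.integral_eq_sub_of_hasDerivAt
      (fun x _ => hasDerivAt_smoothTransition x)
      (continuous_deriv_smoothTransition.intervalIntegrable _ _)]
    simp
  rw [← h1, intervalIntegral.integral_of_le zero_le_one]
  refine (setIntegral_eq_integral_of_forall_compl_eq_zero fun x hx => ?_).symm
  exact deriv_smoothTransition_of_notMem fun h => hx ⟨h.1, h.2.le⟩

theorem exists_lipschitz_smoothTransition : ∃ C : ℝ≥0, LipschitzWith C Real.smoothTransition := by
  obtain ⟨C, hC⟩ := hasCompactSupport_deriv_smoothTransition.exists_bound_of_continuous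
    continuous_deriv_smoothTransition
  refine ⟨C.toNNReal, lipschitzWith_of_nnnorm_deriv_le
    (contDiff_smoothTransition.differentiable (by simp)) fun x => ?_⟩
  rw [← NNReal.coe_le_coe, coe_nnnorm]
  exact (hC x).trans (Real.le_coe_toNNReal C)

variable (b : OrthonormalBasis (Fin 3) ℝ V)

/-- Rademacher's theorem in the parameter plane; the exceptional set is a union of whole fibres of
the projection. -/
theorem ae_differentiableAt_proj {h : (Fin 2 → ℝ) → ℝ} {K : ℝ≥0} (hh : LipschitzWith K h) :
    ∀ᵐ y : V, DifferentiableAt ℝ h (proj b y) := by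
  have hm : MeasurableSet {a | DifferentiableAt ℝ h a} := measurableSet_of_differentiableAt ℝ h
  rw [← (measurePreserving_param b).map_eq]
  refine (ae_map_iff (p := fun y => DifferentiableAt ℝ h (proj b y))
    (continuous_param b).aemeasurable ((proj b).continuous.measurable hm)).2 ?_
  simp only [proj_param]
  exact Measure.quasiMeasurePreserving_fst.ae hh.ae_differentiableAt

theorem hasFDerivAt_inner_left (w y : V) : HasFDerivAt (fun z : V => ⟪z, w⟫) (innerSL ℝ w) y :=
  (innerSL ℝ w).hasFDerivAt.congr_of_eventuallyEq
    (Eventually.of_forall fun z => by simp [real_inner_comm])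

theorem divg_eq (G : V →L[ℝ] V) : divg G = ∑ i, G (EuclideanSpace.single i 1) i := rfl

theorem continuous_divg : Continuous divg := by
  have : divg = fun G : V →L[ℝ] V => ∑ i, G (EuclideanSpace.single i 1) i := funext divg_eq
  rw [this]
  fun_prop

/-- Integration by parts for a Lipschitz function and a compactly supported `C¹` field. -/
theorem integral_mul_divg {F : V → ℝ} {C : ℝ≥0} (hF : LipschitzWith C F) {Y : V → V}
    (hY : ContDiff ℝ 1 Y) (hYs : HasCompactSupport Y) :
    ∫ y, F y * divg (fderiv ℝ Y y) = -∫ y, fderiv ℝ F y (Y y) := by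
  have hYd := hY.differentiable (by simp)
  have key : ∀ i : Fin 3, ∫ y, F y * fderiv ℝ Y y (EuclideanSpace.single i 1) i
      = -∫ y, fderiv ℝ F y (EuclideanSpace.single i 1) * Y y i := by
    intro i
    have hYi : ContDiff ℝ 1 fun y => Y y i := by fun_prop
    have hYis : HasCompactSupport fun y => Y y i := hYs.comp_left (g := fun z : V => z i) rfl
    -- `F` is only Lipschitz, so the integration by parts is done for line derivatives, which agree
    -- with the Fréchet derivative almost everywhere.
    have h1 := hF.integral_lineDeriv_mul_eq (μ := volume)
      (hYi.lipschitzWith_of_hasCompactSupport hYis (by simp)).choose_spec hYis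
      (EuclideanSpace.single i 1)
    have h2 : ∀ y, lineDeriv ℝ (fun y => Y y i) y (-EuclideanSpace.single i 1)
        = -(fderiv ℝ Y y (EuclideanSpace.single i 1) i) := by
      intro y
      have : HasFDerivAt (fun y => Y y i) ((EuclideanSpace.proj i).comp (fderiv ℝ Y y)) y :=
        (EuclideanSpace.proj (𝕜 := ℝ) i).hasFDerivAt.comp y (hYd y).hasFDerivAt
      rw [(this.hasLineDerivAt _).lineDeriv]
      simp
    have h3 : ∫ y, lineDeriv ℝ F y (EuclideanSpace.single i 1) * Y y i
        = ∫ y, fderiv ℝ F y (EuclideanSpace.single i 1) * Y y i := by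
      refine integral_congr_ae ?_
      filter_upwards [hF.ae_differentiableAt] with y hy
      rw [hy.lineDeriv_eq_fderiv]
    rw [← h3, h1, ← integral_neg]
    refine integral_congr_ae (Eventually.of_forall fun y => ?_)
    simp only [h2]; ring
  have hint1 : ∀ i : Fin 3, Integrable fun y => F y * fderiv ℝ Y y (EuclideanSpace.single i 1) i := by
    intro i
    refine Continuous.integrable_of_hasCompactSupport ?_ ?_
    · have := hY.continuous_fderiv (by simp)
      have := hF.continuous
      fun_prop
    · refine HasCompactSupport.mul_left (f := fun y => F y) ?_
      exact (hYs.fderiv (𝕜 := ℝ)).comp_left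
        (g := fun G : V →L[ℝ] V => G (EuclideanSpace.single i 1) i) rfl
  have hint2 : ∀ i : Fin 3,
      Integrable fun y => fderiv ℝ F y (EuclideanSpace.single i 1) * Y y i := by
    intro i
    have hYi : Integrable fun y => Y y i := by
      refine Continuous.integrable_of_hasCompactSupport ?_ (hYs.comp_left (g := fun z : V => z i) rfl)
      have := hY.continuous
      fun_prop
    refine hYi.bdd_mul (c := C) (measurable_fderiv_apply_const ℝ F _).aestronglyMeasurable ?_
    refine Eventually.of_forall fun y => ?_
    calc ‖fderiv ℝ F y (EuclideanSpace.single i 1)‖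
        ≤ ‖fderiv ℝ F y‖ * ‖(EuclideanSpace.single i 1 : V)‖ := ContinuousLinearMap.le_opNorm _ _
      _ ≤ C := by simpa using norm_fderiv_le_of_lipschitz ℝ hF
  have hsum : ∀ y, fderiv ℝ F y (Y y)
      = ∑ i, fderiv ℝ F y (EuclideanSpace.single i 1) * Y y i := by
    intro y
    conv_lhs => rw [show Y y = ∑ i, Y y i • (EuclideanSpace.single i 1 : V) by
      ext j; simp [Finset.sum_apply, Pi.single_apply]]
    rw [map_sum]
    exact Finset.sum_congr rfl fun i _ => by rw [map_smul, smul_eq_mul, mul_comm]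
  simp only [divg_eq, Finset.mul_sum, hsum]
  rw [integral_finsetSum _ fun i _ => hint1 i, integral_finsetSum _ fun i _ => hint2 i,
    ← Finset.sum_neg_distrib]
  exact Finset.sum_congr rfl fun i _ => key i

/-- A field that is `C¹` in `U`, multiplied by a smooth function supported in `U`. -/
theorem contDiff_smul_of_tsupport_subset {U : Set V} {θ : V → ℝ} (hθ : ContDiff ℝ (⊤ : ℕ∞) θ)
    (hθU : tsupport θ ⊆ U) {X : V → V} {D : V → V →L[ℝ] V} (hD : ContinuousOn D U)
    (hU : IsOpen U)
    (hX : ∀ x ∈ U, HasFDerivAt X (D x) x) : ContDiff ℝ 1 fun y => θ y • X y := by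
  rw [contDiff_iff_contDiffAt]
  intro x
  by_cases hx : x ∈ tsupport θ
  · have h1 : ContDiffOn ℝ 1 X U := by
      have := (contDiffOn_succ_iff_fderiv_of_isOpen (𝕜 := ℝ) (n := 0) (f := X) hU).2
        ⟨fun x hx => (hX x hx).differentiableAt.differentiableWithinAt, by simp, by
          rw [contDiffOn_zero]; exact hD.congr fun x hx => (hX x hx).fderiv⟩
      simpa using this
    exact (hθ.contDiffAt.of_le (by exact_mod_cast le_top)).smul
      (h1.contDiffAt (hU.mem_nhds (hθU hx)))
  · have h0 := notMem_tsupport_iff_eventuallyEq.1 hx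
    refine (contDiffAt_const (c := (0 : V))).congr_of_eventuallyEq ?_
    filter_upwards [h0] with y hy
    simp [hy]

/-! ### The boundary layer below a Lipschitz graph -/

/-- The flux density of `X` through the translates of the graph of `h`. -/
def graphFlux (h : (Fin 2 → ℝ) → ℝ) (X : V → V) (y : V) : ℝ :=
  ⟪X y, b 0⟫ - fderiv ℝ h (proj b y) (proj b (X y))

section LocalFlux

variable {b} {h : (Fin 2 → ℝ) → ℝ} {K : ℝ≥0} {Ω : Set V} {p : V} {r : ℝ} {X : V → V}
  {D : V → V →L[ℝ] V}

theorem fderiv_eq_zero_of_notMem_tsupport (hXD : ∀ x ∈ Ω, HasFDerivAt X (D x) x) {y : V}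
    (hy : y ∈ Ω) (hyX : y ∉ tsupport X) : D y = 0 := by
  have h0 := notMem_tsupport_iff_eventuallyEq.1 hyX
  have h1 : HasFDerivAt X (0 : V →L[ℝ] V) y :=
    (hasFDerivAt_const (0 : V) y).congr_of_eventuallyEq h0
  exact (hXD y hy).unique h1

/-- The cut-off is a function of the depth below the graph and vanishes up to depth ε; the shift by
1 in its argument serves this purpose. The field may thus be replaced by a compactly supported one
inside `Ω`, and integration by parts moves the derivative onto the cut-off, where it produces the
flux through translates of the graph. -/
theorem integral_cutoff_mul_divg (hh : LipschitzWith K h) (hΩo : IsOpen Ω)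
    (hΩ : ∀ y ∈ Metric.ball p r, y ∈ Ω ↔ ⟪y, b 0⟫ < h (proj b y))
    (hD : ContinuousOn D Ω) (hXD : ∀ x ∈ Ω, HasFDerivAt X (D x) x)
    (hXs : HasCompactSupport X) (hXt : tsupport X ⊆ Metric.ball p r) {ε : ℝ} (hε : 0 < ε) :
    ∫ y in Ω, Real.smoothTransition ((h (proj b y) - ⟪y, b 0⟫) / ε - 1) * divg (D y)
      = ∫ y, ε⁻¹ * deriv Real.smoothTransition ((h (proj b y) - ⟪y, b 0⟫) / ε - 1)
          * graphFlux b h X y := by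
  set g : V → ℝ := fun y => h (proj b y) - ⟪y, b 0⟫
  have hgc : Continuous g := by have := hh.continuous; fun_prop
  -- The part of the support at depth at least ε is compact in `Ω`, although the support itself may
  -- reach the boundary.
  obtain ⟨θ, hθ, hθs, hθΩ, hθ1, -⟩ := exists_smooth_cutoff (K := tsupport X ∩ {y | ε ≤ g y})
    (hXs.isCompact.inter_right (isClosed_le continuous_const hgc)) hΩo (by
      rintro y ⟨hy, hgy⟩
      rw [hΩ y (hXt hy)]
      have : ε ≤ h (proj b y) - ⟪y, b 0⟫ := hgy
      linarith)
  set Y : V → V := fun y => θ y • X y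
  have hY : ContDiff ℝ 1 Y := contDiff_smul_of_tsupport_subset hθ hθΩ hD hΩo hXD
  have hYs : HasCompactSupport Y := hθs.smul_right
  obtain ⟨C, hC⟩ := exists_lipschitz_smoothTransition
  have hin : LipschitzWith (K * ‖proj b‖₊ + 1) g := by
    refine (hh.comp (proj b).lipschitz).sub (LipschitzWith.of_dist_le_mul fun x y => ?_)
    rw [dist_eq_norm, ← inner_sub_left, dist_eq_norm, NNReal.coe_one, one_mul]
    exact (norm_inner_le_norm _ _).trans (by rw [b.norm_eq_one, mul_one])
  have hF : LipschitzWith (C * (‖ε⁻¹‖₊ * (K * ‖proj b‖₊ + 1)))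
      fun y => Real.smoothTransition (g y / ε - 1) := by
    refine hC.comp ?_
    refine LipschitzWith.of_dist_le_mul fun x y => ?_
    rw [Real.dist_eq, NNReal.coe_mul, coe_nnnorm, mul_assoc,
      show g x / ε - 1 - (g y / ε - 1) = ε⁻¹ * (g x - g y) by ring, abs_mul, Real.norm_eq_abs]
    gcongr
    exact hin.dist_le_mul x y
  have hYX : ∀ y, ε ≤ g y → Y y = X y := by
    intro y hy
    by_cases hyX : y ∈ tsupport X
    · simp [Y, (hθ1 y ⟨hyX, hy⟩).self_of_nhds]
    · simp [Y, image_eq_zero_of_notMem_tsupport hyX]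
  have hsmall : ∀ y, g y < ε → g y / ε - 1 ≤ 0 := fun y hy => by
    rw [sub_nonpos, div_le_one hε]; exact hy.le
  have key := integral_mul_divg hF hY hYs
  have e1 : ∫ y, Real.smoothTransition (g y / ε - 1) * divg (fderiv ℝ Y y)
      = ∫ y in Ω, Real.smoothTransition (g y / ε - 1) * divg (D y) := by
    rw [← integral_indicator hΩo.measurableSet]
    refine integral_congr_ae (Eventually.of_forall fun y => ?_)
    dsimp only
    by_cases hyΩ : y ∈ Ω
    · rw [indicator_of_mem hyΩ]
      rcases lt_or_ge (g y) ε with hy | hy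
      · rw [Real.smoothTransition.zero_of_nonpos (hsmall y hy), zero_mul, zero_mul]
      · congr 2
        by_cases hyX : y ∈ tsupport X
        · have : Y =ᶠ[𝓝 y] X := by
            filter_upwards [hθ1 y ⟨hyX, hy⟩] with z hz
            simp [Y, hz]
          rw [this.fderiv_eq, (hXD y hyΩ).fderiv]
        · have : Y =ᶠ[𝓝 y] fun _ => 0 := by
            filter_upwards [notMem_tsupport_iff_eventuallyEq.1 hyX] with z hz
            simp [Y, hz]
          rw [this.fderiv_eq, fderiv_eq_zero_of_notMem_tsupport hXD hyΩ hyX]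
          simp
    · rw [indicator_of_notMem hyΩ]
      have : Y =ᶠ[𝓝 y] fun _ => 0 := by
        filter_upwards [notMem_tsupport_iff_eventuallyEq.1 fun h' => hyΩ (hθΩ h')] with z hz
        simp [Y, hz]
      rw [this.fderiv_eq]
      simp [divg_eq]
  rw [← e1, key, ← integral_neg]
  refine integral_congr_ae ?_
  filter_upwards [ae_differentiableAt_proj b hh] with y hy
  have hg : HasFDerivAt g ((fderiv ℝ h (proj b y)).comp (proj b) - innerSL ℝ (b 0)) y :=
    (hy.hasFDerivAt.comp y (proj b).hasFDerivAt).sub (hasFDerivAt_inner_left _ _)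
  have h2 : HasFDerivAt (fun y => g y / ε - 1)
      (ε⁻¹ • ((fderiv ℝ h (proj b y)).comp (proj b) - innerSL ℝ (b 0))) y := by
    simpa only [div_eq_inv_mul] using (hg.const_mul ε⁻¹).sub_const 1
  have h3 := (hasDerivAt_smoothTransition (g y / ε - 1)).comp_hasFDerivAt y h2
  have h4 : fderiv ℝ (fun y => Real.smoothTransition (g y / ε - 1)) y = _ := h3.fderiv
  rw [h4]
  rcases lt_or_ge (g y) ε with hy' | hy'
  · have : deriv Real.smoothTransition (g y / ε - 1) = 0 :=
      deriv_smoothTransition_of_notMem fun h' => absurd h'.1 (not_lt.2 (hsmall y hy'))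
    rw [this]
    simp
  · rw [hYX y hy', graphFlux]
    simp [real_inner_comm]
    ring

/-- The gradient of a Lipschitz graph function is only measurable, so no continuity is available
here. -/
theorem measurable_graphFlux (hX : Continuous X) : Measurable (graphFlux b h X) := by
  have h1 : graphFlux b h X = fun y => ⟪X y, b 0⟫
      - ∑ i, fderiv ℝ h (proj b y) (Pi.single i 1) * ⟪X y, b i.succ⟫ := by
    funext y
    have := inner_graphNormal b h y (X y)
    rw [graphFlux, ← this, graphNormal, inner_sub_right, inner_sum]
    simp only [real_inner_smul_right]
  rw [h1]
  have h2 : ∀ i : Fin 2, Measurable fun y => fderiv ℝ h (proj b y) (Pi.single i 1) := fun i =>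
    (measurable_fderiv_apply_const ℝ h _).comp (proj b).continuous.measurable
  have h3 : ∀ w : V, Measurable fun y => ⟪X y, w⟫ := fun w =>
    (hX.inner continuous_const).measurable
  exact (h3 _).sub (Finset.measurable_sum _ fun i _ => (h2 i).mul (h3 _))

theorem exists_graphFlux_bound (hh : LipschitzWith K h) (hX : Continuous X)
    (hXs : HasCompactSupport X) : ∃ C, ∀ y, |graphFlux b h X y| ≤ C := by
  obtain ⟨C, hC⟩ := hXs.exists_bound_of_continuous hX
  have hC0 : 0 ≤ C := (norm_nonneg _).trans (hC 0)
  refine ⟨C + K * (‖proj b‖ * C), fun y => ?_⟩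
  rw [graphFlux]
  refine (abs_sub _ _).trans (add_le_add ?_ ?_)
  · calc |⟪X y, b 0⟫| ≤ ‖X y‖ * ‖b 0‖ := abs_real_inner_le_norm _ _
      _ ≤ C := by rw [b.norm_eq_one, mul_one]; exact hC y
  · calc |fderiv ℝ h (proj b y) (proj b (X y))|
        ≤ ‖fderiv ℝ h (proj b y)‖ * ‖proj b (X y)‖ := by
          rw [← Real.norm_eq_abs]; exact ContinuousLinearMap.le_opNorm _ _
      _ ≤ K * (‖proj b‖ * C) := by
        gcongr
        · exact norm_fderiv_le_of_lipschitz ℝ hh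
        · exact ((proj b).le_opNorm _).trans (by gcongr; exact hC y)

theorem graphFlux_eq_zero {y : V} (hy : X y = 0) : graphFlux b h X y = 0 := by
  rw [graphFlux, hy]; simp

/-- The divergence theorem near a boundary point, for a subgraph of a Lipschitz function. -/
theorem integral_divg_eq_integral_graphFlux (hh : LipschitzWith K h) (hΩo : IsOpen Ω)
    (hΩ : ∀ y ∈ Metric.ball p r, y ∈ Ω ↔ ⟪y, b 0⟫ < h (proj b y)) (hX : Continuous X)
    (hD : Continuous D) (hXD : ∀ x ∈ Ω, HasFDerivAt X (D x) x)
    (hXs : HasCompactSupport X) (hXt : tsupport X ⊆ Metric.ball p r) :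
    ∫ y in Ω, divg (D y) = ∫ a, graphFlux b h X (param b (a, h a)) := by
  set ε : ℕ → ℝ := fun n => 1 / ((n : ℝ) + 1)
  have hε : ∀ n, 0 < ε n := fun n => Nat.one_div_pos_of_nat
  have hε0 : Tendsto ε atTop (𝓝 0) := tendsto_one_div_add_atTop_nhds_zero_nat
  set g : V → ℝ := fun y => h (proj b y) - ⟪y, b 0⟫
  have hgc : Continuous g := by have := hh.continuous; fun_prop
  -- the volume integrals converge
  have lim1 : Tendsto (fun n => ∫ y in Ω, Real.smoothTransition (g y / ε n - 1) * divg (D y))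
      atTop (𝓝 (∫ y in Ω, divg (D y))) := by
    obtain ⟨M, hM⟩ := hXs.isCompact.exists_bound_of_continuousOn
      (continuous_divg.comp hD).continuousOn
    have hK : MeasurableSet (tsupport X) := (isClosed_tsupport X).measurableSet
    refine tendsto_integral_of_dominated_convergence ((tsupport X).indicator fun _ => M)
      (fun n => ?_) ?_ (fun n => ?_) ?_
    · refine Continuous.aestronglyMeasurable ?_
      have h1 := Real.smoothTransition.continuous
      have h2 := continuous_divg
      fun_prop
    · rw [integrable_indicator_iff hK]
      refine integrableOn_const (hs := ?_)
      exact ((Measure.restrict_apply_le _ _).trans_lt hXs.isCompact.measure_lt_top).ne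
    · filter_upwards [ae_restrict_mem hΩo.measurableSet] with y hy
      by_cases hyX : y ∈ tsupport X
      · rw [indicator_of_mem hyX, norm_mul]
        calc _ ≤ 1 * ‖divg (D y)‖ := by
              gcongr
              rw [Real.norm_of_nonneg (Real.smoothTransition.nonneg _)]
              exact Real.smoothTransition.le_one _
          _ ≤ M := by rw [one_mul]; exact hM y hyX
      · rw [fderiv_eq_zero_of_notMem_tsupport hXD hy hyX, indicator_of_notMem hyX]
        simp [divg_eq]
    · filter_upwards [ae_restrict_mem hΩo.measurableSet] with y hy
      by_cases hyX : y ∈ tsupport X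
      · have hpos : 0 < g y := sub_pos.2 ((hΩ y (hXt hyX)).1 hy)
        refine tendsto_const_nhds.congr' ?_
        have : ∀ᶠ n in atTop, ε n < g y / 2 := hε0.eventually (gt_mem_nhds (by positivity))
        filter_upwards [this] with n hn
        rw [Real.smoothTransition.one_of_one_le, one_mul]
        rw [le_sub_iff_add_le, le_div_iff₀ (hε n)]
        linarith
      · rw [fderiv_eq_zero_of_notMem_tsupport hXD hy hyX]
        simp [divg_eq]
  set S := deriv Real.smoothTransition
  obtain ⟨C, hC⟩ := exists_graphFlux_bound (b := b) hh hX hXs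
  have hC0 : 0 ≤ C := (abs_nonneg _).trans (hC 0)
  have hqm := measurable_graphFlux (b := b) (h := h) hX
  obtain ⟨B, hB⟩ := hasCompactSupport_deriv_smoothTransition.exists_bound_of_continuous
    continuous_deriv_smoothTransition
  -- The compact shadow of the support gives a dominating function that does not depend on the
  -- depth, hence not on n.
  set A := proj b '' tsupport X
  have hA : IsCompact A := hXs.isCompact.image (proj b).continuous
  have hzero : ∀ a ∉ A, ∀ s, graphFlux b h X (param b (a, s)) = 0 := fun a ha s => by
    refine graphFlux_eq_zero (image_eq_zero_of_notMem_tsupport fun h' => ha ?_)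
    exact ⟨_, h', proj_param b _⟩
  have hpm : Measurable (param b) := (continuous_param b).measurable
  have hSm : Measurable S := continuous_deriv_smoothTransition.measurable
  have hSi : Integrable S := continuous_deriv_smoothTransition.integrable_of_hasCompactSupport
    hasCompactSupport_deriv_smoothTransition
  have hhm : Measurable h := hh.continuous.measurable
  have bound_int : Integrable fun z : (Fin 2 → ℝ) × ℝ => A.indicator (fun _ => C) z.1 * ‖S z.2‖ := by
    refine Integrable.mul_prod ?_ hSi.norm
    rw [integrable_indicator_iff hA.measurableSet]
    exact integrableOn_const (hs := hA.measure_lt_top.ne)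
  have bound : ∀ (z : (Fin 2 → ℝ) × ℝ) (s : ℝ), ‖S z.2 * graphFlux b h X (param b (z.1, s))‖
      ≤ A.indicator (fun _ => C) z.1 * ‖S z.2‖ := by
    intro z s
    rw [norm_mul, mul_comm]
    by_cases hz : z.1 ∈ A
    · rw [indicator_of_mem hz]
      gcongr
      exact hC _
    · rw [hzero _ hz, indicator_of_notMem hz]; simp
  have meas : ∀ n, Measurable fun z : (Fin 2 → ℝ) × ℝ =>
      S z.2 * graphFlux b h X (param b (z.1, h z.1 - ε n * (z.2 + 1))) := by
    intro n
    refine (hSm.comp measurable_snd).mul (hqm.comp (hpm.comp ?_))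
    exact measurable_fst.prodMk ((hhm.comp measurable_fst).sub
      ((measurable_snd.add_const 1).const_mul _))
  -- change of variables
  have cov : ∀ n, ∫ y, (ε n)⁻¹ * S (g y / ε n - 1) * graphFlux b h X y
      = ∫ z : (Fin 2 → ℝ) × ℝ, S z.2 * graphFlux b h X (param b (z.1, h z.1 - ε n * (z.2 + 1))) := by
    intro n
    have emb : MeasurableEmbedding (param b) := by
      refine Topology.IsClosedEmbedding.measurableEmbedding ?_
      have hi : Function.LeftInverse (fun y : V => (proj b y, ⟪y, b 0⟫)) (param b) := fun z =>
        Prod.ext (proj_param b z) (inner_param b z)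
      exact hi.isClosedEmbedding (by fun_prop) (continuous_param b)
    rw [← (measurePreserving_param b).integral_comp emb]
    -- On each fibre the substitution s = h a - ε(u + 1) turns the argument of the cut-off into u
    -- and absorbs the factor ε⁻¹.
    have inner_eq : ∀ a : Fin 2 → ℝ,
        ∫ s, (ε n)⁻¹ * S (g (param b (a, s)) / ε n - 1) * graphFlux b h X (param b (a, s))
        = ∫ u, S u * graphFlux b h X (param b (a, h a - ε n * (u + 1))) := by
      intro a
      set G : ℝ → ℝ := fun s =>
        (ε n)⁻¹ * S (g (param b (a, s)) / ε n - 1) * graphFlux b h X (param b (a, s))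
      have h1 : ∫ s, G s = ∫ s, G (h a - ε n - s) := (integral_sub_left_eq_self G volume _).symm
      have h2 := Measure.integral_comp_mul_left (fun s => G (h a - ε n - s)) (ε n)
      have h4 : ∫ s, G (h a - ε n - s) = ε n * ∫ u, G (h a - ε n - ε n * u) := by
        rw [h2, smul_eq_mul, abs_of_pos (inv_pos.2 (hε n)), mul_inv_cancel_left₀ (hε n).ne']
      rw [h1, h4, ← integral_const_mul]
      refine integral_congr_ae (Eventually.of_forall fun u => ?_)
      have h3 : g (param b (a, h a - ε n - ε n * u)) / ε n - 1 = u := by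
        simp only [g, proj_param, inner_param]
        field_simp [(hε n).ne']
        ring
      simp only [G, h3]
      rw [show h a - ε n - ε n * u = h a - ε n * (u + 1) by ring, ← mul_assoc, ← mul_assoc,
        mul_inv_cancel₀ (hε n).ne', one_mul]
    rw [Measure.volume_eq_prod, integral_prod, integral_prod]
    · exact integral_congr_ae (Eventually.of_forall fun a => inner_eq a)
    · exact bound_int.mono' (meas n).aestronglyMeasurable
        (Eventually.of_forall fun z => bound z _)
    · refine ((measurePreserving_param b).integrable_comp_emb emb
        (g := fun y => (ε n)⁻¹ * S (g y / ε n - 1) * graphFlux b h X y)).2 ?_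
      have hK : MeasurableSet (tsupport X) := (isClosed_tsupport X).measurableSet
      refine Integrable.mono' (g := (tsupport X).indicator fun _ => (ε n)⁻¹ * B * C) ?_ ?_ ?_
      · rw [integrable_indicator_iff hK]
        exact integrableOn_const (hs := hXs.isCompact.measure_lt_top.ne)
      · refine Measurable.aestronglyMeasurable (Measurable.mul (Measurable.const_mul ?_ _) hqm)
        exact hSm.comp (((hgc.measurable).div_const _).sub_const _)
      · refine Eventually.of_forall fun y => ?_
        by_cases hy : y ∈ tsupport X
        · rw [indicator_of_mem hy, norm_mul, norm_mul, norm_inv, Real.norm_of_nonneg (hε n).le]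
          have hB0 : 0 ≤ B := (norm_nonneg _).trans (hB 0)
          have := hε n
          gcongr
          · exact hB _
          · exact hC _
        · rw [indicator_of_notMem hy, graphFlux_eq_zero (image_eq_zero_of_notMem_tsupport hy)]
          simp
  have lim2 : Tendsto (fun n => ∫ z : (Fin 2 → ℝ) × ℝ,
      S z.2 * graphFlux b h X (param b (z.1, h z.1 - ε n * (z.2 + 1)))) atTop
      (𝓝 (∫ z : (Fin 2 → ℝ) × ℝ, S z.2 * graphFlux b h X (param b (z.1, h z.1)))) := by
    refine tendsto_integral_of_dominated_convergence _
      (fun n => (meas n).aestronglyMeasurable) bound_int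
      (fun n => Eventually.of_forall fun z => bound z _) (Eventually.of_forall fun z => ?_)
    -- Along a fibre the gradient of `h` is evaluated at one fixed point, so the flux density is
    -- continuous in the depth even where `h` is not differentiable.
    have hcont : Continuous fun s : ℝ => graphFlux b h X (param b (z.1, s)) := by
      have := continuous_param b
      simp only [graphFlux, proj_param]
      fun_prop
    have : Tendsto (fun n => h z.1 - ε n * (z.2 + 1)) atTop (𝓝 (h z.1)) := by
      simpa using (hε0.mul_const (z.2 + 1)).const_sub (h z.1)
    exact ((hcont.tendsto _).comp this).const_mul _
  have fin : ∫ z : (Fin 2 → ℝ) × ℝ, S z.2 * graphFlux b h X (param b (z.1, h z.1))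
      = ∫ a, graphFlux b h X (param b (a, h a)) := by
    have := integral_prod_mul (μ := (volume : Measure (Fin 2 → ℝ))) (ν := (volume : Measure ℝ))
      (fun a => graphFlux b h X (param b (a, h a))) S
    rw [integral_deriv_smoothTransition, mul_one] at this
    rw [← this]
    refine integral_congr_ae (Eventually.of_forall fun z => ?_)
    simp only [mul_comm]
  rw [← fin]
  refine tendsto_nhds_unique lim1 (lim2.congr fun n => ?_)
  rw [← cov n]
  exact (integral_cutoff_mul_divg hh hΩo hΩ hD.continuousOn hXD hXs hXt (hε n)).symm

end LocalFlux

/-! ### The divergence theorem for tangential fields on Lipschitz domains -/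

theorem IsSubgraphNear.exists_basis {Reg : (V → ℝ) → Prop} {Ω : Set V} {p : V}
    (h : IsSubgraphNear Reg Ω p) : ∃ (b : OrthonormalBasis (Fin 3) ℝ V) (k : V → ℝ), Reg k ∧
      ∃ r > 0, ∀ y ∈ Metric.ball p r, y ∈ Ω ↔ ⟪y, b 0⟫ < k (param b (proj b y, 0)) := by
  obtain ⟨w, hw, k, hk, r, hr, H⟩ := h
  obtain ⟨b, rfl⟩ := exists_orthonormalBasis hw
  refine ⟨b, k, hk, r, hr, fun y hy => ?_⟩
  rw [H y hy]
  have : y - ⟪y, b 0⟫ • b 0 = param b (proj b y, 0) := by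
    conv_lhs => rw [← param_proj b y]
    simp only [inner_param]
    simp [param]
  rw [this]

theorem integrableOn_of_continuous {X F : Type*} [NormedAddCommGroup X] [ProperSpace X]
    [MeasurableSpace X] [BorelSpace X] [NormedAddCommGroup F] {μ : Measure X}
    [IsFiniteMeasureOnCompacts μ] {Ω : Set X} (hb : Bornology.IsBounded Ω)
    {f : X → F} (hf : Continuous f) : IntegrableOn f Ω μ :=
  (hf.continuousOn.integrableOn_compact hb.isCompact_closure).mono_set subset_closure

theorem integral_divg_compact {Y : V → V} (hY : ContDiff ℝ 1 Y) (hYs : HasCompactSupport Y) :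
    ∫ y, divg (fderiv ℝ Y y) = 0 := by
  have := integral_mul_divg (F := fun _ => 1) (C := 0) (LipschitzWith.const 1) hY hYs
  simpa using this

/-- The derivative of `ζ • X`. -/
def smulDeriv (ζ : V → ℝ) (X : V → V) (D : V → V →L[ℝ] V) (y : V) : V →L[ℝ] V :=
  ζ y • D y + (fderiv ℝ ζ y).smulRight (X y)

theorem continuous_smulDeriv {ζ : V → ℝ} (hζ : ContDiff ℝ 1 ζ) {X : V → V} (hX : Continuous X)
    {D : V → V →L[ℝ] V} (hD : Continuous D) : Continuous (smulDeriv ζ X D) := by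
  have h1 := hζ.continuous
  have h2 := hζ.continuous_fderiv (by simp)
  refine continuous_clm_apply.2 fun v => ?_
  simp only [smulDeriv, add_apply, smul_apply,
    ContinuousLinearMap.smulRight_apply]
  fun_prop

theorem hasFDerivAt_smulDeriv {ζ : V → ℝ} (hζ : ContDiff ℝ 1 ζ) {X : V → V} {D : V → V →L[ℝ] V}
    {y : V} (h : HasFDerivAt X (D y) y) :
    HasFDerivAt (fun y => ζ y • X y) (smulDeriv ζ X D y) y :=
  (hζ.differentiable (by simp) y).hasFDerivAt.smul h

theorem surf_bad_eq_zero {Ω : Set V} {Q : V → Prop}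
    (hn : ∀ᵐ x ∂surf.restrict (frontier Ω), Q x) : surf {x | x ∈ frontier Ω ∧ ¬ Q x} = 0 := by
  rw [ae_restrict_iff' isClosed_frontier.measurableSet] at hn
  have := measure_eq_zero_iff_ae_notMem (s := {x | x ∈ frontier Ω ∧ ¬ Q x}) (μ := surf)
  rw [this]
  filter_upwards [hn] with x hx hx'
  exact hx'.2 (hx hx'.1)

/-- For almost every parameter the graph function is differentiable and the graph point avoids the
surface null set where tangency fails. There the normalized `graphNormal` is the outer normal, and
the integrand is a multiple of the normal component. -/
theorem integral_graphFlux_eq_zero {b : OrthonormalBasis (Fin 3) ℝ V} {h : (Fin 2 → ℝ) → ℝ}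
    {K : ℝ≥0} {Ω : Set V} {p : V} {r : ℝ} {X : V → V} (hh : LipschitzWith K h)
    (hΩ : ∀ y ∈ Metric.ball p r, y ∈ Ω ↔ ⟪y, b 0⟫ < h (proj b y))
    (hXt : tsupport X ⊆ Metric.ball p r)
    (hn : ∀ᵐ x ∂surf.restrict (frontier Ω), ∀ n, IsOuterNormal Ω x n → ⟪X x, n⟫ = 0) :
    ∫ a, graphFlux b h X (param b (a, h a)) = 0 := by
  refine integral_eq_zero_of_ae ?_
  filter_upwards [ae_graph_notMem b (surf_bad_eq_zero hn) h, hh.ae_differentiableAt] with a ha hd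
  set y := param b (a, h a)
  by_cases hy : y ∈ Metric.ball p r
  · have hyf : y ∈ frontier Ω := by
      rw [mem_frontier_iff_of_subgraph hh.continuous hΩ hy, inner_param, proj_param]
    have hnor := isOuterNormal_of_subgraph hh.continuous hΩ hy hyf (by rwa [proj_param])
    have h1 : ⟪X y, ‖graphNormal b h y‖⁻¹ • graphNormal b h y⟫ = 0 := by
      by_contra hne
      exact ha ⟨hyf, fun hall => hne (hall _ hnor)⟩
    rw [real_inner_smul_right, mul_eq_zero, inv_eq_zero, norm_eq_zero] at h1
    have h2 := h1.resolve_left (graphNormal_ne_zero b h y)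
    rw [inner_graphNormal] at h2
    exact h2
  · exact graphFlux_eq_zero (image_eq_zero_of_notMem_tsupport fun h' => hy (hXt h'))

open scoped Manifold ContDiff in
/-- The divergence theorem for a tangential field on a Lipschitz domain. -/
theorem integral_divg_eq_zero {Ω : Set V} (hΩ : IsLipschitzDomain Ω) {X : V → V}
    {D : V → V →L[ℝ] V} (hX : Continuous X) (hD : Continuous D)
    (hXD : ∀ x ∈ Ω, HasFDerivAt X (D x) x)
    (hn : ∀ᵐ x ∂surf.restrict (frontier Ω), ∀ n, IsOuterNormal Ω x n → ⟪X x, n⟫ = 0) :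
    ∫ x in Ω, divg (D x) = 0 := by
  obtain ⟨hΩo, -, hΩb, hΩl⟩ := hΩ
  -- Locally there are two cases: near an interior point the localized field has compact support in
  -- `Ω`, and near a boundary point the integral is a flux through the graph. A partition of unity
  -- assembles them.
  have loc : ∀ p ∈ closure Ω, ∃ r > 0, ∀ ζ : V → ℝ, ContDiff ℝ (⊤ : ℕ∞) ζ →
      tsupport ζ ⊆ Metric.ball p r → ∫ x in Ω, divg (smulDeriv ζ X D x) = 0 := by
    intro p hp
    by_cases hpΩ : p ∈ Ω
    · obtain ⟨r, hr, hball⟩ := Metric.isOpen_iff.1 hΩo p hpΩ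
      refine ⟨r, hr, fun ζ hζ hζt => ?_⟩
      have hζs : HasCompactSupport ζ := Metric.isCompact_of_isClosed_isBounded (isClosed_tsupport _)
        (Metric.isBounded_ball.subset hζt)
      have hY := contDiff_smul_of_tsupport_subset hζ (hζt.trans hball) hD.continuousOn hΩo hXD
      rw [← integral_divg_compact hY hζs.smul_right, ← integral_indicator hΩo.measurableSet]
      refine integral_congr_ae (Eventually.of_forall fun y => ?_)
      dsimp only
      by_cases hy : y ∈ Ω
      · rw [indicator_of_mem hy, (hasFDerivAt_smulDeriv (hζ.of_le (by exact_mod_cast le_top))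
          (hXD y hy)).fderiv]
      · rw [indicator_of_notMem hy]
        have : (fun y => ζ y • X y) =ᶠ[𝓝 y] fun _ => 0 := by
          filter_upwards [notMem_tsupport_iff_eventuallyEq.1 fun h' => hy (hball (hζt h'))]
            with z hz
          simp [hz]
        rw [this.fderiv_eq]
        simp [divg_eq]
    · obtain ⟨b, k, ⟨K, hk⟩, r, hr, H⟩ := (hΩl p ⟨hp, by rwa [hΩo.interior_eq]⟩).exists_basis
      refine ⟨r, hr, fun ζ hζ hζt => ?_⟩
      have hζ1 : ContDiff ℝ 1 ζ := hζ.of_le (by exact_mod_cast le_top)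
      have hζs : HasCompactSupport ζ := Metric.isCompact_of_isClosed_isBounded (isClosed_tsupport _)
        (Metric.isBounded_ball.subset hζt)
      obtain ⟨K', hK'⟩ : ∃ K', LipschitzWith K' fun a : Fin 2 → ℝ => param b (a, 0) := by
        have : (fun a : Fin 2 → ℝ => param b (a, 0)) =
            (∑ i, (ContinuousLinearMap.proj (R := ℝ) (φ := fun _ => ℝ) i).smulRight (b i.succ) :
              (Fin 2 → ℝ) →L[ℝ] V) := by
          funext a; simp [param]
        rw [this]
        exact ⟨_, ContinuousLinearMap.lipschitz _⟩
      have hh := hk.comp hK'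
      have hXt : tsupport (fun y => ζ y • X y) ⊆ Metric.ball p r :=
        (tsupport_smul_subset_left ζ X).trans hζt
      rw [integral_divg_eq_integral_graphFlux (X := fun y => ζ y • X y) hh hΩo H
        (by have := hζ1.continuous; fun_prop) (continuous_smulDeriv hζ1 hX hD)
        (fun x hx => hasFDerivAt_smulDeriv hζ1 (hXD x hx)) hζs.smul_right hXt]
      refine integral_graphFlux_eq_zero hh H hXt ?_
      filter_upwards [hn] with x hx n hxn
      rw [real_inner_smul_left, hx n hxn, mul_zero]
  choose! r hr hloc using loc
  obtain ⟨t, htc, ht⟩ := hΩb.isCompact_closure.elim_nhds_subcover (fun p => Metric.ball p (r p))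
    fun p hp => Metric.ball_mem_nhds p (hr p hp)
  obtain ⟨f, hf⟩ := SmoothPartitionOfUnity.exists_isSubordinate 𝓘(ℝ, V)
    (isClosed_closure (s := Ω)) (fun p : t => Metric.ball (p : V) (r p))
    (fun _ => Metric.isOpen_ball) (by rw [iUnion_subtype]; exact ht)
  have hζ : ∀ i, ContDiff ℝ (⊤ : ℕ∞) (f i) := fun i => (f i).contMDiff.contDiff
  have hζ1 : ∀ i, ContDiff ℝ 1 (f i) := fun i => (hζ i).of_le (by exact_mod_cast le_top)
  -- The partition sums to one in a neighbourhood of y, so the gradients of its members contribute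
  -- nothing in total.
  have hsum : ∀ y ∈ Ω, divg (D y) = ∑ i, divg (smulDeriv (f i) X D y) := by
    intro y hy
    have h1 : HasFDerivAt (fun y => ∑ i, f i y • X y) (∑ i, smulDeriv (f i) X D y) y :=
      HasFDerivAt.fun_sum fun i _ => hasFDerivAt_smulDeriv (hζ1 i) (hXD y hy)
    have h2 : (fun y => ∑ i, f i y • X y) =ᶠ[𝓝 y] X := by
      filter_upwards [hΩo.mem_nhds hy] with z hz
      have := f.sum_eq_one (subset_closure hz)
      rw [finsum_eq_sum_of_fintype] at this
      rw [← Finset.sum_smul, this, one_smul]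
    have h3 := (h1.congr_of_eventuallyEq h2.symm).unique (hXD y hy)
    rw [← h3]
    simp only [divg_eq, _root_.sum_apply, WithLp.ofLp_sum,
      Finset.sum_apply]
    exact Finset.sum_comm
  rw [setIntegral_congr_fun hΩo.measurableSet hsum, integral_finsetSum _ fun i _ => ?_]
  swap
  · exact integrableOn_of_continuous hΩb
      (continuous_divg.comp (continuous_smulDeriv (hζ1 i) hX hD))
  exact Finset.sum_eq_zero fun i _ => hloc i (htc i i.2) (f i) (hζ i) (hf i)

/-! ### Integrals over the space-time cylinder -/

theorem continuous_integral_of_continuous {Ω : Set V} (hb : Bornology.IsBounded Ω)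
    {F : Type*} [NormedAddCommGroup F] [NormedSpace ℝ F]
    {c : ℝ × V → F} (hc : Continuous c) : Continuous fun t => ∫ x in Ω, c (t, x) := by
  have h := continuous_parametric_integral_of_continuous (μ := volume.restrict Ω)
    (f := fun t x => c (t, x)) hc hb.isCompact_closure
  rwa [Measure.restrict_restrict isClosed_closure.measurableSet,
    inter_eq_self_of_subset_right subset_closure] at h

theorem integrable_prod_of_continuous {Ω : Set V} (hb : Bornology.IsBounded Ω) {I : Set ℝ}
    (hI : Bornology.IsBounded I) {F : Type*} [NormedAddCommGroup F]
    {c : ℝ × V → F} (hc : Continuous c) :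
    Integrable c ((volume.restrict I).prod (volume.restrict Ω)) := by
  rw [Measure.prod_restrict]
  exact integrableOn_of_continuous (hI.prod hb) hc

/-- The fundamental theorem of calculus at each point of `Ω`, followed by Fubini's theorem. -/
theorem integral_sub_integral_eq {T : ℝ} {Ω : Set V} (hΩ : MeasurableSet Ω)
    (hb : Bornology.IsBounded Ω) {c : ℝ → V → ℝ} {c₀ c' : ℝ × V → ℝ} (hc₀ : Continuous c₀)
    (hc' : Continuous c') (h0 : ∀ t ∈ Ioo 0 T, ∀ x ∈ Ω, c t x = c₀ (t, x))
    (h1 : ∀ t ∈ Ioo 0 T, ∀ x ∈ Ω, HasDerivAt (fun τ => c τ x) (c' (t, x)) t) {s t : ℝ}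
    (hs : 0 < s) (hst : s ≤ t) (ht : t < T) :
    (∫ x in Ω, c t x) - ∫ x in Ω, c s x = ∫ τ in s..t, ∫ x in Ω, c' (τ, x) := by
  have hint : ∀ r ∈ Ioo 0 T, IntegrableOn (c r) Ω := fun r hr =>
    (integrableOn_of_continuous hb (f := fun x => c₀ (r, x)) (by fun_prop)).congr_fun
      (fun x hx => (h0 r hr x hx).symm) hΩ
  rw [← integral_sub (hint t ⟨hs.trans_le hst, ht⟩) (hint s ⟨hs, hst.trans_lt ht⟩),
    intervalIntegral.integral_of_le hst, integral_integral_swap]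
  · refine setIntegral_congr_fun hΩ fun x hx => ?_
    rw [← intervalIntegral.integral_of_le hst]
    refine (intervalIntegral.integral_eq_sub_of_hasDerivAt (f := fun τ => c τ x)
      (fun τ hτ => ?_) ?_).symm
    · rw [uIcc_of_le hst] at hτ
      exact h1 τ ⟨hs.trans_le hτ.1, hτ.2.trans_lt ht⟩ x hx
    · exact Continuous.intervalIntegrable (by fun_prop) _ _
  · exact integrable_prod_of_continuous hb (Metric.isBounded_Ioc _ _) hc'

/-- Grönwall's inequality with an integrable weight and zero initial value. -/
theorem ae_eq_zero_of_le_integral {T : ℝ} {e k : ℝ → ℝ} (hk0 : ∀ t, 0 ≤ k t)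
    (hk : IntegrableOn k (Ioo 0 T)) (hke : IntegrableOn (fun t => k t * e t) (Ioo 0 T))
    (he : ∀ᵐ t ∂volume.restrict (Ioo 0 T), 0 ≤ e t)
    (h : ∀ᵐ t ∂volume.restrict (Ioo 0 T), e t ≤ ∫ τ in 0..t, k τ * e τ) :
    ∀ᵐ t ∂volume.restrict (Ioo 0 T), e t = 0 := by
  -- Extension by zero makes the primitives continuous on the whole line.
  set p : ℝ → ℝ := (Ioo 0 T).indicator fun t => k t * e t
  set κ : ℝ → ℝ := (Ioo 0 T).indicator k
  have hp : Integrable p := (integrable_indicator_iff measurableSet_Ioo).2 hke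
  have hκ : Integrable κ := (integrable_indicator_iff measurableSet_Ioo).2 hk
  set I : ℝ → ℝ := fun t => ∫ τ in 0..t, p τ
  set J : ℝ → ℝ := fun t => ∫ τ in 0..t, κ τ
  have hIc : Continuous I := intervalIntegral.continuous_primitive
    (fun a b => hp.intervalIntegrable) 0
  have hJc : Continuous J := intervalIntegral.continuous_primitive
    (fun a b => hκ.intervalIntegrable) 0
  have hp0 : ∀ᵐ t, 0 ≤ p t := by
    rw [ae_restrict_iff' measurableSet_Ioo] at he
    filter_upwards [he] with t ht
    by_cases h' : t ∈ Ioo 0 T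
    · simp only [p, indicator_of_mem h']; exact mul_nonneg (hk0 t) (ht h')
    · simp only [p, indicator_of_notMem h']; exact le_rfl
  have hImono : ∀ s t, s ≤ t → I s ≤ I t := fun s t hst => by
    have : I t - I s = ∫ τ in s..t, p τ :=
      intervalIntegral.integral_interval_sub_left hp.intervalIntegrable hp.intervalIntegrable
    have h2 : 0 ≤ ∫ τ in s..t, p τ := intervalIntegral.integral_nonneg_of_ae hst hp0
    linarith
  have hle : ∀ᵐ t, p t ≤ κ t * I t := by
    rw [ae_restrict_iff' measurableSet_Ioo] at h
    filter_upwards [h] with t ht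
    by_cases h' : t ∈ Ioo 0 T
    · simp only [p, κ, indicator_of_mem h']
      refine mul_le_mul_of_nonneg_left ((ht h').trans (le_of_eq ?_)) (hk0 t)
      refine intervalIntegral.integral_congr_ae (Eventually.of_forall fun τ hτ => ?_)
      rw [uIoc_of_le h'.1.le] at hτ
      simp only [p]
      rw [indicator_of_mem]
      exact ⟨hτ.1, hτ.2.trans_lt h'.2⟩
    · simp only [p, κ, indicator_of_notMem h', zero_mul]; exact le_rfl
  have hI0 : Icc 0 T ⊆ {t | I t = 0} := by
    refine IsClosed.Icc_subset_of_forall_exists_gt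
      ((isClosed_eq hIc continuous_const).inter isClosed_Icc) (by simp [I]) ?_
    rintro x ⟨hx, hxT⟩ y hy
    have hx0 : I x = 0 := hx
    -- If the primitive `I` vanishes at x and the weight has mass below 1/2 on (x,t), then I(t) ≤
    -- I(t)/2, hence I(t) = 0. The zero set is closed, so this continuation covers the interval
    -- without an exponential.
    have hev : ∀ᶠ t in 𝓝[>] x, J t - J x < 1 / 2 := by
      have : ContinuousAt (fun t => J t - J x) x := by fun_prop
      refine nhdsWithin_le_nhds (this.eventually (gt_mem_nhds (by norm_num)))
    have hev2 : ∀ᶠ t in 𝓝[>] x, t ∈ Ioc x y := Ioc_mem_nhdsGT hy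
    obtain ⟨t, ht1, ht2⟩ := (hev.and hev2).exists
    refine ⟨t, ?_, ht2⟩
    have e1 : I t - I x = ∫ τ in x..t, p τ :=
      intervalIntegral.integral_interval_sub_left hp.intervalIntegrable hp.intervalIntegrable
    have e2 : J t - J x = ∫ τ in x..t, κ τ :=
      intervalIntegral.integral_interval_sub_left hκ.intervalIntegrable hκ.intervalIntegrable
    have hI0 : 0 ≤ I t := hx0 ▸ hImono x t ht2.1.le
    have e3 : ∫ τ in x..t, p τ ≤ ∫ τ in x..t, κ τ * I t := by
      refine intervalIntegral.integral_mono_ae_restrict ht2.1.le hp.intervalIntegrable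
        (hκ.intervalIntegrable.mul_const _) ?_
      rw [EventuallyLE, ae_restrict_iff' measurableSet_Icc]
      filter_upwards [hle] with τ hτ hτx
      refine hτ.trans (mul_le_mul_of_nonneg_left (hImono _ _ hτx.2) ?_)
      exact indicator_nonneg (fun _ _ => hk0 _) _
    rw [intervalIntegral.integral_mul_const, ← e1, ← e2, hx0, sub_zero] at e3
    change I t = 0
    nlinarith
  filter_upwards [he, h, ae_restrict_mem measurableSet_Ioo] with t h1 h2 ht
  have hIt : I t = 0 := hI0 (Ioo_subset_Icc_self ht)
  refine le_antisymm (h2.trans (le_of_eq (Eq.trans ?_ hIt))) h1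
  refine intervalIntegral.integral_congr_ae (Eventually.of_forall fun τ hτ => ?_)
  rw [uIoc_of_le ht.1.le] at hτ
  simp only [p]
  rw [indicator_of_mem]
  exact ⟨hτ.1, hτ.2.trans_lt ht.2⟩

/-! ### Traces -/

/-- Were g different from the boundary value, the averaged integrand would stay above half their
distance on small balls. -/
theorem HasTrace.eq_of_continuous {Ω : Set V} (hΩ : IsOpen Ω) {u ū : V → V} (hū : Continuous ū)
    (hu : EqOn u ū Ω) {x g : V} (hx : x ∈ closure Ω) (h : HasTrace Ω u x g) : g = ū x := by
  by_contra hne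
  have hd : 0 < ‖ū x - g‖ := norm_pos_iff.2 (sub_ne_zero.2 (Ne.symm hne))
  have hev : ∀ᶠ y in 𝓝 x, ‖ū x - g‖ / 2 < ‖ū y - g‖ := by
    have : ContinuousAt (fun y => ‖ū y - g‖) x := by fun_prop
    exact this.eventually (lt_mem_nhds (by linarith))
  obtain ⟨ρ, hρ, H⟩ := Metric.eventually_nhds_iff_ball.1 hev
  have hlt : ∀ᶠ r : ℝ in 𝓝[>] 0, ⨍ y in Metric.ball x r ∩ Ω, ‖u y - g‖ < ‖ū x - g‖ / 2 :=
    h.eventually (gt_mem_nhds (by positivity))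
  have hr : ∀ᶠ r : ℝ in 𝓝[>] 0, r ∈ Ioo 0 ρ := Ioo_mem_nhdsGT hρ
  obtain ⟨r, h1, hr0, hrρ⟩ := (hlt.and hr).exists
  have hO : IsOpen (Metric.ball x r ∩ Ω) := Metric.isOpen_ball.inter hΩ
  have hne' : (Metric.ball x r ∩ Ω).Nonempty :=
    mem_closure_iff_nhds.1 hx _ (Metric.ball_mem_nhds x hr0)
  have hfin : volume (Metric.ball x r ∩ Ω) ≠ ∞ :=
    ((measure_mono inter_subset_left).trans_lt Metric.isBounded_ball.measure_lt_top).ne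
  have h2 := (convex_Ici (‖ū x - g‖ / 2)).set_average_mem (μ := volume)
    (t := Metric.ball x r ∩ Ω) (f := fun y => ‖u y - g‖) isClosed_Ici
    (hO.measure_pos volume hne').ne' hfin
    ((ae_restrict_mem hO.measurableSet).mono fun y hy => by
      rw [mem_Ici, hu hy.2]
      exact (H y (Metric.ball_subset_ball hrρ.le hy.1)).le)
    ((integrableOn_of_continuous (f := fun y => ‖ū y - g‖) (Metric.isBounded_ball.subset
      inter_subset_left) (by fun_prop)).congr_fun (fun y hy => by simp only [hu hy.2])
      hO.measurableSet)
  exact absurd h1 (not_lt.2 h2)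

/-- Good times are dense, and a sequence of them converging to t has only countably many exceptional
null sets in space. Closedness of the property in time does the rest. -/
theorem forall_of_ae_ae {T : ℝ} {ν : Measure V} {P : ℝ → V → Prop}
    (h : ∀ᵐ t ∂volume.restrict (Ioo 0 T), ∀ᵐ x ∂ν, P t x) {B : Set V} (hB : ∀ᵐ x ∂ν, x ∈ B)
    (hP : ∀ x ∈ B, ∀ t ∈ Ioo 0 T, ∀ s : ℕ → ℝ, (∀ n, s n ∈ Ioo 0 T) → Tendsto s atTop (𝓝 t) →
      (∀ n, P (s n) x) → P t x) :
    ∀ t ∈ Ioo 0 T, ∀ᵐ x ∂ν, P t x := by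
  intro t ht
  rw [ae_restrict_iff' measurableSet_Ioo] at h
  have hd : Dense {s | s ∈ Ioo 0 T → ∀ᵐ x ∂ν, P s x} := Measure.dense_of_ae h
  have htc : t ∈ closure (Ioo 0 T ∩ {s | s ∈ Ioo 0 T → ∀ᵐ x ∂ν, P s x}) :=
    hd.open_subset_closure_inter isOpen_Ioo ht
  obtain ⟨s, hs, hst⟩ := mem_closure_iff_seq_limit.1 htc
  have : ∀ᵐ x ∂ν, ∀ n, P (s n) x := ae_all_iff.2 fun n => (hs n).2 (hs n).1
  filter_upwards [this, hB] with x hx hxB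
  exact hP x hxB t ht s (fun n => (hs n).1) hst hx

/-! ### Weak gradients -/

/-- The classical gradient satisfies the same integration by parts, so in each direction the
difference is orthogonal to all test functions. -/
theorem IsWeakGradient.ae_eq {Ω : Set V} (hΩ : IsOpen Ω) {u ū : V → V} {G D : V → V →L[ℝ] V}
    (h : IsWeakGradient Ω u G) (hG : IntegrableOn G Ω) (hū : Continuous ū) (huū : EqOn u ū Ω)
    (hD : Continuous D) (hu : ∀ x ∈ Ω, HasFDerivAt u (D x) x) : G =ᵐ[volume.restrict Ω] D := by
  have key : ∀ e : V, ∀ᵐ x, x ∈ Ω → G x e - D x e = 0 := by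
    intro e
    have hGe : IntegrableOn (fun x => G x e) Ω :=
      (ContinuousLinearMap.apply ℝ V e).integrable_comp hG
    have hDe : Continuous fun x => D x e := by fun_prop
    refine hΩ.ae_eq_zero_of_integral_contDiff_smul_eq_zero ?_ ?_
    · exact hGe.locallyIntegrableOn.sub (hDe.locallyIntegrable.locallyIntegrableOn _)
    · intro η hη hηs hηΩ
      have hη1 : ContDiff ℝ 1 η := hη.of_le (by exact_mod_cast le_top)
      have hηc := hη1.continuous
      have hη0 : ∀ x ∉ Ω, η x = 0 := fun x hx =>
        image_eq_zero_of_notMem_tsupport fun h' => hx (hηΩ h')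
      have hdη0 : ∀ x ∉ Ω, fderiv ℝ η x e = 0 := fun x hx => by
        have : fderiv ℝ η x = 0 := image_eq_zero_of_notMem_tsupport fun h' =>
          hx (hηΩ (tsupport_fderiv_subset ℝ h'))
        rw [this]; rfl
      have e1 : (fun x => η x • fderiv ℝ u x e) = fun x => η x • D x e := by
        funext x
        by_cases hx : x ∈ Ω
        · rw [(hu x hx).fderiv]
        · rw [hη0 x hx, zero_smul, zero_smul]
      have e2 : (fun x => η x • u x) = fun x => η x • ū x := by
        funext x
        by_cases hx : x ∈ Ω
        · rw [huū hx]
        · rw [hη0 x hx, zero_smul, zero_smul]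
      have e3 : (fun x => fderiv ℝ η x e • u x) = fun x => fderiv ℝ η x e • ū x := by
        funext x
        by_cases hx : x ∈ Ω
        · rw [huū hx]
        · rw [hdη0 x hx, zero_smul, zero_smul]
      have hdη : Continuous fun x => fderiv ℝ η x e :=
        (hη1.continuous_fderiv (by simp)).clm_apply continuous_const
      have hdηs : HasCompactSupport fun x => fderiv ℝ η x e :=
        (hηs.fderiv (𝕜 := ℝ)).comp_left (g := fun L : V →L[ℝ] ℝ => L e) rfl
      have i1 : Integrable fun x => η x • D x e :=
        (hηc.smul hDe).integrable_of_hasCompactSupport hηs.smul_right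
      have ibp := integral_smul_fderiv_eq_neg_fderiv_smul_of_integrable (μ := volume)
        (f := η) (g := u) (v := e)
        (by rw [e3]; exact (hdη.smul hū).integrable_of_hasCompactSupport hdηs.smul_right)
        (by rw [e1]; exact i1)
        (by rw [e2]; exact (hηc.smul hū).integrable_of_hasCompactSupport hηs.smul_right)
        (fun x _ => hη1.differentiable (by simp) x)
        (fun x hx => (hu x (hηΩ hx)).differentiableAt)
      rw [e1] at ibp
      have hw := h η hη hηs hηΩ e
      rw [setIntegral_eq_integral_of_forall_compl_eq_zero
        (fun x hx => by rw [hdη0 x hx, zero_smul]), setIntegral_eq_integral_of_forall_compl_eq_zero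
        (fun x hx => by rw [hη0 x hx, zero_smul])] at hw
      have i2 : Integrable fun x => η x • G x e := by
        have := (((integrable_indicator_iff hΩ.measurableSet).2
          hGe).locallyIntegrable).integrable_smul_left_of_hasCompactSupport hηc hηs
        refine this.congr (Eventually.of_forall fun x => ?_)
        by_cases hx : x ∈ Ω
        · simp only [indicator_of_mem hx]
        · simp only [hη0 x hx, zero_smul]
      simp only [smul_sub]
      rw [integral_sub i2 i1, ibp, hw, neg_neg, sub_self]
  have hall : ∀ᵐ x, ∀ i : Fin 3, x ∈ Ω →
      G x (EuclideanSpace.single i 1) - D x (EuclideanSpace.single i 1) = 0 :=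
    ae_all_iff.2 fun i => key _
  rw [EventuallyEq, ae_restrict_iff' hΩ.measurableSet]
  filter_upwards [hall] with x hx hxΩ
  refine ContinuousLinearMap.coe_injective
    ((EuclideanSpace.basisFun (Fin 3) ℝ).toBasis.ext fun i => ?_)
  simpa using sub_eq_zero.1 (hx i hxΩ)

/-! ### Linear algebra -/

theorem frob_comm (A B : Mat) : frob A B = frob B A := by
  simp only [frob, mul_comm]

theorem frob_add_left (A B C : Mat) : frob (A + B) C = frob A C + frob B C := by
  simp only [frob, Matrix.add_apply, add_mul, Finset.sum_add_distrib]

theorem frob_sub_left (A B C : Mat) : frob (A - B) C = frob A C - frob B C := by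
  simp only [frob, Matrix.sub_apply, sub_mul, Finset.sum_sub_distrib]

theorem frob_smul_left (c : ℝ) (A B : Mat) : frob (c • A) B = c * frob A B := by
  simp only [frob, Matrix.smul_apply, smul_eq_mul, Finset.mul_sum, mul_assoc]

theorem frob_add_right (A B C : Mat) : frob A (B + C) = frob A B + frob A C := by
  rw [frob_comm, frob_add_left, frob_comm B, frob_comm C]

theorem frob_sub_right (A B C : Mat) : frob A (B - C) = frob A B - frob A C := by
  rw [frob_comm, frob_sub_left, frob_comm B, frob_comm C]

theorem frob_smul_right (c : ℝ) (A B : Mat) : frob A (c • B) = c * frob A B := by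
  rw [frob_comm, frob_smul_left, frob_comm]

theorem frob_eq_trace (A B : Mat) : frob A B = (A * B.transpose).trace := by
  simp [frob, Matrix.trace, Matrix.mul_apply]

theorem frob_one_right (A : Mat) : frob A 1 = A.trace := by
  simp [frob_eq_trace]

/-- Cyclicity of the trace. This is how the commutation hypothesis on Dφ removes the spin from the
energy balance. -/
theorem frob_commutator_eq_zero {A B : Mat} (W : Mat) (hB : B.transpose = B) (hAB : B * A = A * B) :
    frob (A * W - W * A) B = 0 := by
  rw [frob_eq_trace, hB, sub_mul, Matrix.trace_sub, mul_assoc, Matrix.trace_mul_comm, mul_assoc, hAB,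
    mul_assoc, sub_self]

theorem frob_single_right (A : Mat) (i j : Fin 3) : frob A (Matrix.single i j 1) = A i j := by
  simp [frob, Matrix.single_apply, Finset.sum_ite_eq, ite_and]

theorem frob_symPart_right {A : Mat} (hA : A.transpose = A) (B : Mat) :
    frob A (symPart B : Mat) = frob A B := by
  have h : frob A B.transpose = frob A B := by
    rw [frob_eq_trace, Matrix.transpose_transpose, frob_eq_trace, ← Matrix.trace_transpose,
      Matrix.transpose_mul, hA, Matrix.trace_mul_comm]
  rw [symPart, SymMat.incl_mk, frob_smul_right, frob_add_right, h]
  ring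

theorem SymMat.ext_frob {A B : SymMat}
    (h : ∀ i j, frob (A : Mat) (symPart (Matrix.single i j 1) : Mat)
      = frob (B : Mat) (symPart (Matrix.single i j 1) : Mat)) : A = B := by
  apply SymMat.incl_injective
  ext i j
  have := h i j
  rwa [frob_symPart_right A.transpose_eq, frob_symPart_right B.transpose_eq, frob_single_right,
    frob_single_right] at this

theorem symPart_coe (A : SymMat) : symPart (A : Mat) = A := by
  apply SymMat.incl_injective
  rw [symPart, SymMat.incl_mk, A.transpose_eq]
  module

/-- The product `A : B` as a continuous bilinear map. -/
def frobL : Mat →L[ℝ] Mat →L[ℝ] ℝ :=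
  LinearMap.toContinuousBilinearMap (LinearMap.mk₂ ℝ frob frob_add_left frob_smul_left
    frob_add_right frob_smul_right)

theorem frobL_apply (A B : Mat) : frobL A B = frob A B := rfl

/-- The inclusion of the symmetric matrices as a continuous linear map. -/
def inclL : SymMat →L[ℝ] Mat := LinearMap.toContinuousLinearMap SymMat.incl

theorem inclL_apply (A : SymMat) : inclL A = (A : Mat) := rfl

/-- The inclusion of the deviatoric matrices as a continuous linear map. -/
def devInclL : DevMat →L[ℝ] Mat := LinearMap.toContinuousLinearMap DevMat.incl

/-- The symmetric part as a continuous linear map. -/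
def symPartL : Mat →L[ℝ] SymMat := LinearMap.toContinuousLinearMap
  { toFun := symPart
    map_add' := fun A B => by
      apply SymMat.incl_injective
      simp only [symPart, SymMat.incl_mk, map_add, Matrix.transpose_add]
      module
    map_smul' := fun c A => by
      apply SymMat.incl_injective
      simp only [symPart, SymMat.incl_mk, map_smul, Matrix.transpose_smul, RingHom.id_apply]
      module }

theorem symPartL_apply (A : Mat) : symPartL A = symPart A := rfl

/-- The deviatoric part as a continuous linear map. -/
def devL : SymMat →L[ℝ] DevMat := LinearMap.toContinuousLinearMap
  { toFun := dev
    map_add' := fun A B => by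
      apply DevMat.incl_injective
      simp only [dev, DevMat.incl_mk, map_add, Matrix.trace_add]
      module
    map_smul' := fun c A => by
      apply DevMat.incl_injective
      simp only [dev, DevMat.incl_mk, map_smul, Matrix.trace_smul, RingHom.id_apply, smul_eq_mul]
      module }

theorem devL_apply (A : SymMat) : devL A = dev A := rfl

/-- The matrix of a linear map, as a continuous linear map. -/
def toMatL : (V →L[ℝ] V) →L[ℝ] Mat := LinearMap.toContinuousLinearMap
  { toFun := toMat
    map_add' := fun A B => by ext i j; simp [toMat]
    map_smul' := fun c A => by ext i j; simp [toMat] }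

/-- The strain rate as a continuous linear map. -/
def strainRateL : (V →L[ℝ] V) →L[ℝ] SymMat := symPartL.comp toMatL

theorem strainRateL_apply (G : V →L[ℝ] V) : strainRateL G = strainRate G := rfl

/-- The spin as a continuous linear map. -/
def spinL : (V →L[ℝ] V) →L[ℝ] Mat := LinearMap.toContinuousLinearMap
  { toFun := spin
    map_add' := fun A B => by
      have := toMatL.map_add A B
      simp only [spin, skewPart]
      change (1 / 2 : ℝ) • (toMatL (A + B) - (toMatL (A + B)).transpose) = _
      rw [this, Matrix.transpose_add]
      change _ = (1 / 2 : ℝ) • (toMatL A - (toMatL A).transpose)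
        + (1 / 2 : ℝ) • (toMatL B - (toMatL B).transpose)
      module
    map_smul' := fun c A => by
      have := toMatL.map_smul c A
      simp only [spin, skewPart, RingHom.id_apply]
      change (1 / 2 : ℝ) • (toMatL (c • A) - (toMatL (c • A)).transpose) = _
      rw [this, Matrix.transpose_smul]
      change _ = c • (1 / 2 : ℝ) • (toMatL A - (toMatL A).transpose)
      module }

/-- The divergence as a continuous linear map. -/
def divgL : (V →L[ℝ] V) →L[ℝ] ℝ :=
  (LinearMap.toContinuousLinearMap (Matrix.traceLinearMap (Fin 3) ℝ ℝ)).comp toMatL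

theorem strainRate_add (G H : V →L[ℝ] V) : strainRate (G + H) = strainRate G + strainRate H :=
  strainRateL.map_add G H

theorem divg_add (G H : V →L[ℝ] V) : divg (G + H) = divg G + divg H := divgL.map_add G H

theorem divg_smulRight (ℓ : V →L[ℝ] ℝ) (u : V) : divg (ℓ.smulRight u) = ℓ u := by
  rw [divg_eq]
  conv_rhs => rw [show u = ∑ i, u i • (EuclideanSpace.single i 1 : V) by
    ext j; simp [Finset.sum_apply, Pi.single_apply]]
  rw [map_sum]
  exact Finset.sum_congr rfl fun i _ => by simp [mul_comm]

theorem divg_smul (c : ℝ) (G : V →L[ℝ] V) : divg (c • G) = c * divg G := divgL.map_smul c G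

theorem trace_strainRate (G : V →L[ℝ] V) : (strainRate G : Mat).trace = divg G := by
  rw [strainRate, symPart, SymMat.incl_mk, Matrix.trace_smul, Matrix.trace_add,
    Matrix.trace_transpose, divg]
  simp only [smul_eq_mul]; ring

/-- The matrix of a functional on the symmetric matrices. -/
def rieszSym : (SymMat →L[ℝ] ℝ) →L[ℝ] SymMat := LinearMap.toContinuousLinearMap
  { toFun := fun ℓ => SymMat.mk (Matrix.of fun i j => ℓ (symPart (Matrix.single i j 1))) (by
      ext i j
      have h : symPart (Matrix.single j i 1) = symPart (Matrix.single i j 1) := by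
        apply SymMat.incl_injective
        simp [symPart, Matrix.transpose_single, add_comm]
      simp [h])
    map_add' := fun A B => by
      apply SymMat.incl_injective
      ext i j
      simp
    map_smul' := fun c A => by
      apply SymMat.incl_injective
      ext i j
      simp }

/-- One continuous derivative of Dφ is what makes Dφ(𝔼) admissible as a strain test function after a
cut-off in time. -/
theorem contDiff_gradSym {φ : SymMat → ℝ} (hφ : ContDiff ℝ 3 φ) : ContDiff ℝ 1 (gradSym φ) :=
  rieszSym.contDiff.comp (hφ.fderiv_right (m := 1) (by norm_num))

namespace Model

variable (m : Model)

/-- The viscous stress as a continuous linear map. -/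
def viscousStressL : (V →L[ℝ] V) →L[ℝ] SymMat :=
  (LinearMap.toContinuousLinearMap m.L).comp strainRateL

theorem viscousStressL_apply (G : V →L[ℝ] V) : m.viscousStressL G = m.viscousStress G := rfl

end Model

/-! ### The pointwise algebra of the energy balance -/

/-- The difference of the strain rate and the Zaremba-Jaumann rate, for velocity `v`, velocity
gradient `G`, strain `A`, its time derivative `At` and its gradient `DA`. -/
def residual (v : V) (G : V →L[ℝ] V) (A At : SymMat) (DA : V →L[ℝ] SymMat) : SymMat :=
  strainRate G - (At + DA v + SymMat.mk ((A : Mat) * spin G - spin G * (A : Mat)) (by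
    have h : (spin G).transpose = -spin G := by
      rw [spin, skewPart, Matrix.transpose_smul, Matrix.transpose_sub, Matrix.transpose_transpose]
      module
    rw [Matrix.transpose_sub, Matrix.transpose_mul, Matrix.transpose_mul, h, A.transpose_eq]
    simp only [neg_mul, mul_neg]
    abel))

theorem coe_residual (v : V) (G : V →L[ℝ] V) (A At : SymMat) (DA : V →L[ℝ] SymMat) :
    (residual v G A At DA : Mat) = (strainRate G : Mat) - ((At : Mat) + (DA v : Mat)
      + ((A : Mat) * spin G - spin G * (A : Mat))) := by
  simp only [residual, map_sub, map_add, SymMat.incl_mk]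

namespace Model

variable (m : Model)

/-- The integrand of the weak momentum equation without the force, after integration by parts in
time. -/
def reducedMomentum (v vt : V) (G : V →L[ℝ] V) (A : SymMat) (p : V) (Dp : V →L[ℝ] V) : ℝ :=
  -(m.ρ * ⟪vt, p⟫) + m.ρ / 2 * divg G * ⟪v, p⟫ + m.ρ * ⟪v, Dp v⟫
    - frob (m.viscousStress G + gradSym m.φ A : SymMat) (strainRate Dp) - m.φ A * divg Dp

/-- The algebraic identity behind the energy balance. -/
theorem density_identity {A : SymMat}
    (hA : (gradSym m.φ A : Mat) * (A : Mat) = (A : Mat) * (gradSym m.φ A : Mat))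
    (v vt : V) (G : V →L[ℝ] V) (At : SymMat) (DA : V →L[ℝ] SymMat) (f p pt : V) (Dp : V →L[ℝ] V)
    (Q Qt : SymMat) (DQ : V →L[ℝ] SymMat) :
    m.dissipationDensity v G f + m.momentumDensity v G A f (v + p) (vt + pt) (G + Dp)
        + strainDensity v G A Q Qt DQ
      = (frob (residual v G A At DA : Mat) (Q - gradSym m.φ A : SymMat)
          + m.reducedMomentum v vt G A p Dp + ⟪f, p⟫)
        + ((m.ρ / 2 * ‖v‖ ^ 2 - m.φ A + frob A Q) * divg G
          + (m.ρ * ⟪v, G v⟫ - frob (gradSym m.φ A) (DA v) + frob (DA v) Q + frob A (DQ v)))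
        - ((m.ρ * ⟪v, vt⟫ + frob (gradSym m.φ A) At)
          - (m.ρ * (⟪vt, v + p⟫ + ⟪v, vt + pt⟫) + (frob At Q + frob A Qt))) := by
  -- The right-hand side has three groups: the residuals, the divergence of (ρ/2|v|² - φ(A) + A :
  -- Q)v, and the time derivative of the energy minus that of the pairing. The viscous dissipation
  -- and the power of the force along v cancel. Apart from rearrangement, the commutator identity is
  -- the only input.
  have hc := frob_commutator_eq_zero (spin G) (gradSym m.φ A).transpose_eq hA
  have hDG : strainRate (G + Dp) = strainRate G + strainRate Dp := strainRate_add G Dp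
  have hv : ‖v‖ ^ 2 = ⟪v, v⟫ := (real_inner_self_eq_norm_sq v).symm
  simp only [dissipationDensity, momentumDensity, strainDensity, reducedMomentum, coe_residual,
    map_add, map_sub, hDG, divg_add, frob_add_left, frob_add_right, frob_sub_left, frob_sub_right,
    inner_add_right, add_apply, hv] at hc ⊢
  rw [frob_comm (DA v) (gradSym m.φ A), frob_comm At (gradSym m.φ A), frob_comm (DQ v) A,
    frob_comm (strainRate G) (gradSym m.φ A), real_inner_comm vt v]
  linear_combination -hc

end Model

/-! ### The energy balance of regular fields -/

/-- The product `A : B` of symmetric matrices as a continuous bilinear map. -/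
def frobS : SymMat →L[ℝ] SymMat →L[ℝ] ℝ :=
  LinearMap.toContinuousBilinearMap (LinearMap.mk₂ ℝ (fun A B : SymMat => frob (A : Mat) (B : Mat))
    (fun _ _ _ => by rw [map_add, frob_add_left]) (fun _ _ _ => by rw [map_smul, frob_smul_left]; rfl)
    (fun _ _ _ => by rw [map_add, frob_add_right])
    (fun _ _ _ => by rw [map_smul, frob_smul_right]; rfl))

theorem frobS_apply (A B : SymMat) : frobS A B = frob (A : Mat) (B : Mat) := rfl

theorem hasDerivAt_frob {A B : ℝ → SymMat} {A' B' : SymMat} {t : ℝ} (hA : HasDerivAt A A' t)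
    (hB : HasDerivAt B B' t) : HasDerivAt (fun τ => frob (A τ : Mat) (B τ : Mat))
      (frob (A' : Mat) (B t : Mat) + frob (A t : Mat) (B' : Mat)) t := by
  have h1 : HasDerivAt (fun τ => frobS (A τ)) (frobS A') t :=
    frobS.hasFDerivAt.comp_hasDerivAt t hA
  exact h1.clm_apply hB

theorem hasFDerivAt_frob {A B : V → SymMat} {A' B' : V →L[ℝ] SymMat} {x : V}
    (hA : HasFDerivAt A A' x) (hB : HasFDerivAt B B' x) :
    HasFDerivAt (fun y => frob (A y : Mat) (B y : Mat))
      ((frobS.flip (B x)).comp A' + (frobS (A x)).comp B') x := by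
  have h1 : HasFDerivAt (fun τ => frobS (A τ)) (frobS.comp A') x :=
    frobS.hasFDerivAt.comp x hA
  have h3 := h1.clm_apply hB
  refine h3.congr_fderiv ?_
  ext e
  simp [add_comm]

theorem residual_eq (v : V) (G : V →L[ℝ] V) (A At : SymMat) (DA : V →L[ℝ] SymMat) :
    residual v G A At DA = strainRateL G
      - (At + DA v + symPartL (inclL A * spinL G - spinL G * inclL A)) := by
  rw [residual, strainRateL_apply, symPartL_apply]
  congr 2
  exact (symPart_coe _).symm

section Continuity

variable {Z : Type*} [TopologicalSpace Z] {A B At : Z → SymMat} {G Dp : Z → V →L[ℝ] V}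
  {u p w : Z → V} {DA : Z → V →L[ℝ] SymMat} {A' B' : Z → Mat}

@[fun_prop]
theorem continuous_frob_comp (hA : Continuous A') (hB : Continuous B') :
    Continuous fun z => frob (A' z) (B' z) := by
  simp only [← frobL_apply]; fun_prop

@[fun_prop]
theorem continuous_coe_comp (hA : Continuous A) : Continuous fun z => (A z : Mat) := by
  simp only [← inclL_apply]; fun_prop

@[fun_prop]
theorem continuous_strainRate_comp (hG : Continuous G) : Continuous fun z => strainRate (G z) := by
  simp only [← strainRateL_apply]; fun_prop

@[fun_prop]
theorem continuous_divg_comp (hG : Continuous G) : Continuous fun z => divg (G z) :=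
  continuous_divg.comp hG

theorem continuous_residual (hu : Continuous u) (hG : Continuous G) (hA : Continuous A)
    (hAt : Continuous At) (hDA : Continuous DA) :
    Continuous fun z => residual (u z) (G z) (A z) (At z) (DA z) := by
  simp only [residual_eq]
  have h1 : Continuous fun z => inclL (A z) * spinL (G z) :=
    Continuous.matrix_mul (by fun_prop) (by fun_prop)
  have h2 : Continuous fun z => spinL (G z) * inclL (A z) :=
    Continuous.matrix_mul (by fun_prop) (by fun_prop)
  have h3 := symPartL.continuous.comp (h1.sub h2)
  have h4 : Continuous fun z => strainRateL (G z) := by fun_prop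
  have h5 : Continuous fun z => At z + DA z (u z) := by fun_prop
  exact h4.sub (h5.add h3)

theorem continuous_gradSym_comp {φ : SymMat → ℝ} (hφ : ContDiff ℝ 3 φ) (hA : Continuous A) :
    Continuous fun z => gradSym φ (A z) :=
  (contDiff_gradSym hφ).continuous.comp hA

theorem Model.continuous_reducedMomentum {m : Model} (hφ : ContDiff ℝ 3 m.φ) (hu : Continuous u)
    (hw : Continuous w) (hG : Continuous G) (hA : Continuous A) (hp : Continuous p)
    (hDp : Continuous Dp) :
    Continuous fun z => m.reducedMomentum (u z) (w z) (G z) (A z) (p z) (Dp z) := by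
  have h1 := hφ.continuous
  have h2 := continuous_gradSym_comp hφ hA
  have h3 : Continuous fun z => m.viscousStress (G z) := by
    simp only [← Model.viscousStressL_apply]; fun_prop
  have h4 := continuous_coe_comp (h3.add h2)
  have h5 := continuous_coe_comp (continuous_strainRate_comp hDp)
  have h6 := h1.comp hA
  simp only [Model.reducedMomentum]
  have h7 := continuous_frob_comp h4 h5
  have h8 : Continuous fun z => -(m.ρ * ⟪w z, p z⟫) + m.ρ / 2 * divg (G z) * ⟪u z, p z⟫
    + m.ρ * ⟪u z, Dp z (u z)⟫ := by fun_prop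
  exact (h8.sub h7).sub (h6.mul (continuous_divg_comp hDp))

end Continuity

namespace Model

variable {m : Model}

/-- The continuous part of the integrand of the reduced energy inequality. -/
def reducedDensity (m : Model) (vb vt : ℝ × V → V) (vx : ℝ × V → V →L[ℝ] V)
    (Eb Et : ℝ × V → SymMat) (Ex : ℝ × V → V →L[ℝ] SymMat) (pb : ℝ × V → V)
    (px : ℝ × V → V →L[ℝ] V) (Qb : ℝ × V → SymMat) (z : ℝ × V) : ℝ :=
  frob (residual (vb z) (vx z) (Eb z) (Et z) (Ex z) : Mat) (Qb z - gradSym m.φ (Eb z) : SymMat)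
    + m.reducedMomentum (vb z) (vt z) (vx z) (Eb z) (pb z) (px z)

/-! ### The energy balance integrated in space and time -/

section Balance

variable {v : ℝ → V → V} {vb vt : ℝ × V → V} {vx : ℝ × V → V →L[ℝ] V}
  {E : ℝ → V → SymMat} {Eb Et : ℝ × V → SymMat} {Ex : ℝ × V → V →L[ℝ] SymMat}

/-- The integrand is the divergence of k v, and k v inherits tangency from v for any scalar k. -/
theorem integral_flux_eq_zero (hm : m.Standing) (hv : CylExt m.T m.Ω v vb vt vx)
    {τ : ℝ} (hτ : τ ∈ Ioo 0 m.T)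
    (hbc : ∀ᵐ x ∂surf.restrict (frontier m.Ω), ∀ n, IsOuterNormal m.Ω x n → ⟪v τ x, n⟫ = 0)
    {k : V → ℝ} {dk : V → V →L[ℝ] ℝ} (hk : Continuous k) (hdk : Continuous dk)
    (hkd : ∀ x ∈ m.Ω, HasFDerivAt k (dk x) x) :
    ∫ x in m.Ω, (k x * divg (vx (τ, x)) + dk x (vb (τ, x))) = 0 := by
  have h1 := hv.cont
  have h2 := hv.cont_x
  have hτ' := Ioo_subset_Icc_self hτ
  have hvd : ∀ x ∈ m.Ω, HasFDerivAt (fun y => vb (τ, y)) (vx (τ, x)) x := fun x hx =>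
    (hv.hasFDerivAt τ hτ x hx).congr_of_eventuallyEq (by
      filter_upwards [hm.domain.1.mem_nhds hx] with y hy
      exact (hv.eqOn τ hτ' y (subset_closure hy)).symm)
  have key := integral_divg_eq_zero hm.domain (X := fun x => k x • vb (τ, x))
    (D := fun x => k x • vx (τ, x) + (dk x).smulRight (vb (τ, x))) (by fun_prop)
    (continuous_clm_apply.2 fun e => by
      simp only [add_apply, smul_apply, ContinuousLinearMap.smulRight_apply]
      fun_prop)
    (fun x hx => (hkd x hx).smul (hvd x hx)) (by
      have hf : ∀ᵐ x ∂surf.restrict (frontier m.Ω), x ∈ frontier m.Ω :=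
        ae_restrict_mem isClosed_frontier.measurableSet
      filter_upwards [hbc, hf] with x hx hxf n hn
      rw [real_inner_smul_left, ← hv.eqOn τ hτ' x (frontier_subset_closure hxf), hx n hn,
        mul_zero])
  simpa only [divg_add, divg_smul, divg_smulRight] using key

theorem isBounded_domain (hm : m.Standing) : Bornology.IsBounded m.Ω := hm.domain.2.2.1

instance : IsFiniteMeasure m.μT := by unfold μT; infer_instance

instance : SFinite m.μΩ := by unfold μΩ; infer_instance

theorem isFiniteMeasure_μΩ (hm : m.Standing) : IsFiniteMeasure m.μΩ :=
  ⟨by rw [μΩ, Measure.restrict_apply_univ]; exact (isBounded_domain hm).measure_lt_top⟩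

/-- Functions in `L¹(0,T; L^q)` are integrable on the cylinder. -/
theorem integrable_of_memLpLq (hm : m.Standing) {F : Type*} [NormedAddCommGroup F] {q : ℝ≥0∞}
    (hq : 1 ≤ q) {u : ℝ → V → F} (h : MemLpLq 1 q m.T m.Ω u) :
    Integrable (Function.uncurry u) (m.μT.prod m.μΩ) := by
  have := isFiniteMeasure_μΩ hm
  obtain ⟨h1, h2⟩ := h
  have h1' : AEStronglyMeasurable (Function.uncurry u) (m.μT.prod m.μΩ) := h1
  refine ⟨h1', ?_⟩
  rw [HasFiniteIntegral, lintegral_prod _ h1'.enorm]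
  rw [eLpNorm_one_eq_lintegral_enorm] at h2
  have hs : ∀ᵐ t ∂m.μT, AEStronglyMeasurable (u t) m.μΩ := h1'.prodMk_left
  -- This is the Hölder constant comparing L¹ and L^q on a set of finite measure; its exponent is
  -- nonnegative because q ≥ 1.
  set C : ℝ≥0∞ := m.μΩ univ ^ (1 / (1 : ℝ≥0∞).toReal - 1 / q.toReal)
  have hC : C < ∞ := by
    refine ENNReal.rpow_lt_top_of_nonneg ?_ (measure_ne_top _ _)
    rcases eq_or_ne q ∞ with rfl | hq'
    · simp
    · have : 1 ≤ q.toReal := by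
        simpa using ENNReal.toReal_mono hq' hq
      simp only [ENNReal.toReal_one, div_one, sub_nonneg]
      exact (div_le_one (by linarith)).2 this
  calc ∫⁻ t, ∫⁻ x, ‖Function.uncurry u (t, x)‖ₑ ∂m.μΩ ∂m.μT
      ≤ ∫⁻ t, C * ‖eLpNorm (u t) q (volume.restrict m.Ω)‖ₑ ∂m.μT := by
        refine lintegral_mono_ae (hs.mono fun t ht => ?_)
        have := eLpNorm_le_eLpNorm_mul_rpow_measure_univ hq ht
        rw [eLpNorm_one_eq_lintegral_enorm, mul_comm] at this
        simpa [C, μΩ] using this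
    _ = C * ∫⁻ t, ‖eLpNorm (u t) q (volume.restrict m.Ω)‖ₑ ∂m.μT := lintegral_const_mul' _ _ hC.ne
    _ < ∞ := ENNReal.mul_lt_top hC h2

theorem integrable_force (hm : m.Standing) :
    Integrable (Function.uncurry m.f) (m.μT.prod m.μΩ) :=
  integrable_of_memLpLq hm (by norm_num) hm.force

theorem integrable_force_inner (hm : m.Standing) {w : ℝ × V → V} (hw : Continuous w) :
    Integrable (fun z : ℝ × V => ⟪m.f z.1 z.2, w z⟫) (m.μT.prod m.μΩ) := by
  have hf := integrable_force hm
  have hK : IsCompact (closure (Ioo 0 m.T ×ˢ m.Ω)) :=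
    ((Metric.isBounded_Ioo 0 m.T).prod (isBounded_domain hm)).isCompact_closure
  obtain ⟨C, hC⟩ := hK.exists_bound_of_continuousOn hw.continuousOn
  refine (hf.norm.mul_const C).mono' (hf.1.inner hw.aestronglyMeasurable) ?_
  rw [μT, μΩ, Measure.prod_restrict]
  filter_upwards [ae_restrict_mem (measurableSet_Ioo.prod hm.domain.1.measurableSet)] with z hz
  exact (norm_inner_le_norm _ _).trans
    (mul_le_mul_of_nonneg_left (hC z (subset_closure hz)) (norm_nonneg _))

theorem continuous_reducedDensity (hm : m.Standing) (hv : CylExt m.T m.Ω v vb vt vx)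
    (hE : CylExt m.T m.Ω E Eb Et Ex) {pb : ℝ × V → V} {px : ℝ × V → V →L[ℝ] V}
    {Qb : ℝ × V → SymMat} (hpb : Continuous pb) (hpx : Continuous px) (hQb : Continuous Qb) :
    Continuous (m.reducedDensity vb vt vx Eb Et Ex pb px Qb) := by
  have h1 := continuous_coe_comp
    (continuous_residual hv.cont hv.cont_x hE.cont hE.cont_t hE.cont_x)
  have h2 := continuous_coe_comp (hQb.sub (continuous_gradSym_comp hm.φ_smooth hE.cont))
  exact (continuous_frob_comp h1 h2).add
    (continuous_reducedMomentum hm.φ_smooth hv.cont hv.cont_t hv.cont_x hE.cont hpb hpx)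

/-- The time derivative of the energy density. -/
def energyRate (m : Model) (vb vt : ℝ × V → V) (Eb Et : ℝ × V → SymMat) (z : ℝ × V) : ℝ :=
  m.ρ * ⟪vb z, vt z⟫ + frob (gradSym m.φ (Eb z)) (Et z)

/-- The time derivative of the integrand of the pairing with the test functions `v + p`, `Q`. -/
def pairingRate (m : Model) (vb vt : ℝ × V → V) (Eb Et : ℝ × V → SymMat) (pb pt : ℝ × V → V)
    (Qb Qt : ℝ × V → SymMat) (z : ℝ × V) : ℝ :=
  m.ρ * (⟪vt z, vb z + pb z⟫ + ⟪vb z, vt z + pt z⟫) + (frob (Et z) (Qb z) + frob (Eb z) (Qt z))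

theorem continuous_energyRate (hm : m.Standing) (hv : CylExt m.T m.Ω v vb vt vx)
    (hE : CylExt m.T m.Ω E Eb Et Ex) : Continuous (m.energyRate vb vt Eb Et) := by
  have h1 := hv.cont
  have h2 := hv.cont_t
  have h3 := hE.cont_t
  have h4 := continuous_gradSym_comp hm.φ_smooth hE.cont
  unfold energyRate
  fun_prop

theorem hasFDerivAt_energyMap (hm : m.Standing) (A : SymMat) :
    HasFDerivAt m.φ (fderiv ℝ m.φ A) A :=
  (hm.φ_smooth.differentiable (by norm_num) A).hasFDerivAt

theorem energy_sub_energy (hm : m.Standing) (hv : CylExt m.T m.Ω v vb vt vx)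
    (hE : CylExt m.T m.Ω E Eb Et Ex) {s t : ℝ} (hs : 0 < s) (hst : s ≤ t) (ht : t < m.T) :
    m.energy (v t) (E t) - m.energy (v s) (E s)
      = ∫ τ in s..t, ∫ x in m.Ω, m.energyRate vb vt Eb Et (τ, x) := by
  have hφ := hm.φ_smooth.continuous
  refine integral_sub_integral_eq hm.domain.1.measurableSet (isBounded_domain hm)
    (c := fun τ x => m.energyDensity (v τ) (E τ) x)
    (c₀ := fun z => m.ρ / 2 * ‖vb z‖ ^ 2 + m.φ (Eb z)) ?_ (continuous_energyRate hm hv hE)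
    (fun τ hτ x hx => ?_) (fun τ hτ x hx => ?_) hs hst ht
  · have h1 := hφ.comp hE.cont
    have h2 := hv.cont
    exact Continuous.add (by fun_prop) h1
  · have h1 := Ioo_subset_Icc_self hτ
    rw [energyDensity, hv.eqOn τ h1 x (subset_closure hx), hE.eqOn τ h1 x (subset_closure hx)]
  · have h1 := Ioo_subset_Icc_self hτ
    have h2 := (hv.hasDerivAt τ hτ x hx).norm_sq.const_mul (m.ρ / 2)
    have h3 := (hasFDerivAt_energyMap hm (E τ x)).comp_hasDerivAt τ (hE.hasDerivAt τ hτ x hx)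
    refine (h2.add h3).congr_deriv ?_
    rw [hv.eqOn τ h1 x (subset_closure hx), hE.eqOn τ h1 x (subset_closure hx), energyRate,
      frob_gradSym]
    ring

section Test

variable {p : ℝ → V → V} {pb pt : ℝ × V → V} {px : ℝ × V → V →L[ℝ] V}
  {Q : ℝ → V → SymMat} {Qb Qt : ℝ × V → SymMat} {Qx : ℝ × V → V →L[ℝ] SymMat}
  {ψ : ℝ → V → V} {T₁ : ℝ}

theorem continuous_pairingRate (hv : CylExt m.T m.Ω v vb vt vx)
    (hE : CylExt m.T m.Ω E Eb Et Ex) (hp : CylExt m.T m.Ω p pb pt px)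
    (hQ : CylExt m.T m.Ω Q Qb Qt Qx) : Continuous (m.pairingRate vb vt Eb Et pb pt Qb Qt) := by
  have h1 := hv.cont
  have h2 := hv.cont_t
  have h3 := hE.cont
  have h4 := hE.cont_t
  have h5 := hp.cont
  have h6 := hp.cont_t
  have h7 := hQ.cont
  have h8 := hQ.cont_t
  unfold pairingRate
  fun_prop

/-- The relation ψ = v + p is required only before time `T₁`: a test function vanishes near the
final time, so v enters through a cut-off. -/
theorem pairing_sub_pairing (hm : m.Standing) (hv : CylExt m.T m.Ω v vb vt vx)
    (hE : CylExt m.T m.Ω E Eb Et Ex) (hp : CylExt m.T m.Ω p pb pt px)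
    (hQ : CylExt m.T m.Ω Q Qb Qt Qx) (hT₁ : T₁ ≤ m.T)
    (hψ : ∀ τ ∈ Ioo 0 T₁, ∀ x ∈ m.Ω, ψ τ x = v τ x + p τ x) {s t : ℝ}
    (hs : 0 < s) (hst : s ≤ t) (ht : t < T₁) :
    m.pairing (v t) (E t) (ψ t) (Q t) - m.pairing (v s) (E s) (ψ s) (Q s)
      = ∫ τ in s..t, ∫ x in m.Ω, m.pairingRate vb vt Eb Et pb pt Qb Qt (τ, x) := by
  have hmem : ∀ τ ∈ Ioo 0 T₁, τ ∈ Ioo 0 m.T := fun τ h => ⟨h.1, h.2.trans_le hT₁⟩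
  refine integral_sub_integral_eq hm.domain.1.measurableSet (isBounded_domain hm)
    (c := fun τ x => m.ρ * ⟪v τ x, ψ τ x⟫ + frob (E τ x) (Q τ x))
    (c₀ := fun z => m.ρ * ⟪vb z, vb z + pb z⟫ + frob (Eb z) (Qb z)) ?_
    (continuous_pairingRate hv hE hp hQ) (fun τ hτ x hx => ?_) (fun τ hτ x hx => ?_) hs hst ht
  · have h1 := hv.cont
    have h2 := hE.cont
    have h3 := hp.cont
    have h4 := hQ.cont
    fun_prop
  · have h1 := Ioo_subset_Icc_self (hmem τ hτ)
    rw [hψ τ hτ x hx, hv.eqOn τ h1 x (subset_closure hx), hE.eqOn τ h1 x (subset_closure hx),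
      hp.eqOn τ h1 x (subset_closure hx), hQ.eqOn τ h1 x (subset_closure hx)]
  · have h1 := Ioo_subset_Icc_self (hmem τ hτ)
    have hv' := hv.hasDerivAt τ (hmem τ hτ) x hx
    have hψ' : HasDerivAt (fun σ => ψ σ x) (vt (τ, x) + pt (τ, x)) τ :=
      (hv'.add (hp.hasDerivAt τ (hmem τ hτ) x hx)).congr_of_eventuallyEq (by
        filter_upwards [Ioo_mem_nhds hτ.1 hτ.2] with σ hσ using hψ σ hσ x hx)
    refine (((hv'.inner ℝ hψ').const_mul m.ρ).add (hasDerivAt_frob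
      (hE.hasDerivAt τ (hmem τ hτ) x hx) (hQ.hasDerivAt τ (hmem τ hτ) x hx))).congr_deriv ?_
    rw [hψ τ hτ x hx, hv.eqOn τ h1 x (subset_closure hx), hE.eqOn τ h1 x (subset_closure hx),
      hp.eqOn τ h1 x (subset_closure hx), hQ.eqOn τ h1 x (subset_closure hx), pairingRate]
    ring

theorem _root_.ViscoElastoPlastic.CylExt.hasFDerivAt_ext {F : Type*} [NormedAddCommGroup F]
    [NormedSpace ℝ F] {T : ℝ} {U : Set V} (hU : IsOpen U) {u : ℝ → V → F} {ub ut : ℝ × V → F} {ux : ℝ × V → V →L[ℝ] F}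
    (hu : CylExt T U u ub ut ux) {τ : ℝ} (hτ : τ ∈ Ioo 0 T) {x : V} (hx : x ∈ U) :
    HasFDerivAt (fun y => ub (τ, y)) (ux (τ, x)) x :=
  (hu.hasFDerivAt τ hτ x hx).congr_of_eventuallyEq (by
    filter_upwards [hU.mem_nhds hx] with y hy
    exact (hu.eqOn τ (Ioo_subset_Icc_self hτ) y (subset_closure hy)).symm)

theorem integral_add_sub_add {μ : Measure V} {a b c d e : V → ℝ} (ha : Integrable a μ)
    (hb : Integrable b μ) (hc : Integrable c μ) (hd : Integrable d μ) (he : Integrable e μ) :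
    ∫ x, (a x + b x - c x + d x + e x) ∂μ
      = (∫ x, a x ∂μ) + (∫ x, b x ∂μ) - (∫ x, c x ∂μ) + (∫ x, d x ∂μ) + ∫ x, e x ∂μ := by
  have h1 : Integrable (fun x => a x + b x) μ := ha.add hb
  have h2 : Integrable (fun x => a x + b x - c x) μ := h1.sub hc
  have h3 : Integrable (fun x => a x + b x - c x + d x) μ := h2.add hd
  rw [integral_add h3 he, integral_add h2 hd, integral_sub h1 hc, integral_add ha hb]

/-- The integral of `density_identity`. Its divergence group has no flux through the boundary, and
the force is integrable at fixed time only when paired as in `hf`. -/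
theorem integral_density_eq (hm : m.Standing) (hv : CylExt m.T m.Ω v vb vt vx)
    (hE : CylExt m.T m.Ω E Eb Et Ex) (hp : CylExt m.T m.Ω p pb pt px)
    (hQ : CylExt m.T m.Ω Q Qb Qt Qx) (hT₁ : T₁ ≤ m.T)
    (hψ : ∀ τ ∈ Ioo 0 T₁, ∀ x ∈ m.Ω, ψ τ x = v τ x + p τ x) {τ : ℝ} (hτ : τ ∈ Ioo 0 T₁)
    (hbc : ∀ᵐ x ∂surf.restrict (frontier m.Ω), ∀ n, IsOuterNormal m.Ω x n → ⟪v τ x, n⟫ = 0)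
    {G : V → V →L[ℝ] V} (hG : G =ᵐ[m.μΩ] fun x => vx (τ, x))
    (hf : Integrable (fun x => ⟪m.f τ x, pb (τ, x)⟫) m.μΩ) :
    (∫ x in m.Ω, (m.dissipationDensity (v τ x) (G x) (m.f τ x)
        + m.momentumDensity (v τ x) (G x) (E τ x) (m.f τ x)
            (ψ τ x) (deriv (fun σ => ψ σ x) τ) (fderiv ℝ (ψ τ) x)
        + strainDensity (v τ x) (G x) (E τ x)
            (Q τ x) (deriv (fun σ => Q σ x) τ) (fderiv ℝ (Q τ) x)))
      = (((∫ x in m.Ω, m.reducedDensity vb vt vx Eb Et Ex pb px Qb (τ, x))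
          + ∫ x in m.Ω, ⟪m.f τ x, pb (τ, x)⟫)
          - ∫ x in m.Ω, m.energyRate vb vt Eb Et (τ, x))
        + ∫ x in m.Ω, m.pairingRate vb vt Eb Et pb pt Qb Qt (τ, x) := by
  have hb := isBounded_domain hm
  have hΩm := hm.domain.1.measurableSet
  have hτT : τ ∈ Ioo 0 m.T := ⟨hτ.1, hτ.2.trans_le hT₁⟩
  have hτI := Ioo_subset_Icc_self hτT
  have hc : Continuous fun x : V => (τ, x) := by fun_prop
  have c3 := hE.cont.comp hc
  have c7 := continuous_gradSym_comp hm.φ_smooth c3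
  have c8 := hm.φ_smooth.continuous.comp c3
  simp only [Function.comp_def] at c3 c7 c8
  have e1 := hv.cont
  have e2 := hv.cont_x
  have e3 := hE.cont
  have e4 := hE.cont_x
  have e5 := hQ.cont
  have e6 := hQ.cont_x
  obtain ⟨B, hB⟩ : ∃ B : V → SymMat, ∀ x, gradSym m.φ (Eb (τ, x)) = B x := ⟨_, fun _ => rfl⟩
  simp only [hB] at c7
  obtain ⟨dk, hdk⟩ : ∃ dk : V → V →L[ℝ] ℝ, dk = fun x =>
    m.ρ • (innerSL ℝ (vb (τ, x))).comp (vx (τ, x))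
      - (frobS (gradSym m.φ (Eb (τ, x)))).comp (Ex (τ, x))
      + ((frobS.flip (Qb (τ, x))).comp (Ex (τ, x)) + (frobS (Eb (τ, x))).comp (Qx (τ, x))) :=
    ⟨_, rfl⟩
  have hdk' : ∀ x y, dk x y = m.ρ * ⟪vb (τ, x), vx (τ, x) y⟫
      - frob (gradSym m.φ (Eb (τ, x))) (Ex (τ, x) y)
      + (frob (Ex (τ, x) y) (Qb (τ, x)) + frob (Eb (τ, x)) (Qx (τ, x) y)) := fun x y => by
    rw [hdk]; rfl
  obtain ⟨k, hk⟩ : ∃ k : V → ℝ, k = fun x => m.ρ / 2 * ‖vb (τ, x)‖ ^ 2 - m.φ (Eb (τ, x))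
      + frob (Eb (τ, x)) (Qb (τ, x)) := ⟨_, rfl⟩
  have hkc : Continuous k := by
    rw [hk]; exact (Continuous.sub (by fun_prop) c8).add (by fun_prop)
  have hdkc : Continuous dk := continuous_clm_apply.2 fun y => by
    simp only [hdk', hB]
    fun_prop
  have hkd : ∀ x ∈ m.Ω, HasFDerivAt k (dk x) x := fun x hx => by
    have d1 := hv.hasFDerivAt_ext hm.domain.1 hτT hx
    have d2 := hE.hasFDerivAt_ext hm.domain.1 hτT hx
    have d3 := hQ.hasFDerivAt_ext hm.domain.1 hτT hx
    rw [hk]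
    refine (((d1.norm_sq.const_mul (m.ρ / 2)).sub
      ((hasFDerivAt_energyMap hm _).comp x d2)).add (hasFDerivAt_frob d2 d3)).congr_fderiv ?_
    ext y
    rw [hdk', frob_gradSym]
    simp only [add_apply, sub_apply, smul_apply, ContinuousLinearMap.comp_apply,
      innerSL_apply_apply, smul_eq_mul, nsmul_eq_mul, frobS_apply, ContinuousLinearMap.flip_apply]
    push_cast
    ring
  have hfl := integral_flux_eq_zero hm hv hτT hbc hkc hdkc hkd
  have hflc : Continuous fun x => k x * divg (vx (τ, x)) + dk x (vb (τ, x)) := by fun_prop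
  have i1 : IntegrableOn (fun x => m.reducedDensity vb vt vx Eb Et Ex pb px Qb (τ, x)) m.Ω :=
    integrableOn_of_continuous hb
      ((continuous_reducedDensity hm hv hE hp.cont hp.cont_x hQ.cont).comp hc)
  have i2 := integrableOn_of_continuous (μ := volume) hb hflc
  have i3 : IntegrableOn (fun x => m.energyRate vb vt Eb Et (τ, x)) m.Ω :=
    integrableOn_of_continuous hb ((continuous_energyRate hm hv hE).comp hc)
  have i4 : IntegrableOn (fun x => m.pairingRate vb vt Eb Et pb pt Qb Qt (τ, x)) m.Ω :=
    integrableOn_of_continuous hb ((continuous_pairingRate hv hE hp hQ).comp hc)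
  have i5 : IntegrableOn (fun x => ⟪m.f τ x, pb (τ, x)⟫) m.Ω := hf
  -- The vanishing flux integral is added on the right, after which the two sides agree pointwise.
  rw [← add_zero ((_ : ℝ) + ∫ x in m.Ω, m.pairingRate vb vt Eb Et pb pt Qb Qt (τ, x)), ← hfl,
    ← integral_add_sub_add i1 i5 i3 i4 i2]
  refine integral_congr_ae ?_
  filter_upwards [hG, ae_restrict_mem hΩm] with x hx hxΩ
  have hxc := subset_closure hxΩ
  have hψt : deriv (fun σ => ψ σ x) τ = vt (τ, x) + pt (τ, x) :=
    (((hv.hasDerivAt τ hτT x hxΩ).add (hp.hasDerivAt τ hτT x hxΩ)).congr_of_eventuallyEq (by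
        filter_upwards [Ioo_mem_nhds hτ.1 hτ.2] with σ hσ using hψ σ hσ x hxΩ)).deriv
  have hψx : fderiv ℝ (ψ τ) x = vx (τ, x) + px (τ, x) :=
    (((hv.hasFDerivAt τ hτT x hxΩ).add (hp.hasFDerivAt τ hτT x hxΩ)).congr_of_eventuallyEq (by
        filter_upwards [hm.domain.1.mem_nhds hxΩ] with y hy using hψ τ hτ y hy)).fderiv
  rw [hx, hψt, hψx, hψ τ hτ x hxΩ, hv.eqOn τ hτI x hxc, hE.eqOn τ hτI x hxc,
    hp.eqOn τ hτI x hxc, hQ.eqOn τ hτI x hxc, (hQ.hasDerivAt τ hτT x hxΩ).deriv,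
    (hQ.hasFDerivAt τ hτT x hxΩ).fderiv,
    density_identity m (hm.φ_commute _) (vb (τ, x)) (vt (τ, x)) (vx (τ, x)) (Et (τ, x))
      (Ex (τ, x)), hdk', hk]
  simp only [reducedDensity, energyRate, pairingRate]
  ring

theorem intervalIntegrable_force (hm : m.Standing) {w : ℝ × V → V} (hw : Continuous w) {s t : ℝ}
    (hs : 0 < s) (hst : s ≤ t) (ht : t < m.T) :
    IntervalIntegrable (fun τ => ∫ x in m.Ω, ⟪m.f τ x, w (τ, x)⟫) volume s t := by
  have h : IntegrableOn (fun τ => ∫ x in m.Ω, ⟪m.f τ x, w (τ, x)⟫) (Ioo 0 m.T) :=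
    (integrable_force_inner hm hw).integral_prod_left
  rw [intervalIntegrable_iff_integrableOn_Ioc_of_le hst]
  exact h.mono_set fun τ hτ => ⟨hs.trans hτ.1, hτ.2.trans_lt ht⟩

theorem intervalIntegrable_reducedDensity (hm : m.Standing) (hv : CylExt m.T m.Ω v vb vt vx)
    (hE : CylExt m.T m.Ω E Eb Et Ex) (hpb : Continuous pb) (hpx : Continuous px)
    (hQb : Continuous Qb) (s t : ℝ) : IntervalIntegrable
      (fun τ => ∫ x in m.Ω, m.reducedDensity vb vt vx Eb Et Ex pb px Qb (τ, x)) volume s t :=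
  (continuous_integral_of_continuous (isBounded_domain hm)
    (continuous_reducedDensity hm hv hE hpb hpx hQb)).intervalIntegrable _ _

/-- The time derivatives integrate to the end-point terms of the pairing and of the energy. In the
energy-variational inequality the former cancel and the latter turn E into the defect E - ℰ. -/
theorem bulk_identity (hm : m.Standing) (hv : CylExt m.T m.Ω v vb vt vx)
    (hE : CylExt m.T m.Ω E Eb Et Ex)
    (hbc : ∀ τ ∈ Ioo 0 m.T, ∀ᵐ x ∂surf.restrict (frontier m.Ω), ∀ n, IsOuterNormal m.Ω x n →
      ⟪v τ x, n⟫ = 0)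
    {G : ℝ → V → V →L[ℝ] V}
    (hG : ∀ᵐ τ ∂m.μT, G τ =ᵐ[m.μΩ] fun x => vx (τ, x))
    (hp : CylExt m.T m.Ω p pb pt px) (hQ : CylExt m.T m.Ω Q Qb Qt Qx)
    (hT₁ : T₁ ≤ m.T) (hψ : ∀ τ ∈ Ioo 0 T₁, ∀ x ∈ m.Ω, ψ τ x = v τ x + p τ x) {s t : ℝ}
    (hs : 0 < s) (hst : s ≤ t) (ht : t < T₁) :
    m.bulkTerm v G E ψ Q s t - (m.pairing (v t) (E t) (ψ t) (Q t)
        - m.pairing (v s) (E s) (ψ s) (Q s))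
      = (∫ τ in s..t, ((∫ x in m.Ω, m.reducedDensity vb vt vx Eb Et Ex pb px Qb (τ, x))
          + ∫ x in m.Ω, ⟪m.f τ x, pb (τ, x)⟫))
        - (m.energy (v t) (E t) - m.energy (v s) (E s)) := by
  have hb := isBounded_domain hm
  have htT := ht.trans_le hT₁
  have hfΩ : ∀ᵐ τ ∂m.μT, Integrable (fun x => ⟪m.f τ x, pb (τ, x)⟫) m.μΩ :=
    (integrable_force_inner hm hp.cont).prod_right_ae
  have hf2 := intervalIntegrable_force hm hp.cont hs hst htT
  have hr2 := intervalIntegrable_reducedDensity hm hv hE hp.cont hp.cont_x hQ.cont s t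
  have he2 := (continuous_integral_of_continuous hb
    (continuous_energyRate hm hv hE)).intervalIntegrable (μ := volume) s t
  have hq2 := (continuous_integral_of_continuous hb
    (continuous_pairingRate (m := m) hv hE hp hQ)).intervalIntegrable (μ := volume) s t
  rw [energy_sub_energy hm hv hE hs hst htT, pairing_sub_pairing hm hv hE hp hQ hT₁ hψ hs hst ht,
    bulkTerm, sub_eq_iff_eq_add, ← intervalIntegral.integral_sub (hr2.add hf2) he2,
    ← intervalIntegral.integral_add ((hr2.add hf2).sub he2) hq2]
  refine intervalIntegral.integral_congr_ae ?_
  rw [μT, ae_restrict_iff' measurableSet_Ioo] at hfΩ hG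
  filter_upwards [hfΩ, hG] with τ h1 h2 hτ
  rw [uIoc_of_le hst] at hτ
  have hτ₁ : τ ∈ Ioo 0 T₁ := ⟨hs.trans hτ.1, hτ.2.trans_lt ht⟩
  have hτT : τ ∈ Ioo 0 m.T := ⟨hs.trans hτ.1, hτ.2.trans_lt htT⟩
  exact integral_density_eq hm hv hE hp hQ hT₁ hψ hτ₁ (hbc τ hτT) (h2 hτT) (h1 hτT)

end Test

end Balance

end Model

/-! ### Boundary conditions, gradients and initial values of regular solutions -/

theorem _root_.ContDiff.contDiffUpTo {X F : Type*} [NormedAddCommGroup X] [NormedSpace ℝ X]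
    [NormedAddCommGroup F] [NormedSpace ℝ F] {U : Set X} (hU : IsOpen U) {u : X → F}
    (hu : ContDiff ℝ 1 u) : ContDiffUpTo 1 U u :=
  HasC1Ext.contDiffUpTo hU ⟨hu.continuous, hu.continuous_fderiv (by simp), fun _ _ => rfl,
    fun x _ => (hu.differentiable (by simp) x).hasFDerivAt⟩

theorem ae_eq_of_forall_integral_mul_eq {Ω : Set V} (hΩ : IsOpen Ω) {a b : V → ℝ}
    (ha : IntegrableOn a Ω) (hb : IntegrableOn b Ω)
    (h : ∀ g : V → ℝ, ContDiff ℝ (⊤ : ℕ∞) g → HasCompactSupport g → tsupport g ⊆ Ω →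
      ∫ x in Ω, g x * a x = ∫ x in Ω, g x * b x) : ∀ᵐ x ∂volume.restrict Ω, a x = b x := by
  have key : ∀ᵐ x, x ∈ Ω → a x - b x = 0 := by
    refine hΩ.ae_eq_zero_of_integral_contDiff_smul_eq_zero (ha.sub hb).locallyIntegrableOn
      fun g hg hgc hgs => ?_
    obtain ⟨C, hC⟩ := hgc.exists_bound_of_continuous hg.continuous
    have hgm := hg.continuous.aestronglyMeasurable (μ := volume.restrict Ω)
    have h1 : IntegrableOn (fun x => g x * a x) Ω := ha.bdd_mul hgm (ae_of_all _ hC)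
    have h2 : IntegrableOn (fun x => g x * b x) Ω := hb.bdd_mul hgm (ae_of_all _ hC)
    rw [← setIntegral_eq_integral_of_forall_compl_eq_zero (s := Ω) fun x hx => by
      rw [image_eq_zero_of_notMem_tsupport fun hx' => hx (hgs hx'), zero_smul]]
    simp only [smul_eq_mul, mul_sub]
    rw [integral_sub h1 h2, h g hg hgc hgs, sub_self]
  rw [ae_restrict_iff' hΩ.measurableSet]
  exact key.mono fun x hx hxΩ => sub_eq_zero.1 (hx hxΩ)

/-- Intervals (0,ε) have positive measure. Limits outside a null set are therefore unique, and
admissible times accumulate at zero. -/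
theorem neBot_nhdsGT_inf_ae : (𝓝[>] (0 : ℝ) ⊓ ae volume).NeBot := by
  rw [Filter.inf_neBot_iff]
  intro s hs t ht
  obtain ⟨ε, hε, h⟩ := mem_nhdsGT_iff_exists_Ioo_subset.1 hs
  by_contra hne
  rw [Set.not_nonempty_iff_eq_empty] at hne
  have h1 : Ioo 0 ε ⊆ tᶜ := fun x hx hxt => by
    have : x ∈ s ∩ t := ⟨h hx, hxt⟩
    rw [hne] at this
    exact this
  have h2 := measure_mono_null h1 (mem_ae_iff.1 ht)
  simp only [Real.volume_Ioo, sub_zero, ENNReal.ofReal_eq_zero] at h2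
  exact absurd h2 (not_le.2 hε)

namespace Model

variable {m : Model} {v : ℝ → V → V} {vb vt : ℝ × V → V} {vx : ℝ × V → V →L[ℝ] V}
  {E : ℝ → V → SymMat} {Eb Et : ℝ × V → SymMat} {Ex : ℝ × V → V →L[ℝ] SymMat}
  {v₀ : V → V} {E₀ : V → SymMat} {En : ℝ → ℝ}

theorem tendsto_of_cylExt {X F : Type*} [NormedAddCommGroup X] [NormedSpace ℝ X]
    [NormedAddCommGroup F] [NormedSpace ℝ F] {T : ℝ} {U : Set X} {u : ℝ → X → F}
    {ub ut : ℝ × X → F} {ux : ℝ × X → X →L[ℝ] F} (hu : CylExt T U u ub ut ux) {x : X}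
    (hx : x ∈ closure U) {t : ℝ} (ht : t ∈ Ioo 0 T) {s : ℕ → ℝ} (hs : ∀ n, s n ∈ Ioo 0 T)
    (hst : Tendsto s atTop (𝓝 t)) : Tendsto (fun n => u (s n) x) atTop (𝓝 (u t x)) := by
  rw [hu.eqOn t (Ioo_subset_Icc_self ht) x hx]
  refine Tendsto.congr (fun n => (hu.eqOn (s n) (Ioo_subset_Icc_self (hs n)) x hx).symm) ?_
  have hc := hu.cont
  have : Continuous fun τ => ub (τ, x) := by fun_prop
  exact (this.tendsto t).comp hst

theorem measurableSet_ΓN (hm : m.Standing) : MeasurableSet m.ΓN :=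
  isClosed_frontier.measurableSet.diff hm.ΓD_meas

theorem eqOn_domain_of_cylExt (hv : CylExt m.T m.Ω v vb vt vx) {t : ℝ} (ht : t ∈ Icc 0 m.T) :
    EqOn (v t) (fun x => vb (t, x)) m.Ω := fun x hx => hv.eqOn t ht x (subset_closure hx)

/-- At almost every time the trace is the value of the continuous extension; `forall_of_ae_ae`
carries the condition to every time. The slip condition below is treated in the same way. -/
theorem velocity_eq_zero (hm : m.Standing) (hsol : m.IsEnVarSolution v₀ E₀ v E En)
    (hv : CylExt m.T m.Ω v vb vt vx) :
    ∀ t ∈ Ioo 0 m.T, ∀ᵐ x ∂surf.restrict m.ΓD, v t x = 0 := by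
  have hc := hv.cont
  have hmem : ∀ᵐ x ∂surf.restrict m.ΓD, x ∈ closure m.Ω :=
    (ae_restrict_mem hm.ΓD_meas).mono fun x hx => frontier_subset_closure (hm.ΓD_subset hx)
  refine forall_of_ae_ae ?_ hmem fun x hx t ht s hs hst h => ?_
  · have hT : ∀ᵐ t ∂m.μT, t ∈ Ioo 0 m.T := ae_restrict_mem measurableSet_Ioo
    filter_upwards [hsol.dirichlet, hT] with t h1 ht
    filter_upwards [h1, hmem] with x h2 hx
    have hI := Ioo_subset_Icc_self ht
    rw [hv.eqOn t hI x hx]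
    exact (h2.eq_of_continuous hm.domain.1 (by fun_prop) (eqOn_domain_of_cylExt hv hI) hx).symm
  · exact tendsto_nhds_unique (tendsto_of_cylExt hv hx ht hs hst)
      (tendsto_const_nhds.congr fun n => (h n).symm)

theorem inner_velocity_normal (hm : m.Standing) (hsol : m.IsEnVarSolution v₀ E₀ v E En)
    (hv : CylExt m.T m.Ω v vb vt vx) :
    ∀ t ∈ Ioo 0 m.T, ∀ᵐ x ∂surf.restrict m.ΓN, ∀ n, IsOuterNormal m.Ω x n → ⟪v t x, n⟫ = 0 := by
  have hc := hv.cont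
  have hmem : ∀ᵐ x ∂surf.restrict m.ΓN, x ∈ closure m.Ω :=
    (ae_restrict_mem (measurableSet_ΓN hm)).mono fun x hx => frontier_subset_closure hx.1
  refine forall_of_ae_ae ?_ hmem fun x hx t ht s hs hst h => ?_
  · have hT : ∀ᵐ t ∂m.μT, t ∈ Ioo 0 m.T := ae_restrict_mem measurableSet_Ioo
    filter_upwards [hsol.slip, hT] with t h1 ht
    filter_upwards [h1, hmem] with x h2 hx
    obtain ⟨g, hg, hgn⟩ := h2
    have hI := Ioo_subset_Icc_self ht
    rw [hv.eqOn t hI x hx]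
    rwa [← hg.eq_of_continuous hm.domain.1 (by fun_prop) (eqOn_domain_of_cylExt hv hI) hx]
  · intro n hn
    exact tendsto_nhds_unique ((tendsto_of_cylExt hv hx ht hs hst).inner tendsto_const_nhds)
      (tendsto_const_nhds.congr fun k => (h k n hn).symm)

theorem testBoundary_velocity (hm : m.Standing) (hsol : m.IsEnVarSolution v₀ E₀ v E En)
    (hv : CylExt m.T m.Ω v vb vt vx) : ∀ t ∈ Ioo 0 m.T, m.TestBoundary (v t) := fun t ht =>
  ⟨velocity_eq_zero hm hsol hv t ht, inner_velocity_normal hm hsol hv t ht⟩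

theorem TestBoundary.tangential (hm : m.Standing) {ψ : V → V} (h : m.TestBoundary ψ) :
    ∀ᵐ x ∂surf.restrict (frontier m.Ω), ∀ n, IsOuterNormal m.Ω x n → ⟪ψ x, n⟫ = 0 := by
  have : frontier m.Ω = m.ΓD ∪ m.ΓN := (union_sdiff_cancel hm.ΓD_subset).symm
  rw [this, ae_restrict_union_iff]
  exact ⟨h.1.mono fun x hx n _ => by rw [hx, inner_zero_left], h.2⟩

/-- The inequality holds for some weak gradient, which has to be identified with the classical one.
The space-time bound provides square integrability in space at almost every time. -/
theorem weakGradient_ae_eq (hm : m.Standing) (hv : CylExt m.T m.Ω v vb vt vx)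
    {G : ℝ → V → V →L[ℝ] V} (hG : MemLpLq 2 2 m.T m.Ω G)
    (hw : ∀ᵐ t ∂m.μT, IsWeakGradient m.Ω (v t) (G t)) :
    ∀ᵐ τ ∂m.μT, G τ =ᵐ[m.μΩ] fun x => vx (τ, x) := by
  have := isFiniteMeasure_μΩ hm
  have hc := hv.cont
  have hcx := hv.cont_x
  obtain ⟨h1, h2⟩ := hG
  have h1' : AEStronglyMeasurable (Function.uncurry G) (m.μT.prod m.μΩ) := h1
  have hmeas : AEMeasurable (fun t => ∫⁻ x, ‖G t x‖ₑ ^ (2 : ℝ) ∂m.μΩ) m.μT :=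
    (h1'.enorm.pow_const 2).lintegral_prod_right'
  have hfin : ∀ᵐ t ∂m.μT, ∫⁻ x, ‖G t x‖ₑ ^ (2 : ℝ) ∂m.μΩ < ∞ := by
    refine ae_lt_top' hmeas ?_
    rw [eLpNorm_lt_top_iff_lintegral_rpow_enorm_lt_top (by norm_num) (by norm_num)] at h2
    refine ne_of_lt (lt_of_eq_of_lt (lintegral_congr fun t => ?_) h2)
    rw [eLpNorm_eq_lintegral_rpow_enorm_toReal (by norm_num) (by norm_num), enorm_eq_self,
      ← ENNReal.rpow_mul]
    norm_num [μΩ]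
  have hT : ∀ᵐ t ∂m.μT, t ∈ Ioo 0 m.T := ae_restrict_mem measurableSet_Ioo
  filter_upwards [hfin, hw, h1'.prodMk_left, hT] with t h3 h4 h5 ht
  have hmem : MemLp (G t) 2 m.μΩ := ⟨h5, by
    rw [eLpNorm_lt_top_iff_lintegral_rpow_enorm_lt_top (by norm_num) (by norm_num)]
    simpa using h3⟩
  exact h4.ae_eq hm.domain.1 (hmem.integrable (by norm_num)) (by fun_prop)
    (eqOn_domain_of_cylExt hv (Ioo_subset_Icc_self ht)) (by fun_prop)
    (fun x hx => hv.hasFDerivAt t ht x hx)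

theorem testBoundary_of_tsupport_subset (hm : m.Standing) {ψ : V → V} (h : tsupport ψ ⊆ m.Ω) :
    m.TestBoundary ψ := by
  have h0 : ∀ x ∈ frontier m.Ω, ψ x = 0 := fun x hx =>
    image_eq_zero_of_notMem_tsupport fun hxs =>
      (hm.domain.1.inter_frontier_eq ▸ ⟨h hxs, hx⟩ : x ∈ (∅ : Set V))
  constructor
  · filter_upwards [ae_restrict_mem hm.ΓD_meas] with x hx using h0 x (hm.ΓD_subset hx)
  · filter_upwards [ae_restrict_mem (measurableSet_ΓN hm)] with x hx n _
    rw [h0 x hx.1, inner_zero_left]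

theorem testBoundary_zero : m.TestBoundary fun _ => 0 :=
  ⟨ae_of_all _ fun _ => rfl, ae_of_all _ fun _ _ _ => inner_zero_left _⟩

/-- The pairing with a fixed test pair is continuous up to time zero, so its value there is the
weak* limit. -/
theorem pairing_initial (hm : m.Standing) (hsol : m.IsEnVarSolution v₀ E₀ v E En)
    (hv : CylExt m.T m.Ω v vb vt vx) (hE : CylExt m.T m.Ω E Eb Et Ex) {ψ : V → V}
    {Ψ : V → SymMat} (hψ : ContDiff ℝ 1 ψ) (hΨ : ContDiff ℝ 1 Ψ) (hb : m.TestBoundary ψ) :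
    m.pairing v₀ E₀ ψ Ψ = m.pairing (v 0) (E 0) ψ Ψ := by
  have := neBot_nhdsGT_inf_ae
  have h1 := hsol.initial ψ Ψ (hψ.contDiffUpTo hm.domain.1) (hΨ.contDiffUpTo hm.domain.1) hb
  have e1 := hv.cont
  have e2 := hE.cont
  have e3 := hψ.continuous
  have e4 := hΨ.continuous
  have hc : Continuous fun t => ∫ x in m.Ω, (m.ρ * ⟪vb (t, x), ψ x⟫ + frob (Eb (t, x)) (Ψ x)) :=
    continuous_integral_of_continuous (isBounded_domain hm)
      (c := fun z => m.ρ * ⟪vb z, ψ z.2⟫ + frob (Eb z) (Ψ z.2)) (by fun_prop)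
  have heq : ∀ t ∈ Icc 0 m.T, m.pairing (v t) (E t) ψ Ψ
      = ∫ x in m.Ω, (m.ρ * ⟪vb (t, x), ψ x⟫ + frob (Eb (t, x)) (Ψ x)) := fun t ht =>
    setIntegral_congr_fun hm.domain.1.measurableSet fun x hx => by
      simp only [hv.eqOn t ht x (subset_closure hx), hE.eqOn t ht x (subset_closure hx)]
  refine tendsto_nhds_unique h1 ?_
  rw [heq 0 ⟨le_rfl, hm.T_pos.le⟩]
  refine ((hc.tendsto 0).mono_left (inf_le_left.trans nhdsWithin_le_nhds)).congr' ?_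
  refine Filter.Eventually.filter_mono inf_le_left ?_
  filter_upwards [Ioo_mem_nhdsGT hm.T_pos] with t ht
  exact (heq t (Ioo_subset_Icc_self ht)).symm

/-- Test functions supported inside `Ω` and acting on one component at a time suffice, since they
satisfy every boundary condition. -/
theorem initial_eq (hm : m.Standing) (h₀ : m.IsInitial v₀ E₀)
    (hsol : m.IsEnVarSolution v₀ E₀ v E En)
    (hv : CylExt m.T m.Ω v vb vt vx) (hE : CylExt m.T m.Ω E Eb Et Ex) :
    ∀ᵐ x ∂m.μΩ, v 0 x = v₀ x ∧ E 0 x = E₀ x := by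
  have e1 := hv.cont
  have e2 := hE.cont
  have h0 : (0 : ℝ) ∈ Icc 0 m.T := ⟨le_rfl, hm.T_pos.le⟩
  have hb := isBounded_domain hm
  have hΩm := hm.domain.1.measurableSet
  have hv₀ : IntegrableOn v₀ m.Ω := memLp_one_iff_integrable.1 h₀.v_int
  have hE₀ : IntegrableOn E₀ m.Ω := memLp_one_iff_integrable.1 h₀.E_int
  have h1 : ∀ i, ∀ᵐ x ∂volume.restrict m.Ω,
      ⟪vb (0, x), EuclideanSpace.single i 1⟫ = ⟪v₀ x, EuclideanSpace.single i 1⟫ := by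
    intro i
    refine ae_eq_of_forall_integral_mul_eq hm.domain.1
      (integrableOn_of_continuous hb (by fun_prop)) (hv₀.inner_const _) fun g hg hgc hgs => ?_
    have hg1 : ContDiff ℝ 1 g := hg.of_le (by exact_mod_cast le_top)
    have key := pairing_initial hm hsol hv hE (ψ := fun x => g x • EuclideanSpace.single i 1)
      (Ψ := fun _ => 0) (hg1.smul contDiff_const) contDiff_const
      (testBoundary_of_tsupport_subset hm ((tsupport_smul_subset_left g _).trans hgs))
    have h3 : ∀ w : V → V, ∀ A : V → SymMat,
        m.pairing w A (fun x => g x • EuclideanSpace.single i 1) (fun _ => 0)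
          = m.ρ * ∫ x in m.Ω, g x * ⟪w x, EuclideanSpace.single i 1⟫ := fun w A => by
      rw [pairing, ← integral_const_mul]
      simp [frob, real_inner_smul_right]
    rw [h3, h3] at key
    rw [mul_left_cancel₀ hm.ρ_pos.ne' key]
    exact setIntegral_congr_fun hΩm fun x hx => by
      simp only [hv.eqOn 0 h0 x (subset_closure hx)]
  have h2 : ∀ i j, ∀ᵐ x ∂volume.restrict m.Ω,
      frobS (Eb (0, x)) (symPart (Matrix.single i j 1))
        = frobS (E₀ x) (symPart (Matrix.single i j 1)) := by
    intro i j
    refine ae_eq_of_forall_integral_mul_eq hm.domain.1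
      (integrableOn_of_continuous hb (by simp only [frobS_apply]; fun_prop))
      ((frobS.flip (symPart (Matrix.single i j 1))).integrable_comp hE₀) fun g hg hgc hgs => ?_
    have hg1 : ContDiff ℝ 1 g := hg.of_le (by exact_mod_cast le_top)
    have key := pairing_initial hm hsol hv hE (ψ := fun _ => 0)
      (Ψ := fun x => g x • symPart (Matrix.single i j 1)) contDiff_const
      (hg1.smul contDiff_const) testBoundary_zero
    have h3 : ∀ w : V → V, ∀ A : V → SymMat,
        m.pairing w A (fun _ => 0) (fun x => g x • symPart (Matrix.single i j 1))
          = ∫ x in m.Ω, g x * frobS (A x) (symPart (Matrix.single i j 1)) := fun w A => by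
      rw [pairing]
      simp [frobS_apply, frob_smul_right]
    rw [h3, h3] at key
    rw [key]
    exact setIntegral_congr_fun hΩm fun x hx => by
      simp only [hE.eqOn 0 h0 x (subset_closure hx)]
  have h1' := ae_all_iff.2 h1
  have h2' := ae_all_iff.2 fun i => ae_all_iff.2 (h2 i)
  filter_upwards [h1', h2', ae_restrict_mem hΩm] with x hx1 hx2 hx
  rw [hv.eqOn 0 h0 x (subset_closure hx), hE.eqOn 0 h0 x (subset_closure hx)]
  refine ⟨?_, SymMat.ext_frob hx2⟩
  ext i
  simpa [EuclideanSpace.inner_single_right] using hx1 i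

theorem energy_initial (hm : m.Standing) (h₀ : m.IsInitial v₀ E₀)
    (hsol : m.IsEnVarSolution v₀ E₀ v E En)
    (hv : CylExt m.T m.Ω v vb vt vx) (hE : CylExt m.T m.Ω E Eb Et Ex) :
    m.energy v₀ E₀ = m.energy (v 0) (E 0) := by
  refine integral_congr_ae ?_
  filter_upwards [initial_eq hm h₀ hsol hv hE] with x hx
  rw [energyDensity, energyDensity, hx.1, hx.2]

end Model

/-! ### Test functions -/

theorem strainRate_zero : strainRate 0 = 0 := strainRateL.map_zero

theorem divg_zero : divg 0 = 0 := divgL.map_zero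

theorem frob_zero_right (A : Mat) : frob A 0 = 0 := by simp [frob]

section CylExt

variable {X F : Type*} [NormedAddCommGroup X] [NormedSpace ℝ X] [NormedAddCommGroup F]
  [NormedSpace ℝ F] {T : ℝ} {U : Set X} {u w : ℝ → X → F} {ub ut wb wt : ℝ × X → F}
  {ux wx : ℝ × X → X →L[ℝ] F}

theorem CylExt.add (hu : CylExt T U u ub ut ux) (hw : CylExt T U w wb wt wx) :
    CylExt T U (fun τ x => u τ x + w τ x) (fun z => ub z + wb z) (fun z => ut z + wt z)
      (fun z => ux z + wx z) where
  cont := hu.cont.add hw.cont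
  cont_t := hu.cont_t.add hw.cont_t
  cont_x := hu.cont_x.add hw.cont_x
  eqOn t ht x hx := by rw [hu.eqOn t ht x hx, hw.eqOn t ht x hx]
  hasDerivAt t ht x hx := (hu.hasDerivAt t ht x hx).add (hw.hasDerivAt t ht x hx)
  hasFDerivAt t ht x hx := (hu.hasFDerivAt t ht x hx).add (hw.hasFDerivAt t ht x hx)

theorem CylExt.time_smul (hu : CylExt T U u ub ut ux) {η : ℝ → ℝ} (hη : ContDiff ℝ 1 η) :
    CylExt T U (fun τ x => η τ • u τ x) (fun z => η z.1 • ub z)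
      (fun z => η z.1 • ut z + deriv η z.1 • ub z) (fun z => η z.1 • ux z) := by
  have h1 := hη.continuous
  have h2 : Continuous (deriv η) := hη.continuous_deriv (by simp)
  have h3 := hu.cont
  have h4 := hu.cont_t
  have h5 := hu.cont_x
  refine ⟨by fun_prop, by fun_prop, by fun_prop, fun t ht x hx => ?_, fun t ht x hx => ?_,
    fun t ht x hx => ?_⟩
  · rw [hu.eqOn t ht x hx]
  · rw [← hu.eqOn t (Ioo_subset_Icc_self ht) x (subset_closure hx)]
    exact (hη.differentiable (by simp) t).hasDerivAt.smul (hu.hasDerivAt t ht x hx)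
  · exact (hu.hasFDerivAt t ht x hx).const_smul (η t)

theorem CylExt.const_smul (hu : CylExt T U u ub ut ux) (c : ℝ) :
    CylExt T U (fun τ x => c • u τ x) (fun z => c • ub z) (fun z => c • ut z)
      (fun z => c • ux z) := by
  have h := hu.time_smul (η := fun _ => c) contDiff_const
  simpa using h

theorem HasC1Ext.cylExt_const {Φ Φb : X → F} {D : X → X →L[ℝ] F} (h : HasC1Ext U Φ Φb D) :
    CylExt T U (fun _ => Φ) (fun z => Φb z.2) (fun _ => 0) (fun z => D z.2) where
  cont := h.cont.comp continuous_snd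
  cont_t := continuous_const
  cont_x := h.cont_deriv.comp continuous_snd
  eqOn _ _ _ hx := h.eqOn hx
  hasDerivAt t _ _ _ := hasDerivAt_const t _
  hasFDerivAt _ _ x hx := h.hasFDerivAt x hx

theorem CylExt.zero : CylExt T U (fun _ _ => (0 : F)) (fun _ => 0) (fun _ => 0)
    (fun _ => (0 : X →L[ℝ] F)) where
  cont := continuous_const
  cont_t := continuous_const
  cont_x := continuous_const
  eqOn _ _ _ _ := rfl
  hasDerivAt t _ _ _ := hasDerivAt_const t _
  hasFDerivAt _ _ x _ := hasFDerivAt_const _ x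

/-- Needed for the field Dφ(𝔼). -/
theorem CylExt.comp_contDiff {F' : Type*} [NormedAddCommGroup F'] [NormedSpace ℝ F']
    (hu : CylExt T U u ub ut ux) {g : F → F'} (hg : ContDiff ℝ 1 g) :
    CylExt T U (fun τ x => g (u τ x)) (fun z => g (ub z)) (fun z => fderiv ℝ g (ub z) (ut z))
      (fun z => (fderiv ℝ g (ub z)).comp (ux z)) := by
  have h1 := hg.continuous
  have h2 : Continuous (fderiv ℝ g) := hg.continuous_fderiv (by simp)
  have h3 := hu.cont
  have h4 := hu.cont_t
  have h5 := hu.cont_x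
  refine ⟨by fun_prop, by fun_prop, by fun_prop, fun t ht x hx => ?_, fun t ht x hx => ?_,
    fun t ht x hx => ?_⟩
  · rw [hu.eqOn t ht x hx]
  · rw [← hu.eqOn t (Ioo_subset_Icc_self ht) x (subset_closure hx)]
    exact (hg.differentiable (by simp) _).hasFDerivAt.comp_hasDerivAt t (hu.hasDerivAt t ht x hx)
  · rw [← hu.eqOn t (Ioo_subset_Icc_self ht) x (subset_closure hx)]
    exact (hg.differentiable (by simp) _).hasFDerivAt.comp x (hu.hasFDerivAt t ht x hx)

end CylExt

/-- A cut-off in time. -/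
theorem exists_time_cutoff {T₁ T : ℝ} (h : T₁ < T) : ∃ η : ℝ → ℝ, ContDiff ℝ 1 η ∧
    (∀ τ ≤ T₁, η τ = 1) ∧ ∃ T₂ < T, ∀ τ, T₂ ≤ τ → η τ = 0 := by
  have hd : 0 < (T - T₁) / 2 := by linarith
  refine ⟨fun τ => Real.smoothTransition (((T₁ + T) / 2 - τ) / ((T - T₁) / 2)), ?_, fun τ hτ => ?_,
    (T₁ + T) / 2, by linarith, fun τ hτ => ?_⟩
  · exact (Real.smoothTransition.contDiff).comp (by fun_prop)
  · exact Real.smoothTransition.one_of_one_le ((one_le_div hd).2 (by linarith))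
  · exact Real.smoothTransition.zero_of_nonpos (div_nonpos_of_nonpos_of_nonneg (by linarith) hd.le)

namespace Model

variable {m : Model}

section IsTest

variable {F : Type*} [NormedAddCommGroup F] [NormedSpace ℝ F] {u w : ℝ → V → F}
  {ub ut : ℝ × V → F} {ux : ℝ × V → V →L[ℝ] F}

theorem isTest_of_cylExt (hm : m.Standing) (hu : CylExt m.T m.Ω u ub ut ux) {T' : ℝ}
    (hT' : T' < m.T) (h0 : ∀ t, T' ≤ t → ∀ x ∈ closure m.Ω, u t x = 0) : m.IsTest u :=
  ⟨(hu.hasC1Ext hm.T_pos hm.domain.1).contDiffUpTo (isOpen_Ioo.prod hm.domain.1), T', hT', h0⟩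

theorem isTest_time_smul (hm : m.Standing) (hu : CylExt m.T m.Ω u ub ut ux) {η : ℝ → ℝ}
    (hη : ContDiff ℝ 1 η) {T₂ : ℝ} (hT₂ : T₂ < m.T) (h0 : ∀ τ, T₂ ≤ τ → η τ = 0) :
    m.IsTest fun τ x => η τ • u τ x :=
  isTest_of_cylExt hm (hu.time_smul hη) hT₂ fun t ht x _ => by rw [h0 t ht, zero_smul]

end IsTest

theorem TestBoundary.add {ψ χ : V → V} (h : m.TestBoundary ψ) (h' : m.TestBoundary χ) :
    m.TestBoundary fun x => ψ x + χ x := by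
  refine ⟨?_, ?_⟩
  · filter_upwards [h.1, h'.1] with x h1 h2
    rw [h1, h2, add_zero]
  · filter_upwards [h.2, h'.2] with x h1 h2 n hn
    rw [inner_add_left, h1 n hn, h2 n hn, add_zero]

theorem TestBoundary.const_smul {ψ : V → V} (h : m.TestBoundary ψ) (c : ℝ) :
    m.TestBoundary fun x => c • ψ x := by
  refine ⟨?_, ?_⟩
  · filter_upwards [h.1] with x h1
    rw [h1, smul_zero]
  · filter_upwards [h.2] with x h1 n hn
    rw [real_inner_smul_left, h1 n hn, mul_zero]

variable {v : ℝ → V → V} {vb vt : ℝ × V → V} {vx : ℝ × V → V →L[ℝ] V}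
  {E : ℝ → V → SymMat} {Eb Et : ℝ × V → SymMat} {Ex : ℝ × V → V →L[ℝ] SymMat}
  {v₀ : V → V} {E₀ : V → SymMat} {En : ℝ → ℝ}

/-! ### The reduced inequality and the vanishing of the energy defect -/

/-- The dissipation of the elastic stress at time `τ`. -/
def stressPotential (m : Model) (E : ℝ → V → SymMat) (τ : ℝ) : ℝ≥0∞ :=
  m.potential fun x => dev (gradSym m.φ (E τ x))

/-- The energy-variational inequality after integration by parts, tested with `v + p` and `Q`
on `(0,T₁)`. -/
def ReducedInequality (m : Model) (K : (closure m.Ω → V) → (closure m.Ω → SymMat) → ℝ≥0)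
    (v : ℝ → V → V) (E : ℝ → V → SymMat) (En : ℝ → ℝ)
    (vb vt : ℝ × V → V) (vx : ℝ × V → V →L[ℝ] V)
    (Eb Et : ℝ × V → SymMat) (Ex : ℝ × V → V →L[ℝ] SymMat) (s t : ℝ) : Prop :=
  ∀ T₁ ≤ m.T, t < T₁ → ∀ (ψ p : ℝ → V → V) (pb pt : ℝ × V → V) (px : ℝ × V → V →L[ℝ] V)
    (Q : ℝ → V → SymMat) (Qb Qt : ℝ × V → SymMat) (Qx : ℝ × V → V →L[ℝ] SymMat),
    m.IsTestPair ψ Q → CylExt m.T m.Ω p pb pt px → CylExt m.T m.Ω Q Qb Qt Qx →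
    (∀ τ ∈ Ioo 0 T₁, ∀ x ∈ m.Ω, ψ τ x = v τ x + p τ x) →
    (((En t - m.energy (v t) (E t)) - (En s - m.energy (v s) (E s))
      + ∫ τ in s..t, ((∫ x in m.Ω, m.reducedDensity vb vt vx Eb Et Ex pb px Qb (τ, x))
          + ∫ x in m.Ω, ⟪m.f τ x, pb (τ, x)⟫) : ℝ) : EReal)
      + ((∫⁻ τ in Ioc s t, m.stressPotential E τ : ℝ≥0∞) : EReal)
    ≤ ((∫⁻ τ in Ioc s t, m.potential (fun x => dev (Q τ x)) : ℝ≥0∞) : EReal)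
      + ((∫ τ in s..t, (K ((closure m.Ω).domRestrict (ψ τ)) ((closure m.Ω).domRestrict (Q τ)) : ℝ)
            * (En τ - m.energy (v τ) (E τ)) : ℝ) : EReal)

/-- `bulk_identity` converts the inequality. For the last claim the zero test pair leaves a real
number on the right, so the dissipation of the stress cannot be infinite; this permits its
cancellation later. -/
theorem exists_reducedInequality (hm : m.Standing) (hsol : m.IsEnVarSolution v₀ E₀ v E En)
    (hv : CylExt m.T m.Ω v vb vt vx) (hE : CylExt m.T m.Ω E Eb Et Ex) :
    ∃ K : (closure m.Ω → V) → (closure m.Ω → SymMat) → ℝ≥0,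
      (∀ ψ Ψ, m.IsTestPair ψ Ψ →
        Integrable (fun τ =>
          (K ((closure m.Ω).domRestrict (ψ τ)) ((closure m.Ω).domRestrict (Ψ τ)) : ℝ)) m.μT) ∧
      (∀ᵐ s ∂m.μT, ∀ᵐ t ∂m.μT, s < t → m.ReducedInequality K v E En vb vt vx Eb Et Ex s t) ∧
      ∀ᵐ s ∂m.μT, ∀ᵐ t ∂m.μT, s < t → ∫⁻ τ in Ioc s t, m.stressPotential E τ ≠ ∞ := by
  obtain ⟨G, hG, hw, K, hK, hineq⟩ := hsol.inequality
  have hGv := weakGradient_ae_eq hm hv hG hw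
  have hbd := testBoundary_velocity hm hsol hv
  have hT : ∀ᵐ t ∂m.μT, t ∈ Ioo 0 m.T := ae_restrict_mem measurableSet_Ioo
  refine ⟨K, hK, ?_, ?_⟩
  · filter_upwards [hineq, hT] with s hs hsT
    filter_upwards [hs, hT] with t ht htT hst T₁ hT₁ htT₁ ψ p pb pt px Q Qb Qt Qx htest hp hQ hψ
    have h1 := ht hst ψ Q htest
    have h2 := bulk_identity hm hv hE (fun τ hτ => (hbd τ hτ).tangential hm) hGv hp hQ hT₁ hψ
      hsT.1 hst.le htT₁
    refine le_trans (le_of_eq ?_) h1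
    simp only [stressPotential]
    congr 2
    linarith
  · filter_upwards [hineq] with s hs
    filter_upwards [hs] with t ht hst htop
    have htest : m.IsTestPair (fun _ _ => 0) (fun _ _ => 0) := by
      refine ⟨isTest_of_cylExt hm CylExt.zero (T' := 0) hm.T_pos fun _ _ _ _ => rfl,
        isTest_of_cylExt hm CylExt.zero (T' := 0) hm.T_pos fun _ _ _ _ => rfl,
        fun _ _ => testBoundary_zero⟩
    have h1 := ht hst _ _ htest
    have h2 : m.potential (fun _ : V => dev (0 : SymMat)) = 0 := by
      have h3 : (fun _ : V => dev (0 : SymMat)) = 0 := funext fun _ => devL.map_zero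
      rw [h3, potential, dif_pos (MemLp.zero : MemLp (0 : V → DevMat) 1 _)]
      exact hm.P_zero
    simp only [stressPotential] at htop
    rw [EnVarInequality, htop, EReal.coe_ennreal_top, EReal.coe_add_top] at h1
    simp only [h2, lintegral_zero, EReal.coe_ennreal_zero, zero_add, top_le_iff] at h1
    exact EReal.coe_ne_top _ h1

theorem ereal_add_le_cancel {a b : ℝ} {L : ℝ≥0∞} (hL : L ≠ ∞)
    (h : (a : EReal) + (L : EReal) ≤ (L : EReal) + (b : EReal)) : a ≤ b := by
  lift L to ℝ≥0 using hL
  have h1 : (((L : ℝ≥0∞)) : EReal) = ((L : ℝ) : EReal) := rfl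
  rw [h1, ← EReal.coe_add, ← EReal.coe_add, EReal.coe_le_coe_iff] at h
  linarith

theorem exists_energy_eq_continuous (hm : m.Standing) (hv : CylExt m.T m.Ω v vb vt vx)
    (hE : CylExt m.T m.Ω E Eb Et Ex) :
    ∃ c : ℝ → ℝ, Continuous c ∧ ∀ t ∈ Icc 0 m.T, m.energy (v t) (E t) = c t := by
  have h1 := hm.φ_smooth.continuous.comp hE.cont
  have h2 := hv.cont
  refine ⟨_, continuous_integral_of_continuous (isBounded_domain hm)
    (c := fun z => m.ρ / 2 * ‖vb z‖ ^ 2 + m.φ (Eb z)) (Continuous.add (by fun_prop) h1),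
    fun t ht => setIntegral_congr_fun hm.domain.1.measurableSet fun x hx => ?_⟩
  simp only [energyDensity, hv.eqOn t ht x (subset_closure hx), hE.eqOn t ht x (subset_closure hx)]

/-- Jordan decomposition into monotone functions. -/
theorem _root_.BoundedVariationOn.aemeasurable_restrict_Icc {f : ℝ → ℝ} {a b : ℝ}
    (h : BoundedVariationOn f (Icc a b)) : AEMeasurable f (volume.restrict (Icc a b)) := by
  obtain ⟨p, q, hp, hq, rfl⟩ := h.locallyBoundedVariationOn.exists_monotoneOn_sub_monotoneOn
  exact (aemeasurable_restrict_of_monotoneOn measurableSet_Icc hp).sub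
    (aemeasurable_restrict_of_monotoneOn measurableSet_Icc hq)

/-- For p = 0 and Q = Dφ(𝔼), cut off only after `T₁`, the strain residual is paired with zero and
both sides contain the same finite dissipation. The weight of this one test pair serves for all s
and t below `T₁`. -/
theorem defect_le_integral (hm : m.Standing)
    (hv : CylExt m.T m.Ω v vb vt vx) (hE : CylExt m.T m.Ω E Eb Et Ex)
    (hbd : ∀ t ∈ Ioo 0 m.T, m.TestBoundary (v t))
    {K : (closure m.Ω → V) → (closure m.Ω → SymMat) → ℝ≥0}
    (hK : ∀ ψ Ψ, m.IsTestPair ψ Ψ → Integrable (fun τ =>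
      (K ((closure m.Ω).domRestrict (ψ τ)) ((closure m.Ω).domRestrict (Ψ τ)) : ℝ)) m.μT)
    (hred : ∀ᵐ s ∂m.μT, ∀ᵐ t ∂m.μT, s < t → m.ReducedInequality K v E En vb vt vx Eb Et Ex s t)
    (hfin : ∀ᵐ s ∂m.μT, ∀ᵐ t ∂m.μT, s < t → ∫⁻ τ in Ioc s t, m.stressPotential E τ ≠ ∞)
    {T₁ : ℝ} (hT₁ : T₁ < m.T) :
    ∃ k : ℝ → ℝ, (∀ t, 0 ≤ k t) ∧ Integrable k m.μT ∧ ∀ᵐ s ∂m.μT, ∀ᵐ t ∂m.μT, s < t → t < T₁ →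
      (En t - m.energy (v t) (E t)) - (En s - m.energy (v s) (E s))
        ≤ ∫ τ in s..t, k τ * (En τ - m.energy (v τ) (E τ)) := by
  obtain ⟨η, hη, hη1, T₂, hT₂, hη0⟩ := exists_time_cutoff hT₁
  have hB := hE.comp_contDiff (contDiff_gradSym hm.φ_smooth)
  have htest : m.IsTestPair (fun τ x => η τ • v τ x) (fun τ x => η τ • gradSym m.φ (E τ x)) :=
    ⟨isTest_time_smul hm hv hη hT₂ hη0, isTest_time_smul hm hB hη hT₂ hη0,
      fun t ht => (hbd t ht).const_smul _⟩
  refine ⟨_, fun t => NNReal.coe_nonneg _, hK _ _ htest, ?_⟩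
  have hT : ∀ᵐ t ∂m.μT, t ∈ Ioo 0 m.T := ae_restrict_mem measurableSet_Ioo
  filter_upwards [hred, hfin, hT] with s h1 h2 hs
  filter_upwards [h1, h2] with t h3 h4 hst ht
  have h5 := h3 hst T₁ hT₁.le ht _ _ _ _ _ _ _ _ _ htest CylExt.zero (hB.time_smul hη)
    (fun τ hτ x _ => by rw [hη1 τ hτ.2.le, one_smul, add_zero])
  have h6 : ∫⁻ τ in Ioc s t, m.potential (fun x => dev (η τ • gradSym m.φ (E τ x)))
      = ∫⁻ τ in Ioc s t, m.stressPotential E τ :=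
    setLIntegral_congr_fun measurableSet_Ioc fun τ hτ => by
      simp only [stressPotential, hη1 τ (hτ.2.trans ht.le), one_smul]
  have h7 : ∫ τ in s..t, ((∫ x in m.Ω, m.reducedDensity vb vt vx Eb Et Ex (fun _ => 0) (fun _ => 0)
        (fun z => η z.1 • gradSym m.φ (Eb z)) (τ, x)) + ∫ x in m.Ω, ⟪m.f τ x, (0 : V)⟫) = 0 := by
    rw [intervalIntegral.integral_congr (g := fun _ => (0 : ℝ)), intervalIntegral.integral_zero]
    intro τ hτ
    rw [uIcc_of_le hst.le] at hτ
    simp [reducedDensity, reducedMomentum, hη1 τ (hτ.2.trans ht.le), strainRate_zero, divg_zero,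
      frob_zero_right]
  rw [h6, h7, add_zero] at h5
  exact ereal_add_le_cancel (h4 hst) h5

/-- The defect is nonnegative and tends to zero at time zero, because E tends to the initial energy
and the regular solution attains its initial data. Sending s to zero in `hdef` puts it in the form
of Grönwall's inequality. -/
theorem energy_eq (hm : m.Standing) (h₀ : m.IsInitial v₀ E₀)
    (hsol : m.IsEnVarSolution v₀ E₀ v E En) (hEn : Tendsto En (𝓝[>] 0) (𝓝 (m.energy v₀ E₀)))
    (hv : CylExt m.T m.Ω v vb vt vx) (hE : CylExt m.T m.Ω E Eb Et Ex)
    (hdef : ∀ T₁ < m.T, ∃ k : ℝ → ℝ, (∀ t, 0 ≤ k t) ∧ Integrable k m.μT ∧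
      ∀ᵐ s ∂m.μT, ∀ᵐ t ∂m.μT, s < t → t < T₁ →
      (En t - m.energy (v t) (E t)) - (En s - m.energy (v s) (E s))
        ≤ ∫ τ in s..t, k τ * (En τ - m.energy (v τ) (E τ))) :
    ∀ᵐ t ∂m.μT, En t = m.energy (v t) (E t) := by
  obtain ⟨c, hc, hce⟩ := exists_energy_eq_continuous hm hv hE
  set e : ℝ → ℝ := fun t => En t - m.energy (v t) (E t) with he
  have hT : ∀ᵐ t ∂m.μT, t ∈ Ioo 0 m.T := ae_restrict_mem measurableSet_Ioo
  have he0 : ∀ᵐ t ∂m.μT, 0 ≤ e t := hsol.energy_le.mono fun t ht => sub_nonneg.2 ht.2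
  have hem : AEStronglyMeasurable e m.μT := by
    have h1 : AEMeasurable En m.μT :=
      hsol.En_bv.aemeasurable_restrict_Icc.mono_measure
        (Measure.restrict_mono Ioo_subset_Icc_self le_rfl)
    refine (h1.aestronglyMeasurable.sub hc.aestronglyMeasurable).congr ?_
    filter_upwards [hT] with t ht
    simp only [he, Pi.sub_apply, hce t (Ioo_subset_Icc_self ht)]
  -- Bounded variation bounds E, so the defect times the integrable weight is integrable.
  obtain ⟨C, hC⟩ : ∃ C, ∀ t ∈ Icc 0 m.T, ‖e t‖ ≤ C := by
    obtain ⟨C₁, hC₁⟩ := isCompact_Icc.exists_bound_of_continuousOn (s := Icc 0 m.T) hc.continuousOn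
    have h0 : (0 : ℝ) ∈ Icc 0 m.T := ⟨le_rfl, hm.T_pos.le⟩
    refine ⟨‖En 0‖ + (eVariationOn En (Icc 0 m.T)).toReal + C₁, fun t ht => ?_⟩
    have h1 := hsol.En_bv.dist_le ht h0
    have h2 := hC₁ t ht
    rw [dist_eq_norm] at h1
    have h3 : ‖En t‖ ≤ ‖En 0‖ + ‖En t - En 0‖ := by
      simpa using norm_add_le (En 0) (En t - En 0)
    simp only [he, hce t ht]
    exact (norm_sub_le _ _).trans (by linarith)
  have hlim : Tendsto e (𝓝[>] 0) (𝓝 0) := by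
    have h1 : Tendsto c (𝓝[>] 0) (𝓝 (c 0)) := (hc.tendsto 0).mono_left nhdsWithin_le_nhds
    rw [energy_initial hm h₀ hsol hv hE, hce 0 ⟨le_rfl, hm.T_pos.le⟩] at hEn
    have h2 := hEn.sub h1
    rw [sub_self] at h2
    refine h2.congr' ?_
    filter_upwards [Ioo_mem_nhdsGT hm.T_pos] with t ht
    simp only [he, hce t (Ioo_subset_Icc_self ht)]
  have key : ∀ T₁ < m.T, ∀ᵐ t ∂volume.restrict (Ioo 0 T₁), e t = 0 := by
    intro T₁ hT₁
    obtain ⟨k, hk0, hk, hke⟩ := hdef T₁ hT₁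
    have hsub : Ioo 0 T₁ ⊆ Ioo 0 m.T := Ioo_subset_Ioo_right hT₁.le
    have hle : volume.restrict (Ioo 0 T₁) ≤ m.μT := Measure.restrict_mono hsub le_rfl
    have hki : Integrable (fun t => k t * e t) m.μT := by
      refine hk.mul_bdd (c := C) hem ?_
      filter_upwards [hT] with t ht using hC t (Ioo_subset_Icc_self ht)
    refine ae_eq_zero_of_le_integral hk0 (hk.mono_measure hle) (hki.mono_measure hle)
      (ae_mono hle he0) ?_
    have := neBot_nhdsGT_inf_ae
    rw [μT, ae_restrict_iff' measurableSet_Ioo] at hke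
    -- The inequality is available only for almost every s; a sequence of such times tending to zero
    -- gives a common null set of exceptional t.
    have hfreq : ∃ s : ℕ → ℝ, (∀ n, s n ∈ Ioo 0 m.T ∧ ∀ᵐ t ∂m.μT, s n < t → t < T₁ →
        e t - e (s n) ≤ ∫ τ in (s n)..t, k τ * e τ) ∧ Tendsto s atTop (𝓝[>] 0) := by
      have hev : ∀ᶠ s in 𝓝[>] 0 ⊓ ae volume, s ∈ Ioo 0 m.T ∧ ∀ᵐ t ∂m.μT, s < t → t < T₁ →
          e t - e s ≤ ∫ τ in s..t, k τ * e τ := by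
        have h1 : ∀ᶠ s in 𝓝[>] (0 : ℝ) ⊓ ae volume, s ∈ Ioo 0 m.T :=
          Filter.Eventually.filter_mono inf_le_left (Ioo_mem_nhdsGT hm.T_pos)
        have h2 := Filter.Eventually.filter_mono
          (inf_le_right : 𝓝[>] (0 : ℝ) ⊓ ae volume ≤ ae volume) hke
        filter_upwards [h1, h2] with s hs hs' using ⟨hs, hs' hs⟩
      have hf : ∃ᶠ s in 𝓝[>] (0 : ℝ), s ∈ Ioo 0 m.T ∧ ∀ᵐ t ∂m.μT, s < t → t < T₁ →
          e t - e s ≤ ∫ τ in s..t, k τ * e τ :=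
        Filter.Frequently.filter_mono hev.frequently inf_le_left
      obtain ⟨s, hs, hs'⟩ := Filter.exists_seq_forall_of_frequently hf
      exact ⟨s, hs', hs⟩
    obtain ⟨s, hs, hslim⟩ := hfreq
    have hall := ae_mono hle (ae_all_iff.2 fun n => (hs n).2)
    have hke0 : ∀ᵐ τ ∂m.μT, 0 ≤ k τ * e τ := he0.mono fun τ hτ => mul_nonneg (hk0 τ) hτ
    filter_upwards [hall, ae_restrict_mem measurableSet_Ioo] with t ht htI
    have hlt : ∀ᶠ n in atTop, s n < t :=
      (tendsto_nhds_of_tendsto_nhdsWithin hslim).eventually (gt_mem_nhds htI.1)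
    have hlim' := (hlim.comp hslim).add_const (∫ τ in 0..t, k τ * e τ)
    rw [zero_add] at hlim'
    refine ge_of_tendsto hlim' ?_
    filter_upwards [hlt] with n hn
    have h1 := ht n hn htI.2
    have h2 : ∫ τ in (s n)..t, k τ * e τ ≤ ∫ τ in 0..t, k τ * e τ := by
      rw [intervalIntegral.integral_of_le hn.le, intervalIntegral.integral_of_le htI.1.le]
      have hs1 : Ioc 0 t ⊆ Ioo 0 m.T := fun τ hτ => ⟨hτ.1, hτ.2.trans_lt (htI.2.trans hT₁)⟩
      refine setIntegral_mono_set (hki.mono_measure (Measure.restrict_mono hs1 le_rfl))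
        (ae_mono (Measure.restrict_mono hs1 le_rfl) hke0) ?_
      exact (Ioc_subset_Ioc_left (hs n).1.1.le).eventuallyLE
    simp only [Function.comp_apply]
    linarith
  -- The weight depends on `T₁`, hence the exhaustion of (0,T) by countably many intervals.
  have hcover : ∀ᵐ t ∂(volume : Measure ℝ), ∀ n : ℕ, t ∈ Ioo 0 (m.T - 1 / ((n : ℝ) + 1)) →
      e t = 0 := by
    refine ae_all_iff.2 fun n => ?_
    rw [← ae_restrict_iff' measurableSet_Ioo]
    exact key _ (by have : (0 : ℝ) < 1 / ((n : ℝ) + 1) := by positivity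
                    linarith)
  rw [μT, ae_restrict_iff' measurableSet_Ioo]
  filter_upwards [hcover] with t ht htT
  obtain ⟨n, hn⟩ := exists_nat_one_div_lt (sub_pos.2 htT.2)
  exact sub_eq_zero.1 (ht n ⟨htT.1, by linarith⟩)

end Model

/-! ### The weak form of the momentum equation -/

namespace Model

variable {m : Model} {v : ℝ → V → V} {vb vt : ℝ × V → V} {vx : ℝ × V → V →L[ℝ] V}
  {E : ℝ → V → SymMat} {Eb Et : ℝ × V → SymMat} {Ex : ℝ × V → V →L[ℝ] SymMat}
  {v₀ : V → V} {E₀ : V → SymMat} {En : ℝ → ℝ}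

/-- The variational inequality satisfied by a regular solution on `(s,t)`. -/
def VariationalInequality (m : Model) (E : ℝ → V → SymMat)
    (vb vt : ℝ × V → V) (vx : ℝ × V → V →L[ℝ] V)
    (Eb Et : ℝ × V → SymMat) (Ex : ℝ × V → V →L[ℝ] SymMat) (s t : ℝ) : Prop :=
  ∀ (p : ℝ → V → V) (pb pt : ℝ × V → V) (px : ℝ × V → V →L[ℝ] V)
    (Q : ℝ → V → SymMat) (Qb Qt : ℝ × V → SymMat) (Qx : ℝ × V → V →L[ℝ] SymMat),
    m.IsTestPair p Q → CylExt m.T m.Ω p pb pt px → CylExt m.T m.Ω Q Qb Qt Qx →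
    ((∫ τ in s..t, ((∫ x in m.Ω, m.reducedDensity vb vt vx Eb Et Ex pb px Qb (τ, x))
          + ∫ x in m.Ω, ⟪m.f τ x, pb (τ, x)⟫) : ℝ) : EReal)
      + ((∫⁻ τ in Ioc s t, m.stressPotential E τ : ℝ≥0∞) : EReal)
    ≤ ((∫⁻ τ in Ioc s t, m.potential (fun x => dev (Q τ x)) : ℝ≥0∞) : EReal)

theorem isTest_add {F : Type*} [NormedAddCommGroup F] [NormedSpace ℝ F] {u w : ℝ → V → F}
    (hm : m.Standing) {ub ut wb wt : ℝ × V → F} {ux wx : ℝ × V → V →L[ℝ] F}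
    (hu : CylExt m.T m.Ω u ub ut ux) (hw : CylExt m.T m.Ω w wb wt wx) (hut : m.IsTest u)
    (hwt : m.IsTest w) : m.IsTest fun τ x => u τ x + w τ x := by
  obtain ⟨-, T₁, h1, h2⟩ := hut
  obtain ⟨-, T₂, h3, h4⟩ := hwt
  refine isTest_of_cylExt hm (hu.add hw) (max_lt h1 h3) fun t ht x hx => ?_
  rw [h2 t ((le_max_left _ _).trans ht) x hx, h4 t ((le_max_right _ _).trans ht) x hx, add_zero]

/-- With zero defect the weight term vanishes whatever the weight is, so v + p may be tested with
arbitrary p and Q. -/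
theorem variational_inequality (hm : m.Standing)
    (hv : CylExt m.T m.Ω v vb vt vx)
    (hbd : ∀ t ∈ Ioo 0 m.T, m.TestBoundary (v t))
    {K : (closure m.Ω → V) → (closure m.Ω → SymMat) → ℝ≥0}
    (hred : ∀ᵐ s ∂m.μT, ∀ᵐ t ∂m.μT, s < t → m.ReducedInequality K v E En vb vt vx Eb Et Ex s t)
    (he : ∀ᵐ t ∂m.μT, En t = m.energy (v t) (E t)) :
    ∀ᵐ s ∂m.μT, ∀ᵐ t ∂m.μT, s < t → m.VariationalInequality E vb vt vx Eb Et Ex s t := by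
  have hT : ∀ᵐ t ∂m.μT, t ∈ Ioo 0 m.T := ae_restrict_mem measurableSet_Ioo
  filter_upwards [hred, hT, he] with s h1 hs hes
  filter_upwards [h1, hT, he] with t h2 ht het hst p pb pt px Q Qb Qt Qx hpQ hp hQ
  -- The midpoint between t and the final time leaves room on both sides: the cut-off is one
  -- slightly beyond t.
  obtain ⟨η, hη, hη1, T₂, hT₂, hη0⟩ := exists_time_cutoff (T₁ := (t + m.T) / 2) (T := m.T)
    (by linarith [ht.2])
  have htest : m.IsTestPair (fun τ x => η τ • v τ x + p τ x) Q :=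
    ⟨isTest_add hm (hv.time_smul hη) hp (isTest_time_smul hm hv hη hT₂ hη0) hpQ.1, hpQ.2.1,
      fun τ hτ => ((hbd τ hτ).const_smul _).add (hpQ.2.2 τ hτ)⟩
  have h3 := h2 hst ((t + m.T) / 2) (by linarith [ht.2]) (by linarith [ht.2]) _ p pb pt px Q Qb Qt
    Qx htest hp hQ (fun τ hτ x _ => by rw [hη1 τ hτ.2.le, one_smul])
  have h4 : ∫ τ in s..t, (K ((closure m.Ω).domRestrict fun x => η τ • v τ x + p τ x)
      ((closure m.Ω).domRestrict (Q τ)) : ℝ) * (En τ - m.energy (v τ) (E τ)) = 0 := by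
    rw [intervalIntegral.integral_of_le hst.le]
    refine integral_eq_zero_of_ae ?_
    have hsub : Ioc s t ⊆ Ioo 0 m.T := fun τ hτ => ⟨hs.1.trans hτ.1, hτ.2.trans_lt ht.2⟩
    refine ae_mono (Measure.restrict_mono hsub le_rfl) (he.mono fun τ hτ => ?_)
    simp only [hτ, sub_self, mul_zero, Pi.zero_apply]
  rw [h4, het, hes, sub_self, sub_self, sub_self, zero_add, EReal.coe_zero, add_zero] at h3
  exact h3

/-- With Q = Dφ(𝔼) on (s,t) only a term linear in p survives, and it is nonpositive for p and for
-p. -/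
theorem weak_momentum (hm : m.Standing)
    (hE : CylExt m.T m.Ω E Eb Et Ex)
    (hfin : ∀ᵐ s ∂m.μT, ∀ᵐ t ∂m.μT, s < t → ∫⁻ τ in Ioc s t, m.stressPotential E τ ≠ ∞)
    (hvi : ∀ᵐ s ∂m.μT, ∀ᵐ t ∂m.μT, s < t → m.VariationalInequality E vb vt vx Eb Et Ex s t) :
    ∀ᵐ s ∂m.μT, ∀ᵐ t ∂m.μT, s < t → ∀ (p : ℝ → V → V) (pb pt : ℝ × V → V)
      (px : ℝ × V → V →L[ℝ] V), m.IsTest p → (∀ t ∈ Ioo 0 m.T, m.TestBoundary (p t)) →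
      CylExt m.T m.Ω p pb pt px →
      ∫ τ in s..t, ((∫ x in m.Ω, m.reducedMomentum (vb (τ, x)) (vt (τ, x)) (vx (τ, x)) (Eb (τ, x))
        (pb (τ, x)) (px (τ, x))) + ∫ x in m.Ω, ⟪m.f τ x, pb (τ, x)⟫) = 0 := by
  have hT : ∀ᵐ t ∂m.μT, t ∈ Ioo 0 m.T := ae_restrict_mem measurableSet_Ioo
  have hB := hE.comp_contDiff (contDiff_gradSym hm.φ_smooth)
  filter_upwards [hvi, hfin] with s h1 h1'
  filter_upwards [h1, h1', hT] with t h2 h2' ht hst p pb pt px hpt hpb hp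
  obtain ⟨η, hη, hη1, T₂, hT₂, hη0⟩ := exists_time_cutoff ht.2
  set M : (ℝ × V → V) → (ℝ × V → V →L[ℝ] V) → ℝ → ℝ := fun pb px τ =>
    (∫ x in m.Ω, m.reducedMomentum (vb (τ, x)) (vt (τ, x)) (vx (τ, x)) (Eb (τ, x))
        (pb (τ, x)) (px (τ, x))) + ∫ x in m.Ω, ⟪m.f τ x, pb (τ, x)⟫ with hM
  have key : ∀ (p : ℝ → V → V) (pb pt : ℝ × V → V)
      (px : ℝ × V → V →L[ℝ] V), m.IsTest p → (∀ t ∈ Ioo 0 m.T, m.TestBoundary (p t)) →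
      CylExt m.T m.Ω p pb pt px → ∫ τ in s..t, M pb px τ ≤ 0 := by
    intro p pb pt px hpt hpb hp
    have h3 := h2 hst p pb pt px _ _ _ _
      ⟨hpt, isTest_time_smul hm hB hη hT₂ hη0, hpb⟩ hp (hB.time_smul hη)
    have h6 : ∫⁻ τ in Ioc s t, m.potential (fun x => dev (η τ • gradSym m.φ (E τ x)))
        = ∫⁻ τ in Ioc s t, m.stressPotential E τ :=
      setLIntegral_congr_fun measurableSet_Ioc fun τ hτ => by
        simp only [stressPotential, hη1 τ hτ.2, one_smul]
    have h7 : ∫ τ in s..t, ((∫ x in m.Ω, m.reducedDensity vb vt vx Eb Et Ex pb px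
          (fun z => η z.1 • gradSym m.φ (Eb z)) (τ, x)) + ∫ x in m.Ω, ⟪m.f τ x, pb (τ, x)⟫)
        = ∫ τ in s..t, M pb px τ := by
      refine intervalIntegral.integral_congr fun τ hτ => ?_
      rw [uIcc_of_le hst.le] at hτ
      simp [reducedDensity, hη1 τ hτ.2, frob_zero_right, hM]
    rw [h6, h7] at h3
    refine ereal_add_le_cancel (h2' hst) (h3.trans (le_of_eq ?_))
    rw [EReal.coe_zero, add_zero]
  refine le_antisymm (key p pb pt px hpt hpb hp) ?_
  have h8 := key _ _ _ _ (by
      obtain ⟨-, T', hT', h0⟩ := hpt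
      exact isTest_of_cylExt hm (hp.const_smul (-1)) hT' fun t ht x hx => by
        rw [h0 t ht x hx, smul_zero]) (fun t ht => (hpb t ht).const_smul (-1)) (hp.const_smul (-1))
  have h9 : ∀ τ, M (fun z => (-1 : ℝ) • pb z) (fun z => (-1 : ℝ) • px z) τ = -M pb px τ := by
    intro τ
    simp only [hM, neg_add]
    rw [← integral_neg, ← integral_neg]
    congr 1
    · refine integral_congr_ae (ae_of_all _ fun x => ?_)
      have e1 : strainRate ((-1 : ℝ) • px (τ, x)) = (-1 : ℝ) • strainRate (px (τ, x)) :=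
        strainRateL.map_smul _ _
      simp only [reducedMomentum, e1, divg_smul, inner_smul_right, smul_apply, map_smul,
        frob_smul_right]
      ring
    · refine integral_congr_ae (ae_of_all _ fun x => ?_)
      simp only [inner_smul_right]
      ring
  simp only [h9, intervalIntegral.integral_neg] at h8
  linarith

end Model

/-! ### The strong form of the momentum equation -/

/-- The action of a symmetric matrix on a vector, as a continuous bilinear map. -/
def actL : SymMat →L[ℝ] V →L[ℝ] V :=
  LinearMap.toContinuousBilinearMap
    (LinearMap.mk₂ ℝ (fun (A : SymMat) (p : V) => (WithLp.toLp 2 ((A : Mat).mulVec p.ofLp) : V))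
      (fun A B p => by simp [Matrix.add_mulVec])
      (fun c A p => by simp [Matrix.smul_mulVec])
      (fun A p q => by simp [Matrix.mulVec_add])
      (fun c A p => by simp [Matrix.mulVec_smul]))

theorem actL_apply (A : SymMat) (p : V) :
    actL A p = WithLp.toLp 2 ((A : Mat).mulVec p.ofLp) := rfl

/-- The divergence of a field of symmetric matrices, as a function of its derivative. -/
def symDiv : (V →L[ℝ] SymMat) →L[ℝ] V := LinearMap.toContinuousLinearMap
  { toFun := fun D => WithLp.toLp 2 fun i => ∑ j, (D (EuclideanSpace.single j 1) : Mat) i j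
    map_add' := fun A B => by
      ext i
      simp [Finset.sum_add_distrib]
    map_smul' := fun c A => by
      ext i
      simp [Finset.mul_sum] }

theorem symDiv_apply (D : V →L[ℝ] SymMat) :
    symDiv D = WithLp.toLp 2 fun i => ∑ j, (D (EuclideanSpace.single j 1) : Mat) i j := rfl

/-- The derivative of `x ↦ A(x) p(x)`. -/
def actDeriv (A : SymMat) (DA : V →L[ℝ] SymMat) (p : V) (Dp : V →L[ℝ] V) : V →L[ℝ] V :=
  (actL A).comp Dp + (actL.flip p).comp DA

theorem hasFDerivAt_actL {A : V → SymMat} {DA : V →L[ℝ] SymMat} {p : V → V} {Dp : V →L[ℝ] V}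
    {x : V} (hA : HasFDerivAt A DA x) (hp : HasFDerivAt p Dp x) :
    HasFDerivAt (fun y => actL (A y) (p y)) (actDeriv (A x) DA (p x) Dp) x := by
  have h1 : HasFDerivAt (fun y => actL (A y)) (actL.comp DA) x := actL.hasFDerivAt.comp x hA
  refine (h1.clm_apply hp).congr_fderiv ?_
  ext e
  simp [actDeriv]

/-- The product rule for the divergence of A p. Symmetry of A replaces the gradient of p by its
symmetric part and identifies row and column divergences. -/
theorem divg_actDeriv (A : SymMat) (DA : V →L[ℝ] SymMat) (p : V) (Dp : V →L[ℝ] V) :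
    divg (actDeriv A DA p Dp) = frob A (strainRate Dp) + ⟪symDiv DA, p⟫ := by
  have h1 : divg ((actL A).comp Dp) = frob A (strainRate Dp) := by
    rw [strainRate, frob_symPart_right A.transpose_eq]
    have hs : ∀ i j, (A : Mat) i j = (A : Mat) j i := fun i j => by
      conv_lhs => rw [← A.transpose_eq]
      rfl
    rw [divg_eq, frob]
    simp only [ContinuousLinearMap.comp_apply, actL_apply, Matrix.mulVec, dotProduct, toMat,
      Matrix.of_apply]
    rw [Finset.sum_comm]
    exact Finset.sum_congr rfl fun i _ => Finset.sum_congr rfl fun j _ => by rw [hs]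
  have h2 : divg ((actL.flip p).comp DA) = ⟪symDiv DA, p⟫ := by
    rw [divg_eq, symDiv_apply, PiLp.inner_apply]
    simp only [ContinuousLinearMap.comp_apply, ContinuousLinearMap.flip_apply, actL_apply,
      Matrix.mulVec, dotProduct]
    rw [Finset.sum_comm]
    refine Finset.sum_congr rfl fun i _ => ?_
    simp only [RCLike.inner_apply, conj_trivial, Finset.mul_sum]
    refine Finset.sum_congr rfl fun j _ => ?_
    have hs : ((DA (EuclideanSpace.single j 1)) : Mat) j i
        = ((DA (EuclideanSpace.single j 1)) : Mat) i j := by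
      conv_lhs => rw [← (DA (EuclideanSpace.single j 1)).transpose_eq]
      rfl
    rw [hs, mul_comm]
  rw [actDeriv, divg_add, h1, h2]

/-- The identity as a symmetric matrix. -/
def SymMat.one : SymMat := SymMat.mk 1 Matrix.transpose_one

namespace Model

variable {m : Model} {v : ℝ → V → V} {vb vt : ℝ × V → V} {vx : ℝ × V → V →L[ℝ] V}
  {E : ℝ → V → SymMat} {Eb Et : ℝ × V → SymMat} {Ex : ℝ × V → V →L[ℝ] SymMat}
  {v₀ : V → V} {E₀ : V → SymMat} {En : ℝ → ℝ}

/-- The elastic stress as a symmetric matrix. -/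
def elasticSym (m : Model) (A : SymMat) : SymMat := gradSym m.φ A + m.φ A • SymMat.one

theorem coe_elasticSym (A : SymMat) : (m.elasticSym A : Mat) = m.elasticStress A := by
  rw [elasticSym, map_add, map_smul]; rfl

theorem contDiff_elasticSym (hm : m.Standing) : ContDiff ℝ 1 m.elasticSym :=
  (contDiff_gradSym hm.φ_smooth).add ((hm.φ_smooth.of_le (by norm_num)).smul contDiff_const)

/-- The total stress, for velocity gradient `G` and elastic strain `A`. -/
def totalStress (m : Model) (G : V →L[ℝ] V) (A : SymMat) : SymMat :=
  m.viscousStress G + m.elasticSym A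

theorem frob_totalStress (G : V →L[ℝ] V) (A : SymMat) (Dp : V →L[ℝ] V) :
    frob (m.totalStress G A) (strainRate Dp)
      = frob (m.viscousStress G + gradSym m.φ A : SymMat) (strainRate Dp)
        + m.φ A * divg Dp := by
  rw [totalStress, elasticSym, ← add_assoc, map_add, frob_add_left, map_smul, frob_smul_left,
    SymMat.one, SymMat.incl_mk, frob_comm 1, frob_one_right, trace_strainRate]

/-- The derivative of the total stress, where `H` is the derivative of the velocity gradient. -/
def stressDeriv (m : Model) (H : V →L[ℝ] V →L[ℝ] V) (A : SymMat) (DA : V →L[ℝ] SymMat) :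
    V →L[ℝ] SymMat :=
  m.viscousStressL.comp H + (fderiv ℝ m.elasticSym A).comp DA

theorem hasFDerivAt_totalStress (hm : m.Standing) {G : V → V →L[ℝ] V} {H : V →L[ℝ] V →L[ℝ] V}
    {A : V → SymMat} {DA : V →L[ℝ] SymMat} {x : V} (hG : HasFDerivAt G H x)
    (hA : HasFDerivAt A DA x) :
    HasFDerivAt (fun y => m.totalStress (G y) (A y)) (m.stressDeriv H (A x) DA) x :=
  (m.viscousStressL.hasFDerivAt.comp x hG).add
    (((contDiff_elasticSym hm).differentiable (by simp) _).hasFDerivAt.comp x hA)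

/-- The residual of the momentum equation without the force. -/
def momentumResidual (m : Model) (v vt : V) (G : V →L[ℝ] V) (H : V →L[ℝ] V →L[ℝ] V) (A : SymMat)
    (DA : V →L[ℝ] SymMat) : V :=
  symDiv (m.stressDeriv H A DA) - (m.ρ / 2 * divg G) • v - m.ρ • (vt + G v)

/-- The derivative of the convective flux `⟪v, p⟫ v`. -/
def convDeriv (v : V) (G : V →L[ℝ] V) (p : V) (Dp : V →L[ℝ] V) : V →L[ℝ] V :=
  ⟪v, p⟫ • G + ((innerSL ℝ v).comp Dp + (innerSL ℝ p).comp G).smulRight v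

theorem hasFDerivAt_conv {u p : V → V} {G Dp : V →L[ℝ] V} {x : V} (hu : HasFDerivAt u G x)
    (hp : HasFDerivAt p Dp x) :
    HasFDerivAt (fun y => ⟪u y, p y⟫ • u y) (convDeriv (u x) G (p x) Dp) x := by
  refine ((hu.inner ℝ hp).smul hu).congr_fderiv ?_
  ext e
  simp [convDeriv, real_inner_comm, fderivInnerCLM_apply]

/-- Derivatives are moved from p onto the solution. The convective flux releases -ρ (div v)⟪v, p⟫,
which reverses the sign of the half-divergence term. -/
theorem reducedMomentum_eq (v vt : V) (G : V →L[ℝ] V) (H : V →L[ℝ] V →L[ℝ] V) (A : SymMat)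
    (DA : V →L[ℝ] SymMat) (p : V) (Dp : V →L[ℝ] V) :
    m.reducedMomentum v vt G A p Dp = ⟪m.momentumResidual v vt G H A DA, p⟫
      + m.ρ * divg (convDeriv v G p Dp)
      - divg (actDeriv (m.totalStress G A) (m.stressDeriv H A DA) p Dp) := by
  rw [divg_actDeriv, frob_totalStress, convDeriv, divg_add, divg_smul, divg_smulRight,
    momentumResidual, reducedMomentum]
  simp only [inner_sub_left, inner_add_left, real_inner_smul_left, add_apply,
    ContinuousLinearMap.comp_apply, innerSL_apply_apply]
  rw [real_inner_comm (G v) p]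
  ring

theorem continuous_actL_comp {Z : Type*} [TopologicalSpace Z] {A : Z → SymMat} {p : Z → V}
    (hA : Continuous A) (hp : Continuous p) : Continuous fun z => actL (A z) (p z) :=
  (actL.continuous.comp hA).clm_apply hp

theorem continuous_actDeriv {Z : Type*} [TopologicalSpace Z] {A : Z → SymMat}
    {DA : Z → V →L[ℝ] SymMat} {p : Z → V} {Dp : Z → V →L[ℝ] V} (hA : Continuous A)
    (hDA : Continuous DA) (hp : Continuous p) (hDp : Continuous Dp) :
    Continuous fun z => actDeriv (A z) (DA z) (p z) (Dp z) :=
  continuous_clm_apply.2 fun _ =>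
    (continuous_actL_comp hA (hDp.clm_apply continuous_const)).add
      (continuous_actL_comp (hDA.clm_apply continuous_const) hp)

theorem continuous_convDeriv {Z : Type*} [TopologicalSpace Z] {u p : Z → V}
    {G Dp : Z → V →L[ℝ] V} (hu : Continuous u) (hG : Continuous G) (hp : Continuous p)
    (hDp : Continuous Dp) : Continuous fun z => convDeriv (u z) (G z) (p z) (Dp z) :=
  continuous_clm_apply.2 fun _ => by
    simp only [convDeriv, add_apply, smul_apply, ContinuousLinearMap.smulRight_apply,
      ContinuousLinearMap.comp_apply, innerSL_apply_apply]
    fun_prop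

theorem continuous_totalStress {Z : Type*} [TopologicalSpace Z] (hm : m.Standing)
    {G : Z → V →L[ℝ] V} {A : Z → SymMat} (hG : Continuous G) (hA : Continuous A) :
    Continuous fun z => m.totalStress (G z) (A z) :=
  (m.viscousStressL.continuous.comp hG).add ((contDiff_elasticSym hm).continuous.comp hA)

theorem continuous_stressDeriv {Z : Type*} [TopologicalSpace Z] (hm : m.Standing)
    {H : Z → V →L[ℝ] V →L[ℝ] V} {A : Z → SymMat} {DA : Z → V →L[ℝ] SymMat} (hH : Continuous H)
    (hA : Continuous A) (hDA : Continuous DA) :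
    Continuous fun z => m.stressDeriv (H z) (A z) (DA z) := by
  have h1 : Continuous fun z => fderiv ℝ m.elasticSym (A z) :=
    ((contDiff_elasticSym hm).continuous_fderiv (by simp)).comp hA
  exact (continuous_const.clm_comp hH).add (h1.clm_comp hDA)

section Strong

variable {H : ℝ × V → V →L[ℝ] V →L[ℝ] V}

theorem continuous_momentumResidual (hm : m.Standing) (hv : CylExt m.T m.Ω v vb vt vx)
    (hE : CylExt m.T m.Ω E Eb Et Ex) (hH : Continuous H) : Continuous fun z =>
      m.momentumResidual (vb z) (vt z) (vx z) (H z) (Eb z) (Ex z) := by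
  have h1 := hv.cont
  have h2 := hv.cont_t
  have h3 := hv.cont_x
  have h4 := symDiv.continuous.comp (continuous_stressDeriv hm hH hE.cont hE.cont_x)
  simp only [Function.comp_def] at h4
  exact (h4.sub (by fun_prop)).sub (by fun_prop)

theorem hasFDerivAt_velocityGradient (hm : m.Standing) (hv : CylExt m.T m.Ω v vb vt vx)
    (hHd : ∀ t ∈ Icc 0 m.T, ∀ x ∈ m.Ω, HasFDerivAt (fderiv ℝ (v t)) (H (t, x)) x)
    {τ : ℝ} (hτ : τ ∈ Ioo 0 m.T) {x : V} (hx : x ∈ m.Ω) :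
    HasFDerivAt (fun y => vx (τ, y)) (H (τ, x)) x :=
  (hHd τ (Ioo_subset_Icc_self hτ) x hx).congr_of_eventuallyEq (by
    filter_upwards [hm.domain.1.mem_nhds hx] with y hy
    exact (hv.hasFDerivAt τ hτ y hy).fderiv.symm)

theorem hasFDerivAt_stress_act (hm : m.Standing) (hv : CylExt m.T m.Ω v vb vt vx)
    (hE : CylExt m.T m.Ω E Eb Et Ex)
    (hHd : ∀ t ∈ Icc 0 m.T, ∀ x ∈ m.Ω, HasFDerivAt (fderiv ℝ (v t)) (H (t, x)) x)
    {τ : ℝ} (hτ : τ ∈ Ioo 0 m.T) {x : V} (hx : x ∈ m.Ω) {p : V → V} {Dp : V →L[ℝ] V}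
    (hp : HasFDerivAt p Dp x) :
    HasFDerivAt (fun y => actL (m.totalStress (vx (τ, y)) (Eb (τ, y))) (p y))
      (actDeriv (m.totalStress (vx (τ, x)) (Eb (τ, x)))
        (m.stressDeriv (H (τ, x)) (Eb (τ, x)) (Ex (τ, x))) (p x) Dp) x :=
  hasFDerivAt_actL (hasFDerivAt_totalStress hm (hasFDerivAt_velocityGradient hm hv hHd hτ hx)
    (hE.hasFDerivAt_ext hm.domain.1 hτ hx)) hp

theorem continuous_divg_stress (hm : m.Standing) (hv : CylExt m.T m.Ω v vb vt vx)
    (hE : CylExt m.T m.Ω E Eb Et Ex) (hH : Continuous H) {p : ℝ × V → V} {Dp : ℝ × V → V →L[ℝ] V}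
    (hp : Continuous p) (hDp : Continuous Dp) :
    Continuous fun z => actDeriv (m.totalStress (vx z) (Eb z))
        (m.stressDeriv (H z) (Eb z) (Ex z)) (p z) (Dp z) :=
  continuous_actDeriv (continuous_totalStress hm hv.cont_x hE.cont)
    (continuous_stressDeriv hm hH hE.cont hE.cont_x) hp hDp

/-- The convective flux ⟪v, p⟫ v is tangential for any p, so the stress flux is the only boundary
contribution; p need not satisfy a boundary condition yet. -/
theorem integral_reducedMomentum (hm : m.Standing) (hv : CylExt m.T m.Ω v vb vt vx)
    (hE : CylExt m.T m.Ω E Eb Et Ex) (hH : Continuous H)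
    {τ : ℝ} (hτ : τ ∈ Ioo 0 m.T)
    (hbc : ∀ᵐ x ∂surf.restrict (frontier m.Ω), ∀ n, IsOuterNormal m.Ω x n → ⟪v τ x, n⟫ = 0)
    {p : V → V} {Dp : V → V →L[ℝ] V} (hp : Continuous p) (hDp : Continuous Dp)
    (hpd : ∀ x ∈ m.Ω, HasFDerivAt p (Dp x) x) :
    ∫ x in m.Ω, m.reducedMomentum (vb (τ, x)) (vt (τ, x)) (vx (τ, x)) (Eb (τ, x)) (p x) (Dp x)
      = (∫ x in m.Ω, ⟪m.momentumResidual (vb (τ, x)) (vt (τ, x)) (vx (τ, x)) (H (τ, x)) (Eb (τ, x))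
          (Ex (τ, x)), p x⟫)
        - ∫ x in m.Ω, divg (actDeriv (m.totalStress (vx (τ, x)) (Eb (τ, x)))
          (m.stressDeriv (H (τ, x)) (Eb (τ, x)) (Ex (τ, x))) (p x) (Dp x)) := by
  have hb := isBounded_domain hm
  have e1 := hv.cont
  have e2 := hv.cont_x
  have hτI := Ioo_subset_Icc_self hτ
  have hc : Continuous fun x : V => (τ, x) := by fun_prop
  have c1 : Continuous fun x => convDeriv (vb (τ, x)) (vx (τ, x)) (p x) (Dp x) :=
    continuous_convDeriv (e1.comp hc) (e2.comp hc) hp hDp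
  have h1 : ∫ x in m.Ω, divg (convDeriv (vb (τ, x)) (vx (τ, x)) (p x) (Dp x)) = 0 := by
    refine integral_divg_eq_zero hm.domain (X := fun x => ⟪vb (τ, x), p x⟫ • vb (τ, x))
      (by fun_prop) c1
      (fun x hx => hasFDerivAt_conv (hv.hasFDerivAt_ext hm.domain.1 hτ hx) (hpd x hx)) ?_
    filter_upwards [hbc, ae_restrict_mem isClosed_frontier.measurableSet] with x hx hxf n hn
    rw [real_inner_smul_left, ← hv.eqOn τ hτI x (frontier_subset_closure hxf), hx n hn, mul_zero]
  have c2 : Continuous fun x => ⟪m.momentumResidual (vb (τ, x)) (vt (τ, x)) (vx (τ, x)) (H (τ, x))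
      (Eb (τ, x)) (Ex (τ, x)), p x⟫ :=
    ((continuous_momentumResidual hm hv hE hH).comp hc).inner hp
  have c3 := continuous_divg_comp ((continuous_divg_stress hm hv hE hH
    (hp.comp continuous_snd) (hDp.comp continuous_snd)).comp hc)
  simp only [Function.comp_def] at c3
  have i1 := integrableOn_of_continuous (μ := volume) hb c2
  have i2 := integrableOn_of_continuous (μ := volume) hb (continuous_divg_comp c1)
  have i3 := integrableOn_of_continuous (μ := volume) hb c3
  have i4 : Integrable (fun x => m.ρ * divg (convDeriv (vb (τ, x)) (vx (τ, x)) (p x) (Dp x)))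
      (volume.restrict m.Ω) := i2.const_mul _
  have key := integral_add (i1.sub i3) i4
  simp only [Pi.sub_apply] at key
  rw [← integral_sub i1 i3, ← add_zero (∫ x in m.Ω, (_ : ℝ) - _), ← mul_zero m.ρ, ← h1,
    ← integral_const_mul, ← key]
  refine integral_congr_ae (ae_of_all _ fun x => ?_)
  simp only [reducedMomentum_eq (H := H (τ, x)) (DA := Ex (τ, x))]
  ring

theorem integral_divg_stress_eq_zero (hm : m.Standing) (hv : CylExt m.T m.Ω v vb vt vx)
    (hE : CylExt m.T m.Ω E Eb Et Ex) (hH : Continuous H)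
    (hHd : ∀ t ∈ Icc 0 m.T, ∀ x ∈ m.Ω, HasFDerivAt (fderiv ℝ (v t)) (H (t, x)) x)
    {τ : ℝ} (hτ : τ ∈ Ioo 0 m.T) {p : V → V} {Dp : V → V →L[ℝ] V} (hp : Continuous p)
    (hDp : Continuous Dp) (hpd : ∀ x ∈ m.Ω, HasFDerivAt p (Dp x) x)
    (h0 : ∀ x ∈ frontier m.Ω, p x = 0) :
    ∫ x in m.Ω, divg (actDeriv (m.totalStress (vx (τ, x)) (Eb (τ, x)))
      (m.stressDeriv (H (τ, x)) (Eb (τ, x)) (Ex (τ, x))) (p x) (Dp x)) = 0 := by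
  have hc : Continuous fun x : V => (τ, x) := by fun_prop
  refine integral_divg_eq_zero hm.domain
    (X := fun x => actL (m.totalStress (vx (τ, x)) (Eb (τ, x))) (p x))
    (continuous_actL_comp ((continuous_totalStress hm hv.cont_x hE.cont).comp hc) hp)
    ((continuous_divg_stress hm hv hE hH (hp.comp continuous_snd) (hDp.comp continuous_snd)).comp hc)
    (fun x hx => hasFDerivAt_stress_act hm hv hE hHd hτ hx (hpd x hx)) ?_
  filter_upwards [ae_restrict_mem isClosed_frontier.measurableSet] with x hx n hn
  rw [h0 x hx, map_zero, inner_zero_left]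

end Strong

end Model

/-! ### Localization of the momentum equation in space-time -/

theorem exists_mem_Ioo_of_ae {T a b : ℝ} {P : ℝ → Prop}
    (h : ∀ᵐ s ∂volume.restrict (Ioo 0 T), P s) (ha : 0 ≤ a) (hab : a < b) (hb : b ≤ T) :
    ∃ s ∈ Ioo a b, P s := by
  by_contra! hne
  have h1 : ∀ᵐ s ∂volume.restrict (Ioo a b), P s :=
    ae_mono (Measure.restrict_mono (Ioo_subset_Ioo ha hb) le_rfl) h
  have h2 : ∀ᵐ s ∂volume.restrict (Ioo a b), False := by
    filter_upwards [h1, ae_restrict_mem measurableSet_Ioo] with s hs hs' using hne s hs' hs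
  rw [ae_iff] at h2
  simp only [not_false_eq_true, ofPred_true, Measure.restrict_apply_univ, Real.volume_Ioo,
    ENNReal.ofReal_eq_zero] at h2
  linarith

namespace Model

variable {m : Model} {v : ℝ → V → V} {vb vt : ℝ × V → V} {vx : ℝ × V → V →L[ℝ] V}
  {E : ℝ → V → SymMat} {Eb Et : ℝ × V → SymMat} {Ex : ℝ × V → V →L[ℝ] SymMat}
  {v₀ : V → V} {E₀ : V → SymMat} {En : ℝ → ℝ} {H : ℝ × V → V →L[ℝ] V →L[ℝ] V}

/-- The conclusion of the weak momentum equation on `(s,t)`. -/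
def WeakMomentum (m : Model) (vb vt : ℝ × V → V) (vx : ℝ × V → V →L[ℝ] V) (Eb : ℝ × V → SymMat)
    (s t : ℝ) : Prop :=
  ∀ (p : ℝ → V → V) (pb pt : ℝ × V → V)
      (px : ℝ × V → V →L[ℝ] V), m.IsTest p → (∀ t ∈ Ioo 0 m.T, m.TestBoundary (p t)) →
      CylExt m.T m.Ω p pb pt px →
      ∫ τ in s..t, ((∫ x in m.Ω, m.reducedMomentum (vb (τ, x)) (vt (τ, x)) (vx (τ, x)) (Eb (τ, x))
        (pb (τ, x)) (px (τ, x))) + ∫ x in m.Ω, ⟪m.f τ x, pb (τ, x)⟫) = 0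

theorem exists_Icc_of_isCompact {T : ℝ} (hT : 0 < T) {K : Set ℝ} (hK : IsCompact K)
    (hKT : K ⊆ Ioo 0 T) : ∃ a b, 0 < a ∧ a ≤ b ∧ b < T ∧ K ⊆ Icc a b := by
  -- The added point only guarantees that the extrema exist when `K` is empty.
  have hK' : IsCompact (insert (T / 2) K) := hK.insert _
  have hsub : insert (T / 2) K ⊆ Ioo 0 T := insert_subset ⟨by linarith, by linarith⟩ hKT
  obtain ⟨a, ha⟩ := hK'.exists_isLeast (insert_nonempty _ _)
  obtain ⟨b, hb⟩ := hK'.exists_isGreatest (insert_nonempty _ _)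
  exact ⟨a, b, (hsub ha.1).1, ha.2 hb.1, (hsub hb.1).2,
    fun x hx => ⟨ha.2 (mem_insert_of_mem _ hx), hb.2 (mem_insert_of_mem _ hx)⟩⟩

theorem integral_test_momentum (hm : m.Standing) (hv : CylExt m.T m.Ω v vb vt vx)
    (hE : CylExt m.T m.Ω E Eb Et Ex) (hH : Continuous H)
    (hHd : ∀ t ∈ Icc 0 m.T, ∀ x ∈ m.Ω, HasFDerivAt (fderiv ℝ (v t)) (H (t, x)) x)
    (hbd : ∀ t ∈ Ioo 0 m.T, m.TestBoundary (v t))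
    (hw : ∀ᵐ s ∂m.μT, ∀ᵐ t ∂m.μT, s < t → m.WeakMomentum vb vt vx Eb s t)
    {g : ℝ × V → ℝ} (hg : ContDiff ℝ 1 g) (hgc : HasCompactSupport g)
    (hgs : tsupport g ⊆ Ioo 0 m.T ×ˢ m.Ω) (e : V) :
    ∫ z in Ioo 0 m.T ×ˢ m.Ω, ⟪m.momentumResidual (vb z) (vt z) (vx z) (H z) (Eb z) (Ex z)
      + m.f z.1 z.2, g z • e⟫ = 0 := by
  have hb := isBounded_domain hm
  obtain ⟨a, b, ha, hab, hbT, hKab⟩ := exists_Icc_of_isCompact hm.T_pos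
    (hgc.image continuous_fst) (by rintro _ ⟨z, hz, rfl⟩; exact (hgs hz).1)
  have hg0 : ∀ τ x, τ ∉ Icc a b → g (τ, x) = 0 := fun τ x hτ =>
    image_eq_zero_of_notMem_tsupport fun hz => hτ (hKab ⟨_, hz, rfl⟩)
  have hg0' : ∀ τ x, x ∉ m.Ω → g (τ, x) = 0 := fun τ x hx =>
    image_eq_zero_of_notMem_tsupport fun hz => hx (hgs hz).2
  have hpC : ContDiff ℝ 1 (fun z => g z • e) := hg.smul contDiff_const
  have hp : CylExt m.T m.Ω (fun τ x => g (τ, x) • e) (fun z => g z • e) _ _ :=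
    HasC1Ext.cylExt hm.T_pos (D := fderiv ℝ fun z => g z • e) ⟨hpC.continuous,
      hpC.continuous_fderiv (by simp), fun _ _ => rfl,
      fun x _ => (hpC.differentiable (by simp) x).hasFDerivAt⟩
  have hΩx : ∀ x ∈ frontier m.Ω, x ∉ m.Ω := fun x hx hxΩ =>
    (hm.domain.1.inter_frontier_eq ▸ ⟨hxΩ, hx⟩ : x ∈ (∅ : Set V))
  have hpbd : ∀ t ∈ Ioo 0 m.T, m.TestBoundary fun x => g (t, x) • e := fun t _ => by
    refine ⟨?_, ?_⟩
    · filter_upwards [ae_restrict_mem hm.ΓD_meas] with x hx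
      rw [hg0' t x (hΩx x (hm.ΓD_subset hx)), zero_smul]
    · filter_upwards [ae_restrict_mem (measurableSet_ΓN hm)] with x hx n _
      rw [hg0' t x (hΩx x hx.1), zero_smul, inner_zero_left]
  have hptest : m.IsTest fun τ x => g (τ, x) • e :=
    isTest_of_cylExt hm hp (T' := (b + m.T) / 2) (by linarith) fun t ht x _ => by
      rw [hg0 t x fun h => by linarith [h.2], zero_smul]
  -- Admissible end points are chosen before and after the time support [a,b] of the test function,
  -- so that nothing is lost outside (s,t).
  obtain ⟨s, hs, hs'⟩ := exists_mem_Ioo_of_ae hw le_rfl ha (by linarith)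
  obtain ⟨t, ht, ht'⟩ := exists_mem_Ioo_of_ae hs' (by linarith) hbT le_rfl
  have hst : s < t := by linarith [hs.2, ht.1]
  have h1 := ht' hst _ _ _ _ hptest hpbd hp
  set R : ℝ × V → V := fun z => m.momentumResidual (vb z) (vt z) (vx z) (H z) (Eb z) (Ex z)
    with hR
  have hRc : Continuous R := continuous_momentumResidual hm hv hE hH
  have hint : Integrable (fun z : ℝ × V => ⟪R z + m.f z.1 z.2, g z • e⟫) (m.μT.prod m.μΩ) := by
    have i1 : Integrable (fun z => ⟪R z, g z • e⟫) (m.μT.prod m.μΩ) :=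
      integrable_prod_of_continuous hb (Metric.isBounded_Ioo 0 m.T)
        (hRc.inner hpC.continuous)
    refine (i1.add (integrable_force_inner hm hpC.continuous)).congr (ae_of_all _ fun z => ?_)
    simp only [Pi.add_apply, inner_add_left]
  have hvol : volume.restrict (Ioo 0 m.T ×ˢ m.Ω) = m.μT.prod m.μΩ := by
    rw [μT, μΩ, Measure.prod_restrict]; rfl
  rw [hvol, integral_prod _ hint]
  have hsub : Ioc s t ⊆ Ioo 0 m.T := fun τ hτ => ⟨hs.1.trans hτ.1, hτ.2.trans_lt ht.2⟩
  have h2 : ∫ τ, (∫ x, ⟪R (τ, x) + m.f τ x, g (τ, x) • e⟫ ∂m.μΩ) ∂m.μT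
      = ∫ τ in Ioc s t, ∫ x, ⟪R (τ, x) + m.f τ x, g (τ, x) • e⟫ ∂m.μΩ := by
    refine setIntegral_eq_of_subset_of_forall_sdiff_eq_zero measurableSet_Ioo hsub fun τ hτ => ?_
    have : ∀ x, g (τ, x) = 0 := fun x => hg0 τ x fun h => hτ.2
      ⟨hs.2.trans_le h.1, h.2.trans ht.1.le⟩
    simp [this]
  rw [h2, ← h1, intervalIntegral.integral_of_le hst.le]
  have hf := (integrable_force_inner hm hpC.continuous).prod_right_ae
  rw [μT, ae_restrict_iff' measurableSet_Ioo] at hf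
  refine setIntegral_congr_ae measurableSet_Ioc ?_
  filter_upwards [hf] with τ hfτ hτ
  have hτT := hsub hτ
  have hcx : Continuous fun x : V => (τ, x) := by fun_prop
  have hpx := hp.cont_x.comp hcx
  simp only [Function.comp_def] at hpx
  have hpb : Continuous fun x => g (τ, x) • e := hpC.continuous.comp hcx
  have hpd : ∀ x ∈ m.Ω, HasFDerivAt (fun y => g (τ, y) • e)
      ((fderiv ℝ (fun z => g z • e) (τ, x)).comp (ContinuousLinearMap.inr ℝ ℝ V)) x :=
    fun x hx => hp.hasFDerivAt τ hτT x hx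
  rw [integral_reducedMomentum hm hv hE hH hτT ((hbd τ hτT).tangential hm) hpb hpx hpd,
    integral_divg_stress_eq_zero hm hv hE hH hHd hτT hpb hpx hpd
      (fun x hx => by rw [hg0' τ x (hΩx x hx), zero_smul]), sub_zero]
  have i1 : Integrable (fun x => ⟪R (τ, x), g (τ, x) • e⟫) m.μΩ :=
    integrableOn_of_continuous hb ((hRc.comp hcx).inner hpb)
  have i2 : Integrable (fun x => ⟪m.f τ x, g (τ, x) • e⟫) m.μΩ := hfτ hτT
  simp only [inner_add_left]
  exact integral_add i1 i2

/-- The fundamental lemma of the calculus of variations on the cylinder. The force is merely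
integrable, so the equation holds only almost everywhere. -/
theorem momentumResidual_add_force (hm : m.Standing) (hv : CylExt m.T m.Ω v vb vt vx)
    (hE : CylExt m.T m.Ω E Eb Et Ex) (hH : Continuous H)
    (hHd : ∀ t ∈ Icc 0 m.T, ∀ x ∈ m.Ω, HasFDerivAt (fderiv ℝ (v t)) (H (t, x)) x)
    (hbd : ∀ t ∈ Ioo 0 m.T, m.TestBoundary (v t))
    (hw : ∀ᵐ s ∂m.μT, ∀ᵐ t ∂m.μT, s < t → m.WeakMomentum vb vt vx Eb s t) :
    ∀ᵐ t ∂m.μT, ∀ᵐ x ∂m.μΩ,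
      m.momentumResidual (vb (t, x)) (vt (t, x)) (vx (t, x)) (H (t, x)) (Eb (t, x)) (Ex (t, x))
        + m.f t x = 0 := by
  have hb := isBounded_domain hm
  have hvol : volume.restrict (Ioo 0 m.T ×ˢ m.Ω) = m.μT.prod m.μΩ := by
    rw [μT, μΩ, Measure.prod_restrict]; rfl
  set R : ℝ × V → V := fun z => m.momentumResidual (vb z) (vt z) (vx z) (H z) (Eb z) (Ex z)
    with hR
  have hRc : Continuous R := continuous_momentumResidual hm hv hE hH
  have hRi : Integrable R (m.μT.prod m.μΩ) :=
    integrable_prod_of_continuous hb (Metric.isBounded_Ioo 0 m.T) hRc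
  have hW : IntegrableOn (fun z : ℝ × V => R z + m.f z.1 z.2) (Ioo 0 m.T ×ˢ m.Ω) := by
    rw [IntegrableOn, hvol]
    exact hRi.add (integrable_force hm)
  have hopen : IsOpen (Ioo 0 m.T ×ˢ m.Ω) := isOpen_Ioo.prod hm.domain.1
  have key : ∀ᵐ z : ℝ × V, z ∈ Ioo 0 m.T ×ˢ m.Ω → R z + m.f z.1 z.2 = 0 := by
    refine hopen.ae_eq_zero_of_integral_contDiff_smul_eq_zero hW.locallyIntegrableOn
      fun g hg hgc hgs => ?_
    obtain ⟨C, hC⟩ := hgc.exists_bound_of_continuous hg.continuous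
    have hgm := hg.continuous.aestronglyMeasurable
      (μ := volume.restrict (Ioo 0 m.T ×ˢ m.Ω))
    have hgW : IntegrableOn (fun z : ℝ × V => g z • (R z + m.f z.1 z.2)) (Ioo 0 m.T ×ˢ m.Ω) :=
      hW.bdd_smul C hgm (ae_of_all _ hC)
    rw [← setIntegral_eq_integral_of_forall_compl_eq_zero (s := Ioo 0 m.T ×ˢ m.Ω) fun x hx => by
      rw [image_eq_zero_of_notMem_tsupport fun hx' => hx (hgs hx'), zero_smul]]
    refine ext_inner_left ℝ fun e => ?_
    rw [inner_zero_right, ← integral_inner hgW e]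
    refine Eq.trans ?_ (integral_test_momentum hm hv hE hH hHd hbd hw
      (hg.of_le (by exact_mod_cast le_top)) hgc hgs e)
    refine integral_congr_ae (ae_of_all _ fun z => ?_)
    simp only [hR, inner_smul_right, real_inner_comm e]
  have h2 : ∀ᵐ z ∂m.μT.prod m.μΩ, R z + m.f z.1 z.2 = 0 := by
    rw [← hvol, ae_restrict_iff' hopen.measurableSet]
    exact key
  exact Measure.ae_ae_of_ae_prod h2

theorem matDiv_eq {S : V → SymMat} {D : V →L[ℝ] SymMat} {x : V} (h : HasFDerivAt S D x) :
    matDiv (fun y => (S y : Mat)) x = symDiv D := by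
  rw [matDiv, symDiv_apply]
  congr 1
  ext i
  refine Finset.sum_congr rfl fun j _ => ?_
  let ent : SymMat →L[ℝ] ℝ := LinearMap.toContinuousLinearMap
    { toFun := fun A => (A : Mat) i j
      map_add' := fun A B => by rw [map_add]; rfl
      map_smul' := fun c A => by rw [map_smul]; rfl }
  have h1 : HasFDerivAt (fun y => (S y : Mat) i j) (ent.comp D) x := ent.hasFDerivAt.comp x h
  rw [h1.fderiv]
  rfl

theorem momentumEq_of_residual (hm : m.Standing) (hv : CylExt m.T m.Ω v vb vt vx)
    (hE : CylExt m.T m.Ω E Eb Et Ex)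
    (hHd : ∀ t ∈ Icc 0 m.T, ∀ x ∈ m.Ω, HasFDerivAt (fderiv ℝ (v t)) (H (t, x)) x)
    (h : ∀ᵐ t ∂m.μT, ∀ᵐ x ∂m.μΩ,
      m.momentumResidual (vb (t, x)) (vt (t, x)) (vx (t, x)) (H (t, x)) (Eb (t, x)) (Ex (t, x))
        + m.f t x = 0) : ∀ᵐ t ∂m.μT, ∀ᵐ x ∂m.μΩ, m.MomentumEq v E t x := by
  have hT : ∀ᵐ t ∂m.μT, t ∈ Ioo 0 m.T := ae_restrict_mem measurableSet_Ioo
  have hΩ : ∀ᵐ x ∂m.μΩ, x ∈ m.Ω := ae_restrict_mem hm.domain.1.measurableSet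
  filter_upwards [h, hT] with t h1 ht
  filter_upwards [h1, hΩ] with x h2 hx
  have htI := Ioo_subset_Icc_self ht
  have hS := hasFDerivAt_totalStress hm (hHd t htI x hx) (hE.hasFDerivAt t ht x hx)
  have h3 := matDiv_eq hS
  have h4 : (fun y => (m.viscousStress (fderiv ℝ (v t) y) : Mat) + m.elasticStress (E t y))
      = fun y => (m.totalStress (fderiv ℝ (v t) y) (E t y) : Mat) := by
    funext y
    rw [totalStress, map_add, coe_elasticSym]
  rw [MomentumEq, h4, h3, (hv.hasDerivAt t ht x hx).deriv, (hv.hasFDerivAt t ht x hx).fderiv,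
    hv.eqOn t htI x (subset_closure hx), hE.eqOn t htI x (subset_closure hx)]
  rw [momentumResidual] at h2
  rw [← sub_eq_zero, ← neg_eq_zero, ← h2]
  abel

end Model

/-! ### The traction condition -/

/-- From one admissible s, the primitive vanishes at a dense set of later times, hence at all of
them by continuity, and so does its derivative J. -/
theorem eq_zero_of_ae_integral_eq_zero {T : ℝ} {J : ℝ → ℝ} (hJ : Continuous J)
    (h : ∀ᵐ s ∂volume.restrict (Ioo 0 T), ∀ᵐ t ∂volume.restrict (Ioo 0 T), s < t →
      ∫ τ in s..t, J τ = 0) : ∀ τ ∈ Ioo 0 T, J τ = 0 := by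
  intro τ hτ
  obtain ⟨s, hs, hs'⟩ := exists_mem_Ioo_of_ae h le_rfl hτ.1 hτ.2.le
  have hF : ∀ t, HasDerivAt (fun t => ∫ τ in s..t, J τ) (J t) t := fun t =>
    intervalIntegral.integral_hasDerivAt_right (hJ.intervalIntegrable _ _)
      (hJ.stronglyMeasurableAtFilter _ _) hJ.continuousAt
  have hFc : Continuous fun t => ∫ τ in s..t, J τ :=
    continuous_iff_continuousAt.2 fun t => (hF t).continuousAt
  have hz : ∀ t ∈ Ioo s T, ∫ τ in s..t, J τ = 0 := by
    intro t ht
    by_contra hne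
    obtain ⟨ε, hε, hball⟩ := Metric.eventually_nhds_iff_ball.1
      ((hFc.continuousAt (x := t)).eventually_ne hne)
    obtain ⟨t', ht', h0⟩ := exists_mem_Ioo_of_ae hs' (a := t) (b := min (t + ε) T)
      (hs.1.trans ht.1).le (lt_min (by linarith) ht.2) (min_le_right _ _)
    refine hball t' ?_ (h0 (ht.1.trans ht'.1))
    rw [Metric.mem_ball, Real.dist_eq, abs_of_pos (sub_pos.2 ht'.1)]
    linarith [(lt_min_iff.1 ht'.2).1]
  have h1 : (fun t => ∫ τ in s..t, J τ) =ᶠ[𝓝 τ] fun _ => 0 := by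
    filter_upwards [Ioo_mem_nhds hs.2 hτ.2] with t ht using hz t ht
  exact (hF τ).unique ((hasDerivAt_const τ (0 : ℝ)).congr_of_eventuallyEq h1)

theorem inner_actL_left (A : SymMat) (p q : V) : ⟪actL A p, q⟫ = ⟪p, actL A q⟫ := by
  have hs : ∀ i j, (A : Mat) i j = (A : Mat) j i := fun i j => by
    conv_lhs => rw [← A.transpose_eq]
    rfl
  simp only [actL_apply, PiLp.inner_apply, Matrix.mulVec, dotProduct, RCLike.inner_apply,
    conj_trivial, Finset.mul_sum, Finset.sum_mul]
  rw [Finset.sum_comm]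
  refine Finset.sum_congr rfl fun i _ => Finset.sum_congr rfl fun j _ => ?_
  rw [hs j i]
  ring

section Normal

variable {b : OrthonormalBasis (Fin 3) ℝ V} {h : (Fin 2 → ℝ) → ℝ}

theorem contDiff_graphNormal (hh : ContDiff ℝ 2 h) : ContDiff ℝ 1 (graphNormal b h) := by
  have h1 : ContDiff ℝ 1 (fderiv ℝ h) := hh.fderiv_right (by norm_num)
  unfold graphNormal
  have h2 : ContDiff ℝ 1 fun y => fderiv ℝ h (proj b y) := h1.comp (proj b).contDiff
  exact contDiff_const.sub (ContDiff.sum fun i _ => (h2.clm_apply contDiff_const).smul contDiff_const)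

/-- The multiple by `‖N‖²` of the tangential part of `c`, for the normal `N` of the graph. -/
def tangentialPart (b : OrthonormalBasis (Fin 3) ℝ V) (h : (Fin 2 → ℝ) → ℝ) (c y : V) : V :=
  ‖graphNormal b h y‖ ^ 2 • c - ⟪c, graphNormal b h y⟫ • graphNormal b h y

theorem inner_tangentialPart (c y : V) : ⟪tangentialPart b h c y, graphNormal b h y⟫ = 0 := by
  rw [tangentialPart, inner_sub_left, real_inner_smul_left, real_inner_smul_left,
    real_inner_self_eq_norm_sq]
  ring

/-- The normal of a C² graph is C¹, just enough for a test function. -/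
theorem contDiff_tangentialPart (hh : ContDiff ℝ 2 h) (c : V) :
    ContDiff ℝ 1 (tangentialPart b h c) := by
  have := contDiff_graphNormal (b := b) hh
  unfold tangentialPart
  exact ((this.norm_sq ℝ).smul contDiff_const).sub ((contDiff_const.inner ℝ this).smul this)

end Normal

namespace Model

variable {m : Model} {v : ℝ → V → V} {vb vt : ℝ × V → V} {vx : ℝ × V → V →L[ℝ] V}
  {E : ℝ → V → SymMat} {Eb Et : ℝ × V → SymMat} {Ex : ℝ × V → V →L[ℝ] SymMat}
  {v₀ : V → V} {E₀ : V → SymMat} {En : ℝ → ℝ} {H : ℝ × V → V →L[ℝ] V →L[ℝ] V}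

/-- Where the momentum equation holds almost everywhere, the weak equation retains only the stress
flux. It is continuous in time, so it vanishes at every time and not only on average. -/
theorem integral_divg_stress_eq_zero_of_testBoundary (hm : m.Standing)
    (hv : CylExt m.T m.Ω v vb vt vx)
    (hE : CylExt m.T m.Ω E Eb Et Ex) (hH : Continuous H)
    (hbd : ∀ t ∈ Ioo 0 m.T, m.TestBoundary (v t))
    (hw : ∀ᵐ s ∂m.μT, ∀ᵐ t ∂m.μT, s < t → m.WeakMomentum vb vt vx Eb s t)
    (hR : ∀ᵐ t ∂m.μT, ∀ᵐ x ∂m.μΩ,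
      m.momentumResidual (vb (t, x)) (vt (t, x)) (vx (t, x)) (H (t, x)) (Eb (t, x)) (Ex (t, x))
        + m.f t x = 0)
    {χ : V → V} (hχ : ContDiff ℝ 1 χ) (hχb : m.TestBoundary χ) :
    ∀ τ ∈ Ioo 0 m.T, ∫ x in m.Ω, divg (actDeriv (m.totalStress (vx (τ, x)) (Eb (τ, x)))
      (m.stressDeriv (H (τ, x)) (Eb (τ, x)) (Ex (τ, x))) (χ x) (fderiv ℝ χ x)) = 0 := by
  have hb := isBounded_domain hm
  have hDχ : Continuous (fderiv ℝ χ) := hχ.continuous_fderiv (by simp)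
  have hJ : Continuous fun τ => ∫ x in m.Ω, divg (actDeriv (m.totalStress (vx (τ, x)) (Eb (τ, x)))
      (m.stressDeriv (H (τ, x)) (Eb (τ, x)) (Ex (τ, x))) (χ x) (fderiv ℝ χ x)) :=
    continuous_integral_of_continuous hb (continuous_divg_comp
      (continuous_divg_stress hm hv hE hH (hχ.continuous.comp continuous_snd)
        (hDχ.comp continuous_snd)))
  refine eq_zero_of_ae_integral_eq_zero hJ ?_
  have hT : ∀ᵐ t ∂m.μT, t ∈ Ioo 0 m.T := ae_restrict_mem measurableSet_Ioo
  have hχx : HasC1Ext m.Ω χ χ (fderiv ℝ χ) := ⟨hχ.continuous, hDχ, fun _ _ => rfl,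
    fun x _ => (hχ.differentiable (by simp) x).hasFDerivAt⟩
  filter_upwards [hw, hT] with s h1 hs
  filter_upwards [h1, hT] with t h2 ht hst
  obtain ⟨η, hη, hη1, T₂, hT₂, hη0⟩ := exists_time_cutoff ht.2
  have h3 := h2 hst _ _ _ _ (isTest_time_smul hm hχx.cylExt_const hη hT₂ hη0)
    (fun t _ => hχb.const_smul _) (hχx.cylExt_const.time_smul hη)
  rw [← neg_eq_zero, ← intervalIntegral.integral_neg, ← h3]
  rw [intervalIntegral.integral_of_le hst.le, intervalIntegral.integral_of_le hst.le]
  refine setIntegral_congr_ae measurableSet_Ioc ?_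
  have hf := (integrable_force_inner hm (hχ.continuous.comp continuous_snd)).prod_right_ae
  rw [μT, ae_restrict_iff' measurableSet_Ioo] at hf hR
  filter_upwards [hf, hR] with τ hfτ hRτ hτ
  have hτT : τ ∈ Ioo 0 m.T := ⟨hs.1.trans hτ.1, hτ.2.trans_lt ht.2⟩
  have hcx : Continuous fun x : V => (τ, x) := by fun_prop
  simp only [hη1 τ hτ.2, one_smul]
  rw [integral_reducedMomentum hm hv hE hH hτT ((hbd τ hτT).tangential hm) hχ.continuous hDχ
    (fun x _ => (hχ.differentiable (by simp) x).hasFDerivAt)]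
  have i1 : Integrable (fun x => ⟪m.momentumResidual (vb (τ, x)) (vt (τ, x)) (vx (τ, x))
      (H (τ, x)) (Eb (τ, x)) (Ex (τ, x)), χ x⟫) m.μΩ :=
    integrableOn_of_continuous hb
      (((continuous_momentumResidual hm hv hE hH).comp hcx).inner hχ.continuous)
  have i2 : Integrable (fun x => ⟪m.f τ x, χ x⟫) m.μΩ := hfτ hτT
  have h4 : (∫ x in m.Ω, ⟪m.momentumResidual (vb (τ, x)) (vt (τ, x)) (vx (τ, x))
      (H (τ, x)) (Eb (τ, x)) (Ex (τ, x)), χ x⟫) + ∫ x in m.Ω, ⟪m.f τ x, χ x⟫ = 0 := by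
    refine (integral_add i1 i2).symm.trans (integral_eq_zero_of_ae ?_)
    filter_upwards [hRτ hτT] with x hx
    rw [← inner_add_left, hx, inner_zero_left, Pi.zero_apply]
  linarith

theorem extendFrom_fderiv (hv : CylExt m.T m.Ω v vb vt vx) {t : ℝ}
    (ht : t ∈ Ioo 0 m.T) {x : V} (hx : x ∈ closure m.Ω) :
    extendFrom m.Ω (fderiv ℝ (v t)) x = vx (t, x) := by
  refine extendFrom_eq hx ?_
  have h1 := hv.cont_x
  have h2 : Continuous fun y => vx (t, y) := by fun_prop
  refine Tendsto.congr' ?_ ((h2.tendsto x).mono_left nhdsWithin_le_nhds)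
  filter_upwards [self_mem_nhdsWithin] with y hy using (hv.hasFDerivAt t ht y hy).fderiv.symm

/-- The graph function near a regular Neumann point, cut off to become Lipschitz. -/
theorem IsRegularNeumannPoint.exists_graph {x : V} (hx : m.IsRegularNeumannPoint x) :
    ∃ (b : OrthonormalBasis (Fin 3) ℝ V) (h : (Fin 2 → ℝ) → ℝ), ContDiff ℝ 2 h ∧
      (∃ K, LipschitzWith K h) ∧ ∃ r > 0,
        (∀ y ∈ Metric.ball x r, y ∈ m.Ω ↔ ⟪y, b 0⟫ < h (proj b y)) ∧
        surf (m.ΓD ∩ Metric.ball x r) = 0 := by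
  obtain ⟨-, hsub, r', hr', hnull⟩ := hx
  obtain ⟨b, k, hk, r, hr, hΩ⟩ := hsub.exists_basis
  have hkc : ContDiff ℝ 2 fun a : Fin 2 → ℝ => k (param b (a, 0)) := by
    refine hk.comp ?_
    unfold param
    fun_prop
  have hK : IsCompact (proj b '' Metric.closedBall x r) :=
    (isCompact_closedBall x r).image (proj b).continuous
  -- The cut-off is one over the shadow of the ball, so the description of `Ω` there is unchanged,
  -- while compact support makes the C² graph function Lipschitz.
  obtain ⟨θ, hθ, hθc, -, hθ1, -⟩ := exists_smooth_cutoff hK isOpen_univ (subset_univ _)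
  have hθ2 : ContDiff ℝ 2 θ := contDiff_infty.1 hθ 2
  have hh : ContDiff ℝ 2 fun a => θ a * k (param b (a, 0)) := hθ2.mul hkc
  refine ⟨b, fun a => θ a * k (param b (a, 0)), hh,
    hh.lipschitzWith_of_hasCompactSupport hθc.mul_right (by norm_num), min r r', lt_min hr hr',
    fun y hy => ?_, measure_mono_null (inter_subset_inter_right _
      (Metric.ball_subset_ball (min_le_right _ _))) hnull⟩
  have hyr := Metric.ball_subset_ball (min_le_left r r') hy
  have h1 : θ (proj b y) = 1 :=
    (hθ1 _ ⟨y, Metric.ball_subset_closedBall hyr, rfl⟩).self_of_nhds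
  simp only [hΩ y hyr, h1, one_mul]

/-- The Dirichlet condition is free of charge: the field vanishes outside the ball, and inside it
the Dirichlet part is a null set. -/
theorem testBoundary_tangentialPart (hm : m.Standing) {b : OrthonormalBasis (Fin 3) ℝ V}
    {h : (Fin 2 → ℝ) → ℝ} (hh : ContDiff ℝ 2 h) {x : V} {r : ℝ}
    (hΩ : ∀ y ∈ Metric.ball x r, y ∈ m.Ω ↔ ⟪y, b 0⟫ < h (proj b y))
    (hnull : surf (m.ΓD ∩ Metric.ball x r) = 0) {ζ : V → ℝ} (hζ : tsupport ζ ⊆ Metric.ball x r)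
    (c : V) : m.TestBoundary fun y => ζ y • tangentialPart b h c y := by
  have h0 : ∀ y ∉ Metric.ball x r, ζ y = 0 := fun y hy =>
    image_eq_zero_of_notMem_tsupport fun h' => hy (hζ h')
  refine ⟨?_, ?_⟩
  · rw [ae_restrict_iff' hm.ΓD_meas]
    filter_upwards [measure_eq_zero_iff_ae_notMem.1 hnull] with y hy hyD
    rw [h0 y fun hyb => hy ⟨hyD, hyb⟩, zero_smul]
  · filter_upwards [ae_restrict_mem (measurableSet_ΓN hm)] with y hyN n hn
    by_cases hy : y ∈ Metric.ball x r
    · have h1 := isOuterNormal_of_subgraph hh.continuous hΩ hy hyN.1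
        (hh.differentiable (by norm_num) _)
      rw [hn.unique h1, real_inner_smul_left, real_inner_smul_right, inner_tangentialPart, mul_zero,
        mul_zero]
    · rw [h0 y hy, zero_smul, inner_zero_left]

/-- The test field is the localized tangential projection of the constant vector w, the scaled
tangential traction at x. The flux density it produces equals ‖w‖² at x; if w were nonzero, the flux
over a small piece of the graph would be positive, contrary to `hJ`. -/
theorem tractionFree (hm : m.Standing) (hv : CylExt m.T m.Ω v vb vt vx)
    (hE : CylExt m.T m.Ω E Eb Et Ex) (hH : Continuous H)
    (hHd : ∀ t ∈ Icc 0 m.T, ∀ x ∈ m.Ω, HasFDerivAt (fderiv ℝ (v t)) (H (t, x)) x)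
    (hJ : ∀ χ : V → V, ContDiff ℝ 1 χ → m.TestBoundary χ →
      ∀ τ ∈ Ioo 0 m.T, ∫ x in m.Ω, divg (actDeriv (m.totalStress (vx (τ, x)) (Eb (τ, x)))
        (m.stressDeriv (H (τ, x)) (Eb (τ, x)) (Ex (τ, x))) (χ x) (fderiv ℝ χ x)) = 0)
    {t : ℝ} (ht : t ∈ Ioo 0 m.T) {x n : V} (hx : m.IsRegularNeumannPoint x)
    (hn : IsOuterNormal m.Ω x n) : m.TractionFree (v t) (E t) x n := by
  obtain ⟨b, h, hh, ⟨K, hK⟩, r, hr, hΩ, hnull⟩ := hx.exists_graph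
  have hxb : x ∈ Metric.ball x r := Metric.mem_ball_self hr
  have hxf := hx.1.1
  have hxc := frontier_subset_closure hxf
  have hcx : Continuous fun x : V => (t, x) := by fun_prop
  set S : V → SymMat := fun y => m.totalStress (vx (t, y)) (Eb (t, y)) with hS
  have hSc : Continuous S := (continuous_totalStress hm hv.cont_x hE.cont).comp hcx
  set N : V → V := graphNormal b h with hN
  have hNc : Continuous N := (contDiff_graphNormal hh).continuous
  set w : V := ‖N x‖ ^ 2 • actL (S x) (N x) - ⟪N x, actL (S x) (N x)⟫ • N x with hw
  set q : V → ℝ := fun y => ⟪actL (S y) (tangentialPart b h w y), N y⟫ with hq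
  have hqc : Continuous q :=
    (continuous_actL_comp hSc (contDiff_tangentialPart hh w).continuous).inner hNc
  -- Both the stress and the scaled tangential projection are symmetric, so the projection moves
  -- from w onto the traction and gives w again.
  have hqx : q x = ‖w‖ ^ 2 := by
    have h1 : ⟪w, w⟫ = ⟪w, ‖N x‖ ^ 2 • actL (S x) (N x) - ⟪N x, actL (S x) (N x)⟫ • N x⟫ :=
      congrArg (fun z => ⟪w, z⟫) hw
    rw [← real_inner_self_eq_norm_sq, h1]
    simp only [hq]
    rw [inner_actL_left, tangentialPart, inner_sub_left, inner_sub_right, real_inner_smul_left,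
      real_inner_smul_left, real_inner_smul_right, real_inner_smul_right]
    ring
  have hgraph : ⟪x, b 0⟫ = h (proj b x) :=
    (mem_frontier_iff_of_subgraph hK.continuous hΩ hxb).1 hxf
  have hpx : param b (proj b x, h (proj b x)) = x := by
    rw [← hgraph, param_proj]
  have hw0 : w = 0 := by
    by_contra hne
    have hpos : 0 < q x := by rw [hqx]; positivity
    obtain ⟨δ, hδ, hball⟩ := Metric.eventually_nhds_iff_ball.1
      (hqc.continuousAt.eventually (lt_mem_nhds hpos))
    obtain ⟨ζ, hζ, hζc, hζs, hζ1, hζ01⟩ := exists_smooth_cutoff (isCompact_singleton (x := x))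
      (Metric.isOpen_ball (x := x) (ε := min δ r))
      (singleton_subset_iff.2 (Metric.mem_ball_self (lt_min hδ hr)))
    have hζr : tsupport ζ ⊆ Metric.ball x r :=
      hζs.trans (Metric.ball_subset_ball (min_le_right _ _))
    have hζ1' : ContDiff ℝ 1 ζ := hζ.of_le (by exact_mod_cast le_top)
    have hχ : ContDiff ℝ 1 fun y => ζ y • tangentialPart b h w y :=
      hζ1'.smul (contDiff_tangentialPart hh w)
    have h1 := hJ _ hχ (testBoundary_tangentialPart hm hh hΩ hnull hζr w) t ht
    have hXs : tsupport (fun y => actL (S y) (ζ y • tangentialPart b h w y)) ⊆ tsupport ζ := by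
      refine closure_mono fun y hy => ?_
      rw [Function.mem_support] at hy ⊢
      exact fun h0 => hy (by rw [h0, zero_smul, map_zero])
    have h2 := integral_divg_eq_integral_graphFlux hK hm.domain.1 hΩ
      (X := fun y => actL (S y) (ζ y • tangentialPart b h w y))
      (continuous_actL_comp hSc hχ.continuous)
      ((continuous_divg_stress hm hv hE hH (hχ.continuous.comp continuous_snd)
        ((hχ.continuous_fderiv (by simp)).comp continuous_snd)).comp hcx)
      (fun y hy => hasFDerivAt_stress_act hm hv hE hHd ht hy
        (hχ.differentiable (by simp) y).hasFDerivAt)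
      (hζc.of_isClosed_subset (isClosed_tsupport _) hXs) (hXs.trans hζr)
    have h3 : ∫ a, ζ (param b (a, h a)) * q (param b (a, h a)) = 0 := by
      rw [← h1]
      refine Eq.trans (integral_congr_ae (ae_of_all _ fun a => ?_)) h2.symm
      rw [graphFlux, ← inner_graphNormal, map_smul, real_inner_smul_left]
    have hpc : Continuous fun a => param b (a, h a) :=
      (continuous_param b).comp (continuous_id.prodMk hK.continuous)
    have hFc : Continuous fun a => ζ (param b (a, h a)) * q (param b (a, h a)) :=
      (hζ.continuous.comp hpc).mul (hqc.comp hpc)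
    have h4 : 0 < ∫ a, ζ (param b (a, h a)) * q (param b (a, h a)) := by
      refine hFc.integral_pos_of_hasCompactSupport_nonneg_nonzero (x := proj b x) ?_ ?_ ?_
      · refine HasCompactSupport.intro (hζc.image (proj b).continuous) fun a ha => ?_
        have : ζ (param b (a, h a)) = 0 := image_eq_zero_of_notMem_tsupport fun h' =>
          ha ⟨_, h', proj_param b _⟩
        rw [this, zero_mul]
      · intro a
        by_cases hy : param b (a, h a) ∈ Metric.ball x (min δ r)
        · exact mul_nonneg (hζ01 _).1
            (hball _ (Metric.ball_subset_ball (min_le_left _ _) hy)).le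
        · have : ζ (param b (a, h a)) = 0 :=
            image_eq_zero_of_notMem_tsupport fun h' => hy (hζs h')
          simp [this]
      · rw [hpx, (hζ1 x rfl).self_of_nhds, one_mul]
        exact hpos.ne'
    exact h4.ne' h3
  have hnN : n = ‖N x‖⁻¹ • N x := hn.unique (isOuterNormal_of_subgraph hh.continuous hΩ hxb hxf
    (hh.differentiable (by norm_num) _))
  have hNpos : 0 < ‖N x‖ := norm_pos_iff.2 (graphNormal_ne_zero b h x)
  have htI := Ioo_subset_Icc_self ht
  have hstress : m.boundaryStress (v t) (E t) x = (S x : Mat) := by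
    rw [boundaryStress, extendFrom_fderiv hv ht hxc, hE.eqOn t htI x hxc, add_comm,
      ← coe_elasticSym, ← map_add]
    rfl
  have ha : (WithLp.toLp 2 ((m.boundaryStress (v t) (E t) x).mulVec n.ofLp) : V)
      = actL (S x) n := by rw [hstress, actL_apply]
  rw [TractionFree, ha]
  change actL (S x) n - ⟪actL (S x) n, n⟫ • n = 0
  -- Two powers come from the scaling of the tangential part and one from normalizing the normal.
  have hfin : (‖N x‖ ^ 3) • (actL (S x) n - ⟪actL (S x) n, n⟫ • n) = w := by
    rw [hnN, hw, map_smul, real_inner_smul_left, real_inner_smul_right, smul_sub, smul_smul,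
      smul_smul, smul_smul, inner_actL_left]
    congr 2
    · field_simp
    · field_simp
  rw [hw0] at hfin
  exact (smul_eq_zero.1 hfin).resolve_left (by positivity)

end Model

/-! ### The strain inclusion -/

theorem frob_trace_one_right (A : Mat) (c : ℝ) : frob A (c • (1 : Mat)) = c * A.trace := by
  rw [frob_smul_right, frob_one_right]

/-- The inclusion of the deviatoric matrices into the symmetric matrices. -/
def DevMat.toSym : DevMat →L[ℝ] SymMat := symPartL.comp devInclL

theorem DevMat.coe_toSym (A : DevMat) : ((DevMat.toSym A : SymMat) : Mat) = (A : Mat) :=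
  congrArg SymMat.incl (symPart_coe (SymMat.mk (A : Mat) (Subtype.property A).1))

theorem DevMat.trace_coe (A : DevMat) : (A : Mat).trace = 0 := (Subtype.property A).2

theorem dev_toSym (A : DevMat) : dev (DevMat.toSym A) = A := by
  apply DevMat.incl_injective
  rw [dev, DevMat.incl_mk, DevMat.coe_toSym, DevMat.trace_coe, mul_zero, zero_smul, sub_zero]

theorem coe_dev (A : SymMat) :
    (dev A : Mat) = (A : Mat) - ((1 / 3 : ℝ) * (A : Mat).trace) • (1 : Mat) := rfl

theorem coe_dev_of_trace_eq_zero {A : SymMat} (h : (A : Mat).trace = 0) :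
    (dev A : Mat) = (A : Mat) := by
  rw [coe_dev, h, mul_zero, zero_smul, sub_zero]

theorem dev_one_eq_zero : dev SymMat.one = 0 := by
  apply DevMat.incl_injective
  rw [coe_dev, map_zero]
  have h : (SymMat.one : Mat) = 1 := rfl
  rw [h, Matrix.trace_one]
  simp

theorem frob_dev_right {A : Mat} (h : A.trace = 0) (B : SymMat) :
    frob A (dev B : Mat) = frob A (B : Mat) := by
  rw [coe_dev, frob_sub_right, frob_trace_one_right, h, mul_zero, sub_zero]

/-- The pressure part φ(A)𝕀 is removed by `dev`, so the inclusion at dev 𝕋 and the inequality at dev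
Dφ(𝔼) concern the same point. -/
theorem Model.dev_elasticStress (m : Model) (A : SymMat) :
    dev (symPart (m.elasticStress A)) = dev (gradSym m.φ A) := by
  rw [← coe_elasticSym, symPart_coe, elasticSym, ← devL_apply, map_add, map_smul, devL_apply,
    devL_apply, dev_one_eq_zero, smul_zero, add_zero]

theorem HasC1Ext.clm_comp {X F F' : Type*} [NormedAddCommGroup X] [NormedSpace ℝ X]
    [NormedAddCommGroup F] [NormedSpace ℝ F] [NormedAddCommGroup F'] [NormedSpace ℝ F']
    {U : Set X} {u ub : X → F} {D : X → X →L[ℝ] F} (h : HasC1Ext U u ub D) (Λ : F →L[ℝ] F') :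
    HasC1Ext U (fun x => Λ (u x)) (fun x => Λ (ub x)) (fun x => Λ.comp (D x)) where
  cont := Λ.continuous.comp h.cont
  cont_deriv := continuous_const.clm_comp h.cont_deriv
  eqOn _ hx := congrArg Λ (h.eqOn hx)
  hasFDerivAt x hx := Λ.hasFDerivAt.comp x (h.hasFDerivAt x hx)

theorem hasC1Ext_of_contDiff {X F : Type*} [NormedAddCommGroup X] [NormedSpace ℝ X]
    [NormedAddCommGroup F] [NormedSpace ℝ F] {U : Set X} {u : X → F} (h : ContDiff ℝ 1 u) :
    HasC1Ext U u u (fderiv ℝ u) where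
  cont := h.continuous
  cont_deriv := h.continuous_fderiv (by simp)
  eqOn _ _ := rfl
  hasFDerivAt x _ := (h.differentiable (by simp) x).hasFDerivAt

namespace Model

variable {m : Model} {v : ℝ → V → V} {vb vt : ℝ × V → V} {vx : ℝ × V → V →L[ℝ] V}
  {E : ℝ → V → SymMat} {Eb Et : ℝ × V → SymMat} {Ex : ℝ × V → V →L[ℝ] SymMat}

theorem potential_eq_of_ae_eq {u w : V → DevMat} (hw : MemLp w 1 (volume.restrict m.Ω))
    (h : u =ᵐ[volume.restrict m.Ω] w) : m.potential u = m.P (hw.toLp w) := by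
  have hu : MemLp u 1 (volume.restrict m.Ω) := (memLp_congr_ae h).2 hw
  rw [potential, dif_pos hu, (MemLp.toLp_eq_toLp_iff hu hw).2 h]

theorem memLp_of_continuous (hm : m.Standing) {F : Type*} [NormedAddCommGroup F] {w : V → F}
    (hw : Continuous w) (p : ℝ≥0∞) : MemLp w p (volume.restrict m.Ω) := by
  have : IsFiniteMeasure (volume.restrict m.Ω) := isFiniteMeasure_μΩ hm
  obtain ⟨C, hC⟩ := (isBounded_domain hm).isCompact_closure.exists_bound_of_continuousOn
    hw.continuousOn
  refine MemLp.of_bound hw.aestronglyMeasurable C ?_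
  filter_upwards [ae_restrict_mem hm.domain.1.measurableSet] with x hx
  exact hC x (subset_closure hx)

/-- The deviatoric stress is continuous in time with values in L¹, and P is lower semicontinuous. -/
theorem eventually_lt_stressPotential (hm : m.Standing) (hE : CylExt m.T m.Ω E Eb Et Ex) {t : ℝ}
    (ht : t ∈ Ioo 0 m.T) {y : ℝ≥0∞} (hy : y < m.stressPotential E t) :
    ∀ᶠ τ in 𝓝 t, y < m.stressPotential E τ := by
  set w : ℝ × V → DevMat := fun z => devL (gradSym m.φ (Eb z)) with hw
  have hwc : Continuous w := devL.continuous.comp (continuous_gradSym_comp hm.φ_smooth hE.cont)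
  have hmem : ∀ τ, MemLp (fun x => w (τ, x)) 1 (volume.restrict m.Ω) := fun τ =>
    memLp_of_continuous hm (by fun_prop) 1
  have hP : ∀ τ ∈ Icc 0 m.T, m.stressPotential E τ = m.P ((hmem τ).toLp _) := fun τ hτ =>
    potential_eq_of_ae_eq (hmem τ) (by
      filter_upwards [ae_restrict_mem hm.domain.1.measurableSet] with x hx
      rw [hE.eqOn τ hτ x (subset_closure hx)]
      rfl)
  have hU : Tendsto (fun τ => (hmem τ).toLp _) (𝓝 t) (𝓝 ((hmem t).toLp _)) := by
    rw [tendsto_iff_norm_sub_tendsto_zero]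
    have h1 : Continuous fun τ => ∫ x in m.Ω, ‖w (τ, x) - w (t, x)‖ :=
      continuous_integral_of_continuous (isBounded_domain hm)
        (c := fun z => ‖w z - w (t, z.2)‖) (by fun_prop)
    have h2 := h1.tendsto t
    simp only [sub_self, norm_zero, integral_zero] at h2
    refine h2.congr fun τ => ?_
    rw [← MemLp.toLp_sub, Lp.norm_toLp, eLpNorm_one_eq_lintegral_enorm,
      ← integral_norm_eq_lintegral_enorm ((hmem τ).sub (hmem t)).1]
    rfl
  rw [hP t (Ioo_subset_Icc_self ht)] at hy
  filter_upwards [hU.eventually (hm.P_lsc _ y hy), Icc_mem_nhds ht.1 ht.2] with τ h3 h4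
  rwa [hP τ h4]

/-- The strain part of the reduced energy inequality, tested with `Φb`. -/
def strainGap (m : Model) (vb : ℝ × V → V) (vx : ℝ × V → V →L[ℝ] V) (Eb Et : ℝ × V → SymMat)
    (Ex : ℝ × V → V →L[ℝ] SymMat) (Φb : V → SymMat) (τ : ℝ) : ℝ :=
  ∫ x in m.Ω, frob (residual (vb (τ, x)) (vx (τ, x)) (Eb (τ, x)) (Et (τ, x)) (Ex (τ, x)) : Mat)
    (Φb x - gradSym m.φ (Eb (τ, x)) : SymMat)

/-- If the inequality failed at t, it would fail by continuity on an interval around t, and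
integrating between two admissible times in that interval contradicts the variational inequality. A
finite lower bound y replaces the dissipation, which is only semicontinuous and not yet known to be
finite at t. -/
theorem strainGap_add_le (hm : m.Standing)
    (hv : CylExt m.T m.Ω v vb vt vx) (hE : CylExt m.T m.Ω E Eb Et Ex)
    (hvi : ∀ᵐ s ∂m.μT, ∀ᵐ t ∂m.μT, s < t → m.VariationalInequality E vb vt vx Eb Et Ex s t)
    {Φ Φb : V → SymMat} {D : V → V →L[ℝ] SymMat} (hΦ : HasC1Ext m.Ω Φ Φb D)
    (hL : m.potential (fun x => dev (Φ x)) ≠ ∞) {t : ℝ} (ht : t ∈ Ioo 0 m.T) {y : ℝ≥0}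
    (hy : ∀ᶠ τ in 𝓝 t, (y : ℝ≥0∞) ≤ m.stressPotential E τ) :
    m.strainGap vb vx Eb Et Ex Φb t + y ≤ (m.potential fun x => dev (Φ x)).toReal := by
  set L := m.potential fun x => dev (Φ x) with hLdef
  set I := m.strainGap vb vx Eb Et Ex Φb with hI
  have hIc : Continuous I := by
    refine continuous_integral_of_continuous (isBounded_domain hm)
      (c := fun z => frob (residual (vb z) (vx z) (Eb z) (Et z) (Ex z) : Mat)
        (Φb z.2 - gradSym m.φ (Eb z) : SymMat)) ?_
    exact continuous_frob_comp (continuous_coe_comp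
      (continuous_residual hv.cont hv.cont_x hE.cont hE.cont_t hE.cont_x))
      (continuous_coe_comp ((hΦ.cont.comp continuous_snd).sub
        (continuous_gradSym_comp hm.φ_smooth hE.cont)))
  by_contra! hlt
  have hev : ∀ᶠ τ in 𝓝 t, (y : ℝ≥0∞) ≤ m.stressPotential E τ ∧ L.toReal < I τ + y ∧
      τ ∈ Ioo 0 m.T :=
    hy.and (((hIc.add continuous_const).tendsto t).eventually (lt_mem_nhds hlt) |>.and
      (Ioo_mem_nhds ht.1 ht.2))
  obtain ⟨ε, hε, hball⟩ := Metric.eventually_nhds_iff_ball.1 hev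
  rw [Real.ball_eq_Ioo] at hball
  set a := max 0 (t - ε) with ha
  -- The midpoint keeps b below the final time, as the cut-off requires.
  set b := min ((t + m.T) / 2) (t + ε) with hb
  have hat : a < t := max_lt ht.1 (by linarith)
  have htb : t < b := lt_min (by linarith [ht.2]) (by linarith)
  have hbT : b < m.T := (min_le_left _ _).trans_lt (by linarith [ht.2])
  have hab : ∀ τ ∈ Ioo a b, (y : ℝ≥0∞) ≤ m.stressPotential E τ ∧ L.toReal < I τ + y ∧
      τ ∈ Ioo 0 m.T := fun τ hτ =>
    hball τ ⟨(le_max_right _ _).trans_lt hτ.1, hτ.2.trans_le (min_le_right _ _)⟩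
  obtain ⟨s, hs, h1⟩ := exists_mem_Ioo_of_ae hvi (le_max_left _ _) (hat.trans htb) hbT.le
  obtain ⟨r, hr, h2⟩ := exists_mem_Ioo_of_ae h1 ((le_max_left 0 (t - ε)).trans hs.1.le) hs.2 hbT.le
  obtain ⟨η, hη, hη1, T₂, hT₂, hη0⟩ := exists_time_cutoff hbT
  have hQ := hΦ.cylExt_const (T := m.T)
  have h3 := h2 hr.1 _ _ _ _ _ _ _ _ ⟨isTest_of_cylExt hm CylExt.zero hT₂ fun _ _ _ _ => rfl,
    isTest_time_smul hm hQ hη hT₂ hη0, fun _ _ => testBoundary_zero⟩ CylExt.zero (hQ.time_smul hη)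
  have hsr : ∀ τ ∈ Ioc s r, τ ∈ Ioo a b := fun τ hτ => ⟨hs.1.trans hτ.1, hτ.2.trans_lt hr.2⟩
  have h4 : ∫⁻ τ in Ioc s r, m.potential (fun x => dev (η τ • Φ x))
      = L * ENNReal.ofReal (r - s) := by
    rw [setLIntegral_congr_fun (g := fun _ => L) measurableSet_Ioc fun τ hτ => by
      simp only [hη1 τ (hsr τ hτ).2.le, one_smul, hLdef], setLIntegral_const, Real.volume_Ioc]
  have h5 : (y : ℝ≥0∞) * ENNReal.ofReal (r - s) ≤ ∫⁻ τ in Ioc s r, m.stressPotential E τ := by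
    rw [← Real.volume_Ioc, ← setLIntegral_const]
    exact setLIntegral_mono' measurableSet_Ioc fun τ hτ => (hab τ (hsr τ hτ)).1
  have h6 : ∫ τ in s..r, ((∫ x in m.Ω, m.reducedDensity vb vt vx Eb Et Ex (fun _ => 0) (fun _ => 0)
        (fun z => η z.1 • Φb z.2) (τ, x)) + ∫ x in m.Ω, ⟪m.f τ x, (0 : V)⟫)
      = ∫ τ in s..r, I τ := by
    refine intervalIntegral.integral_congr fun τ hτ => ?_
    rw [uIcc_of_le hr.1.le] at hτ
    simp [reducedDensity, reducedMomentum, hη1 τ (hτ.2.trans hr.2.le), strainRate_zero, divg_zero,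
      frob_zero_right, hI, strainGap]
  rw [h4, h6] at h3
  have hrs : 0 < r - s := sub_pos.2 hr.1
  clear_value L
  lift L to ℝ≥0 using hL
  have h7 := (add_le_add_right (EReal.coe_ennreal_le_coe_ennreal_iff.2 h5) _).trans h3
  have e1 : ∀ q : ℝ≥0, (((q : ℝ≥0∞) * ENNReal.ofReal (r - s) : ℝ≥0∞) : EReal)
      = ((q * (r - s) : ℝ) : EReal) := fun q => by
    rw [EReal.coe_ennreal_mul, EReal.coe_ennreal_ofReal, max_eq_left hrs.le, EReal.coe_mul]
    rfl
  rw [e1, e1, ← EReal.coe_add, EReal.coe_le_coe_iff] at h7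
  have h8 : 0 < ∫ τ in s..r, (I τ + y - L) := by
    refine intervalIntegral.intervalIntegral_pos_of_pos_on
      (Continuous.intervalIntegrable (by fun_prop) _ _) (fun τ hτ => ?_) hr.1
    have := (hab τ (hsr τ ⟨hτ.1, hτ.2.le⟩)).2.1
    rw [ENNReal.coe_toReal] at this
    linarith
  have h9 : ∫ τ in s..r, (I τ + y - L) = (∫ τ in s..r, I τ) + (y * (r - s) - L * (r - s)) := by
    have : (fun τ => I τ + y - L) = fun τ => I τ + ((y : ℝ) - L) := by
      funext τ
      ring
    rw [this, intervalIntegral.integral_add (hIc.intervalIntegrable _ _)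
      (continuous_const.intervalIntegrable _ _), intervalIntegral.integral_const, smul_eq_mul]
    ring
  rw [h9] at h8
  linarith

/-- `strainGap_add_le` is applied to every y below the dissipation at t, which also proves that the
dissipation is finite. -/
theorem strain_inequality (hm : m.Standing)
    (hv : CylExt m.T m.Ω v vb vt vx) (hE : CylExt m.T m.Ω E Eb Et Ex)
    (hvi : ∀ᵐ s ∂m.μT, ∀ᵐ t ∂m.μT, s < t → m.VariationalInequality E vb vt vx Eb Et Ex s t)
    {Φ Φb : V → SymMat} {D : V → V →L[ℝ] SymMat} (hΦ : HasC1Ext m.Ω Φ Φb D)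
    (hL : m.potential (fun x => dev (Φ x)) ≠ ∞) {t : ℝ} (ht : t ∈ Ioo 0 m.T) :
    m.stressPotential E t ≠ ∞ ∧ m.strainGap vb vx Eb Et Ex Φb t + (m.stressPotential E t).toReal
      ≤ (m.potential fun x => dev (Φ x)).toReal := by
  -- The case y = 0 shows that the bound below is nonnegative, so that passing through
  -- `ENNReal.ofReal` loses nothing.
  have h0 := strainGap_add_le hm hv hE hvi hΦ hL ht (y := 0) (Eventually.of_forall fun _ => by simp)
  rw [NNReal.coe_zero, add_zero] at h0
  have h1 : m.stressPotential E t ≤ ENNReal.ofReal ((m.potential fun x => dev (Φ x)).toReal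
      - m.strainGap vb vx Eb Et Ex Φb t) := by
    refine ENNReal.le_of_forall_nnreal_lt fun y hy => ?_
    have h2 := strainGap_add_le hm hv hE hvi hΦ hL ht
      ((eventually_lt_stressPotential hm hE ht hy).mono fun _ h => h.le)
    rw [← ENNReal.ofReal_coe_nnreal]
    exact ENNReal.ofReal_le_ofReal (by linarith)
  refine ⟨ne_top_of_le_ne_top ENNReal.ofReal_ne_top h1, ?_⟩
  have h3 := ENNReal.toReal_mono ENNReal.ofReal_ne_top h1
  rw [ENNReal.toReal_ofReal (by linarith)] at h3
  linarith

end Model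

namespace Model

variable {m : Model} {v : ℝ → V → V} {vb vt : ℝ × V → V} {vx : ℝ × V → V →L[ℝ] V}
  {E : ℝ → V → SymMat} {Eb Et : ℝ × V → SymMat} {Ex : ℝ × V → V →L[ℝ] SymMat}

theorem potential_zero (hm : m.Standing) : m.potential (fun _ => 0) = 0 :=
  (potential_eq_of_ae_eq (MemLp.zero : MemLp (0 : V → DevMat) 1 _) ae_eq_rfl).trans hm.P_zero

/-- Test fields c g 𝕀 have zero deviatoric part and hence zero potential for every real c. The
inequality is affine in c, so its slope, the integral of g times the trace, must vanish. -/
theorem trace_residual_eq_zero (hm : m.Standing)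
    (hv : CylExt m.T m.Ω v vb vt vx) (hE : CylExt m.T m.Ω E Eb Et Ex)
    (hvi : ∀ᵐ s ∂m.μT, ∀ᵐ t ∂m.μT, s < t → m.VariationalInequality E vb vt vx Eb Et Ex s t)
    {t : ℝ} (ht : t ∈ Ioo 0 m.T) {x : V} (hx : x ∈ m.Ω) :
    (residual (vb (t, x)) (vx (t, x)) (Eb (t, x)) (Et (t, x)) (Ex (t, x)) : Mat).trace = 0 := by
  have hb := isBounded_domain hm
  set Z : V → SymMat := fun x =>
    residual (vb (t, x)) (vx (t, x)) (Eb (t, x)) (Et (t, x)) (Ex (t, x)) with hZ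
  have hZc : Continuous Z :=
    (continuous_residual hv.cont hv.cont_x hE.cont hE.cont_t hE.cont_x).comp
      (Continuous.prodMk_right t)
  have hBc : Continuous fun x => gradSym m.φ (Eb (t, x)) :=
    (continuous_gradSym_comp hm.φ_smooth hE.cont).comp (Continuous.prodMk_right t)
  have hcoe := continuous_coe_comp hZc
  have htr : Continuous fun x => (Z x : Mat).trace := hcoe.matrix_trace
  have hint : ∀ {a : V → ℝ}, Continuous a → IntegrableOn a m.Ω := fun ha =>
    memLp_one_iff_integrable.1 (memLp_of_continuous hm ha 1)
  set b : ℝ := ∫ x in m.Ω, frob (Z x : Mat) (gradSym m.φ (Eb (t, x)) : Mat) with hbdef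
  have key : ∀ g : V → ℝ, ContDiff ℝ 1 g → ∫ x in m.Ω, g x * (Z x : Mat).trace = 0 := by
    intro g hg
    by_contra hne
    set a := ∫ x in m.Ω, g x * (Z x : Mat).trace
    have h1 : ∀ c : ℝ, c * a - b ≤ 0 := by
      intro c
      have hΦ : ContDiff ℝ 1 fun x => (c * g x) • SymMat.one :=
        (contDiff_const.mul hg).smul contDiff_const
      have hdev : (fun x => dev ((c * g x) • SymMat.one)) = fun _ => 0 := by
        funext x
        rw [← devL_apply, map_smul, devL_apply, dev_one_eq_zero, smul_zero]
      have h2 := (strain_inequality hm hv hE hvi (hasC1Ext_of_contDiff hΦ)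
        (by rw [hdev, potential_zero hm]; exact ENNReal.zero_ne_top) ht).2
      rw [hdev, potential_zero hm, ENNReal.toReal_zero] at h2
      have h3 : m.strainGap vb vx Eb Et Ex (fun x => (c * g x) • SymMat.one) t = c * a - b := by
        have i1 : Integrable (fun x => c * (g x * (Z x : Mat).trace)) (volume.restrict m.Ω) :=
          (hint (hg.continuous.mul htr)).const_mul c
        rw [← integral_const_mul, hbdef, ← integral_sub i1
          (hint (continuous_frob_comp hcoe (continuous_coe_comp hBc)))]
        refine integral_congr_ae (ae_of_all _ fun x => ?_)
        have e1 : (((c * g x) • SymMat.one - gradSym m.φ (Eb (t, x)) : SymMat) : Mat)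
            = (c * g x) • (1 : Mat) - (gradSym m.φ (Eb (t, x)) : Mat) := rfl
        simp only [e1, frob_sub_right, frob_trace_one_right, hZ]
        ring
      rw [h3] at h2
      have h4 := ENNReal.toReal_nonneg (a := m.stressPotential E t)
      linarith
    -- This c makes the left-hand side equal to 1.
    have h5 := h1 ((b + 1) / a)
    rw [div_mul_cancel₀ _ hne] at h5
    linarith
  have h6 := ae_eq_of_forall_integral_mul_eq hm.domain.1 (hint htr) (hint continuous_const)
    (b := fun _ => 0) fun g hg _ _ => by
      rw [key g (hg.of_le (by exact_mod_cast le_top))]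
      simp
  exact Measure.eqOn_open_of_ae_eq h6 hm.domain.1 htr.continuousOn continuousOn_const hx

/-- The strain residual is trace-free, so it equals its deviatoric part Ξ, and `strain_inequality`
is the subgradient inequality on C¹ fields. Being bounded, Ξ acts as a continuous functional on L¹,
so the inequality passes to the weak limits of the approximation property. -/
theorem strainInclusion (hm : m.Standing) (hP : m.ApproximationProperty)
    (hv : CylExt m.T m.Ω v vb vt vx) (hE : CylExt m.T m.Ω E Eb Et Ex)
    (hvi : ∀ᵐ s ∂m.μT, ∀ᵐ t ∂m.μT, s < t → m.VariationalInequality E vb vt vx Eb Et Ex s t)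
    {t : ℝ} (ht : t ∈ Ioo 0 m.T) : m.StrainInclusion v E t := by
  have htr := fun x (hx : x ∈ m.Ω) => trace_residual_eq_zero hm hv hE hvi ht hx
  have htI := Ioo_subset_Icc_self ht
  set Z : V → SymMat := fun x =>
    residual (vb (t, x)) (vx (t, x)) (Eb (t, x)) (Et (t, x)) (Ex (t, x)) with hZ
  have hZc : Continuous Z :=
    (continuous_residual hv.cont hv.cont_x hE.cont hE.cont_t hE.cont_x).comp
      (Continuous.prodMk_right t)
  set A : V → DevMat := fun x => devL (gradSym m.φ (Eb (t, x))) with hA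
  have hAc : Continuous A := devL.continuous.comp
    ((continuous_gradSym_comp hm.φ_smooth hE.cont).comp (Continuous.prodMk_right t))
  set Ξ : V → DevMat := fun x => devL (Z x) with hΞ
  have hΞc : Continuous Ξ := devL.continuous.comp hZc
  have hΞp := memLp_of_continuous hm hΞc ∞
  have hAE : (fun x => dev (symPart (m.elasticStress (E t x)))) =ᵐ[volume.restrict m.Ω] A := by
    filter_upwards [ae_restrict_mem hm.domain.1.measurableSet] with x hx
    rw [dev_elasticStress, hE.eqOn t htI x (subset_closure hx)]
    rfl
  have hA1 := memLp_of_continuous hm hAc 1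
  have hAsP : m.potential (fun x => dev (symPart (m.elasticStress (E t x))))
      = m.stressPotential E t := by
    simp only [dev_elasticStress, stressPotential]
  have hsP : m.stressPotential E t ≠ ∞ := by
    have h0 : (fun _ : V => dev 0) = fun _ => 0 := funext fun _ => devL.map_zero
    exact (strain_inequality hm hv hE hvi (hasC1Ext_of_contDiff (contDiff_const (c := 0)))
      (by rw [h0, potential_zero hm]; exact ENNReal.zero_ne_top) ht).1
  set B₀ : DevMat →L[ℝ] DevMat →L[ℝ] ℝ := frobL.bilinearComp devInclL devInclL with hB₀
  have hB₀a : ∀ X Y : DevMat, B₀ X Y = frob (X : Mat) (Y : Mat) := fun _ _ => rfl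
  set ℓ : StrongDual ℝ (Lp DevMat 1 ((volume : Measure V).restrict m.Ω)) :=
    B₀.lpPairing (volume.restrict m.Ω) ∞ 1 (hΞp.toLp Ξ) with hℓ
  have hℓa : ∀ X, ℓ X = ∫ x in m.Ω, frob (Ξ x : Mat) (X x : Mat) := fun X => by
    rw [hℓ, ContinuousLinearMap.lpPairing_eq_integral]
    refine integral_congr_ae ?_
    filter_upwards [hΞp.coeFn_toLp] with x hx
    rw [hx, hB₀a]
  set c := ℓ (hA1.toLp A)
  have hℓsub : ∀ (X : Lp DevMat 1 ((volume : Measure V).restrict m.Ω)) (Y : V → DevMat),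
      X =ᵐ[volume.restrict m.Ω] Y →
      ∫ x in m.Ω, frob (Ξ x : Mat) (Y x - dev (symPart (m.elasticStress (E t x))) : DevMat)
        = ℓ X - c := by
    intro X Y hXY
    rw [← map_sub, hℓa]
    refine integral_congr_ae ?_
    filter_upwards [hXY, hAE, Lp.coeFn_sub X (hA1.toLp A), hA1.coeFn_toLp] with x h1 h2 h3 h4
    rw [h3, Pi.sub_apply, h1, h4, ← h2]
  -- The inequality for classes with a C¹ representative; an infinite potential makes it trivial.
  have hreg : ∀ (X : Lp DevMat 1 ((volume : Measure V).restrict m.Ω)) (Φ : V → DevMat),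
      ContDiffUpTo 1 m.Ω Φ → X =ᵐ[m.μΩ] Φ →
      (((m.stressPotential E t).toReal + (ℓ X - c) : ℝ) : EReal) ≤ (m.P X : EReal) := by
    intro X Φ hΦ hX
    by_cases htop : m.P X = ∞
    · rw [htop, EReal.coe_ennreal_top]
      exact le_top
    obtain ⟨Φb, D, hΦb⟩ := hΦ.exists_hasC1Ext hm.domain.1
    have hdev : (fun x => dev (DevMat.toSym (Φ x))) = Φ := funext fun x => dev_toSym _
    have hpot : m.potential Φ = m.P X := by
      rw [potential_eq_of_ae_eq (Lp.memLp X) hX.symm, Lp.toLp_coeFn]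
    have h1 := (strain_inequality hm hv hE hvi (hΦb.clm_comp DevMat.toSym)
      (by rwa [hdev, hpot]) ht).2
    rw [hdev, hpot] at h1
    have h2 : m.strainGap vb vx Eb Et Ex (fun x => DevMat.toSym (Φb x)) t = ℓ X - c := by
      rw [← hℓsub X Φ hX]
      refine setIntegral_congr_fun hm.domain.1.measurableSet fun x hx => ?_
      have e1 : ((Ξ x : DevMat) : Mat) = (Z x : Mat) := coe_dev_of_trace_eq_zero (htr x hx)
      simp only []
      rw [dev_elasticStress, e1, hE.eqOn t htI x (subset_closure hx),
        ← hΦb.eqOn (subset_closure hx)]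
      have e2 : Φ x - dev (gradSym m.φ (Eb (t, x)))
          = dev (DevMat.toSym (Φ x) - gradSym m.φ (Eb (t, x))) := by
        rw [← devL_apply, ← devL_apply, map_sub, devL_apply (DevMat.toSym _), dev_toSym]
      rw [e2, frob_dev_right (htr x hx)]
    rw [h2] at h1
    rw [← EReal.coe_toReal (x := (m.P X : EReal)) (by simpa using htop) (by simp),
      EReal.coe_le_coe_iff, EReal.toReal_coe_ennreal]
    linarith
  refine ⟨Ξ, ⟨hΞp, (memLp_congr_ae hAE).2 hA1, by rw [hAsP]; exact hsP, fun B hB => ?_⟩,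
    fun x hx => ?_⟩
  · obtain ⟨Bj, hBj, hweak, hlim⟩ := hP (hB.toLp B)
    rw [hAsP, hℓsub (hB.toLp B) B hB.coeFn_toLp, potential_eq_of_ae_eq hB ae_eq_rfl]
    have h1 : (m.stressPotential E t : EReal) = (((m.stressPotential E t).toReal : ℝ) : EReal) := by
      rw [← EReal.toReal_coe_ennreal, EReal.coe_toReal (by simpa using hsP) (by simp)]
    rw [h1, ← EReal.coe_add]
    refine le_of_tendsto_of_tendsto'
      (f := fun j => (((m.stressPotential E t).toReal + (ℓ (Bj j) - c) : ℝ) : EReal)) ?_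
      ((continuous_coe_ennreal_ereal.tendsto _).comp hlim) fun j => ?_
    · exact (continuous_coe_real_ereal.tendsto _).comp
        (tendsto_const_nhds.add ((hweak ℓ).sub tendsto_const_nhds))
    · obtain ⟨Φ, hΦ, hΦB⟩ := hBj j
      exact hreg _ Φ hΦ hΦB
  · have e1 : ((Ξ x : DevMat) : Mat) = (Z x : Mat) := coe_dev_of_trace_eq_zero (htr x hx)
    have hxc := subset_closure hx
    have e2 : deriv (fun τ => (E τ x : Mat)) t = (Et (t, x) : Mat) :=
      (inclL.hasFDerivAt.comp_hasDerivAt t (hE.hasDerivAt t ht x hx)).deriv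
    rw [e1, hZ, coe_residual, jaumannRate, e2,
      (hE.hasFDerivAt t ht x hx).fderiv, (hv.hasFDerivAt t ht x hx).fderiv,
      hv.eqOn t htI x hxc, hE.eqOn t htI x hxc]
    abel

end Model

end ViscoElastoPlastic

end

/-! ### Assembly of the energy identity and the strong system -/

open ViscoElastoPlastic in
theorem proposition3p4 (m : ViscoElastoPlastic.Model) (hm : m.Standing)
    (hP : m.ApproximationProperty)
    (v₀ : V → V) (E₀ : V → SymMat) (h₀ : m.IsInitial v₀ E₀)
    (v : ℝ → V → V) (E : ℝ → V → SymMat) (En : ℝ → ℝ)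
    (hsol : m.IsEnVarSolution v₀ E₀ v E En)
    (hEn : Tendsto En (𝓝[>] 0) (𝓝 (m.energy v₀ E₀)))
    (hv : C1InTime m.T 2 m.Ω v) (hE : C1InTime m.T 1 m.Ω E) :
    (∀ᵐ t ∂m.μT, En t = m.energy (v t) (E t)) ∧ m.IsStrongSolution v₀ E₀ v E := by
  have hb := Model.isBounded_domain hm
  obtain ⟨vb, vt, vx, hv'⟩ := hv.exists_cylExt one_le_two hm.domain.1 hb
  obtain ⟨Eb, Et, Ex, hE'⟩ := hE.exists_cylExt le_rfl hm.domain.1 hb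
  obtain ⟨H, hH, hHd⟩ := hv.exists_second_deriv hm.domain.1 hb
  have hbd := Model.testBoundary_velocity hm hsol hv'
  obtain ⟨K, hK, hred, hfin⟩ := Model.exists_reducedInequality hm hsol hv' hE'
  have he := Model.energy_eq hm h₀ hsol hEn hv' hE' fun T₁ hT₁ =>
    Model.defect_le_integral hm hv' hE' hbd hK hred hfin hT₁
  have hvi := Model.variational_inequality hm hv' hbd hred he
  have hw := Model.weak_momentum hm hE' hfin hvi
  have hR := Model.momentumResidual_add_force hm hv' hE' hH hHd hbd hw
  refine ⟨he, Model.momentumEq_of_residual hm hv' hE' hHd hR,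
    fun t ht => Model.strainInclusion hm hP hv' hE' hvi ht, Model.velocity_eq_zero hm hsol hv',
    Model.inner_velocity_normal hm hsol hv', fun t ht x hx n hn => ?_,
    Model.initial_eq hm h₀ hsol hv' hE'⟩
  exact Model.tractionFree hm hv' hE' hH hHd (fun χ hχ hχb =>
    Model.integral_divg_stress_eq_zero_of_testBoundary hm hv' hE' hH hbd hw hR hχ hχb) ht hx hn
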